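/- Let $\tilde M$ be a complex manifold with complex structure $J$, and let $M\subset\tilde M$ be an embedded smooth generic CR submanifold of type $(n,k)$: $M$ has real dimension $2n+k$, the holomorphic tangent space $H_xM=T_xM\cap JT_xM$ has complex dimension $n$ for every $x\in M$, and $T_xM+JT_xM=T_x\tilde M$ for every $x\in M$ (so $\dim_{\mathbb C}\tilde M=n+k$ if $M\neq\emptyset$). Let $H^0M$ be the characteristic bundle of $M$, whose fibre over $x\in M$ consists of the real covectors on $T_xM$ that vanish on $H_xM$. It is regarded as a subset of $T^*\tilde M$ by identifying it with the set of real covectors at points $x\in M$ that vanish on $JT_xM$. The bundle $T^*\tilde M$ carries its usual complex structure, obtained by identifying a real covector with the complex linear form of which it is the real part. For $\xi\in H^0_xM$ let the Levi form $\mathcal L_\xi$ be the Hermitian form on $H_xM$ with $\mathcal L_\xi(V_x)=\xi([JV,V]_x)$ for all smooth local sections $V$ of $HM$. Let $\dot H^0M$ be the set of nonzero elements of $H^0M$, and let $U$ be an open subset of $\dot H^0M$ such that $\mathcal L_\xi$ has constant (complex) rank $m$ for all $\xi\in U$. Then $U$ is an embedded CR submanifold of $T^*\tilde M$ of type $(n-m,\,2k+2m)$;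 that is, it is a smooth submanifold of real dimension $2(n-m)+2k+2m$ whose holomorphic tangent spaces have complex dimension $n-m$. Moreover, $U$ is Levi flat (its Levi forms at all its characteristic covectors vanish), and it is smoothly foliated by connected injectively immersed complex submanifolds of $T^*\tilde M$ of complex dimension $n-m$. If $m<n$ and $U\neq\emptyset$, then $U$ is not a generic submanifold of $T^*\tilde M$. -/

import Mathlib

open Set Topology
open scoped Manifold ContDiff ComplexConjugate

noncomputable section

namespace CRGeometry

universe u v

/-! ### Real submanifolds of complex manifolds

`Y` is a complex manifold modelled on the complex vector space `F`: a space with an atlas of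
charts in `F` and `IsManifold 𝓘(ℂ, F) ∞ Y` (over `ℂ`, and in finite dimension, being `C^1`,
`C^∞` or analytic are the same: holomorphic).  The underlying real manifold has the same charts
and the model `𝓘(ℝ, F)`. The complex structure of the tangent space is multiplication by
`Complex.I` on `TangentSpace 𝓘(ℂ, F) y`; the types `TangentSpace 𝓘(ℂ, F) y` and
`TangentSpace 𝓘(ℝ, F) y` are the same copy of `F`. -/

section General

variable {F : Type*} [NormedAddCommGroup F] [NormedSpace ℂ F]
  {Y : Type v} [TopologicalSpace Y] [ChartedSpace F Y]

/-- The smooth real manifold underlying a complex manifold. -/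
instance isManifold_real [IsManifold 𝓘(ℂ, F) ∞ Y] : IsManifold 𝓘(ℝ, F) ∞ Y := by
  refine isManifold_of_contDiffOn _ _ _ fun e e' he he' => ?_
  have h := (contDiffGroupoid ∞ 𝓘(ℂ, F)).compatible he he'
  rw [contDiffGroupoid, mem_groupoid_of_pregroupoid] at h
  exact ContDiffOn.restrict_scalars ℝ h.1

/-- The tangent space `T_y S` of a subset `S` of `Y` (meant for smooth submanifolds): the vectors
killed by the differentials of all local smooth functions that vanish on `S`. If `S` is given
near `y` by the equation `ρ = 0`, where `dρ` is onto, this is the kernel of `dρ` at `y`. -/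
def tangentAt (S : Set Y) (y : Y) : Submodule ℝ (TangentSpace 𝓘(ℂ, F) y) where
  carrier := {w | ∀ (W : Set Y) (f : Y → ℝ), IsOpen W → y ∈ W →
    ContMDiffOn 𝓘(ℝ, F) 𝓘(ℝ, ℝ) ∞ f W → (∀ z ∈ S ∩ W, f z = 0) →
      mfderiv 𝓘(ℝ, F) 𝓘(ℝ, ℝ) f y w = 0}
  add_mem' := by
    intro a b ha hb W f hW hy hf h0
    have h := (mfderiv 𝓘(ℝ, F) 𝓘(ℝ, ℝ) f y).map_add a b
    rw [ha W f hW hy hf h0, hb W f hW hy hf h0, add_zero] at h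
    exact h
  zero_mem' := fun W f _ _ _ _ => (mfderiv 𝓘(ℝ, F) 𝓘(ℝ, ℝ) f y).map_zero
  smul_mem' := by
    intro c a ha W f hW hy hf h0
    have h := (mfderiv 𝓘(ℝ, F) 𝓘(ℝ, ℝ) f y).map_smul c a
    rw [ha W f hW hy hf h0, smul_zero] at h
    exact h

/-- The holomorphic tangent space `H_y S = T_y S ∩ J T_y S`, a complex vector space. -/
def crTangentAt (S : Set Y) (y : Y) : Submodule ℂ (TangentSpace 𝓘(ℂ, F) y) where
  carrier := {w | w ∈ tangentAt S y ∧ Complex.I • w ∈ tangentAt S y}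
  add_mem' := by
    rintro a b ⟨ha, ha'⟩ ⟨hb, hb'⟩
    refine ⟨add_mem ha hb, ?_⟩
    rw [smul_add]
    exact add_mem ha' hb'
  zero_mem' := ⟨zero_mem _, by rw [smul_zero]; exact zero_mem _⟩
  smul_mem' := by
    rintro c a ⟨ha, ha'⟩
    have key : ∀ (c : ℂ) (a : TangentSpace 𝓘(ℂ, F) y), a ∈ tangentAt S y →
        Complex.I • a ∈ tangentAt S y → c • a ∈ tangentAt S y := by
      intro c a ha ha'
      have h : c • a = c.re • a + c.im • (Complex.I • a) := by
        conv_lhs => rw [← Complex.re_add_im c]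
        rw [add_smul, mul_smul]
        rfl
      rw [h]
      exact add_mem (Submodule.smul_mem _ _ ha) (Submodule.smul_mem _ _ ha')
    refine ⟨key c a ha ha', ?_⟩
    rw [smul_smul]
    exact key _ a ha ha'

/-- `S` is an embedded smooth real submanifold of `Y` of real dimension `d`: near each of its
points it is the zero set of a smooth submersion to `ℝ^c`, with `d + c = dim_ℝ Y`. -/
def IsSmoothSubmanifold (S : Set Y) (d : ℕ) : Prop :=
  ∀ y ∈ S, ∃ c : ℕ, d + c = Module.finrank ℝ F ∧
    ∃ (W : Set Y) (ρ : Y → (Fin c → ℝ)), IsOpen W ∧ y ∈ W ∧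
      ContMDiffOn 𝓘(ℝ, F) 𝓘(ℝ, Fin c → ℝ) ∞ ρ W ∧
      (∀ z ∈ W, z ∈ S ↔ ρ z = 0) ∧
      ∀ z ∈ S ∩ W, Function.Surjective (mfderiv 𝓘(ℝ, F) 𝓘(ℝ, Fin c → ℝ) ρ z)

/-- `S` is a CR submanifold of type `(n, k)`: an embedded smooth submanifold of real dimension
`2 n + k` whose holomorphic tangent spaces all have complex dimension `n`. (Being of constant
rank, `H S` is then a smooth subbundle of `T S`; formal integrability is inherited from `Y`.) -/
def IsCRSubmanifold (S : Set Y) (n k : ℕ) : Prop :=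
  IsSmoothSubmanifold (F := F) S (2 * n + k) ∧
    ∀ y ∈ S, Module.finrank ℂ (crTangentAt (F := F) S y) = n

/-- `S` is generic: `T_y S + J T_y S = T_y Y` at all points `y` of `S`. -/
def IsGeneric (S : Set Y) : Prop :=
  ∀ y ∈ S, ∀ w : TangentSpace 𝓘(ℂ, F) y,
    ∃ a ∈ tangentAt S y, ∃ b ∈ tangentAt S y, w = a + Complex.I • b

variable [IsManifold 𝓘(ℂ, F) ∞ Y]

/-- `V` restricts to a smooth section of `H S` over `S ∩ W`, where `W` is open in `Y`
(a smooth section over a submanifold always extends locally to the ambient manifold). -/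
structure IsCRSection (S W : Set Y) (V : (y : Y) → TangentSpace 𝓘(ℂ, F) y) : Prop where
  isOpen : IsOpen W
  smooth : ContMDiffOn 𝓘(ℝ, F) 𝓘(ℝ, F).tangent ∞
    (fun y => (⟨y, V y⟩ : TangentBundle 𝓘(ℝ, F) Y)) W
  mem : ∀ y ∈ S ∩ W, V y ∈ crTangentAt S y

/-- `L` is the Levi form of the CR submanifold `S` at the characteristic covector `ξ` at `y`: the
Hermitian form on `H_y S` with `L (V_y, V_y) = ξ ([J V, V]_y)` for all smooth local sections `V`
of `H S`. Only the restriction of `ξ` to `T_y S` matters (it has to vanish on `H_y S`), because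
`[J V, V]` is tangent to `S` and depends on the restriction of `V` to `S` only. -/
def IsLeviForm (S : Set Y) (y : Y) (ξ : TangentSpace 𝓘(ℂ, F) y →ₗ[ℝ] ℝ)
    (L : crTangentAt (F := F) S y →ₗ⋆[ℂ] crTangentAt (F := F) S y →ₗ[ℂ] ℂ) : Prop :=
  (∀ a b, L a b = conj (L b a)) ∧
  ∀ (W : Set Y) (V : (z : Y) → TangentSpace 𝓘(ℂ, F) z) (hV : IsCRSection S W V)
    (hy : y ∈ S ∩ W), L ⟨V y, hV.mem y hy⟩ ⟨V y, hV.mem y hy⟩ =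
      ((ξ (VectorField.mlieBracket 𝓘(ℝ, F) (fun z => Complex.I • V z) V y) : ℝ) : ℂ)

/-- The Levi form of `S` at the characteristic covector `ξ` at `y` has (complex) rank `m`. -/
def HasLeviRank (S : Set Y) (y : Y) (ξ : TangentSpace 𝓘(ℂ, F) y →ₗ[ℝ] ℝ) (m : ℕ) : Prop :=
  ∃ L : crTangentAt (F := F) S y →ₗ⋆[ℂ] crTangentAt (F := F) S y →ₗ[ℂ] ℂ,
    IsLeviForm S y ξ L ∧ Module.finrank ℂ (LinearMap.range L) = m

/-- `S` is Levi flat: its Levi forms at all characteristic covectors vanish. -/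
def IsLeviFlat (S : Set Y) : Prop :=
  ∀ y ∈ S, ∀ ξ : TangentSpace 𝓘(ℂ, F) y →ₗ[ℝ] ℝ,
    (∀ w ∈ crTangentAt (F := F) S y, ξ w = 0) → IsLeviForm S y ξ 0

/-- A smooth foliation of the submanifold `S` of the complex manifold `Y` by complex submanifolds
of `Y` of complex dimension `d`. The leaves are connected complex manifolds with injective
holomorphic immersions into `Y`; they partition `S`. Each point of `S` is in the range of a
foliated chart: a smooth embedding `Ψ` of a product of balls in `ℂ^d × ℝ^q` onto an open piece of
`S`, such that each plaque `Ψ (ball × {t})` is an open piece of one leaf, and `Ψ` is holomorphic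
along the plaques. -/
structure ComplexFoliation (F : Type*) [NormedAddCommGroup F] [NormedSpace ℂ F]
    {Y : Type v} [TopologicalSpace Y] [ChartedSpace F Y] (S : Set Y) (d : ℕ) where
  /-- the index set of the leaves -/
  ι : Type v
  /-- the leaves, as abstract complex manifolds -/
  Leaf : ι → Type v
  [topology : ∀ i, TopologicalSpace (Leaf i)]
  [charted : ∀ i, ChartedSpace (EuclideanSpace ℂ (Fin d)) (Leaf i)]
  [isManifold : ∀ i, IsManifold 𝓘(ℂ, EuclideanSpace ℂ (Fin d)) ∞ (Leaf i)]
  [connected : ∀ i, ConnectedSpace (Leaf i)]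
  /-- the immersions of the leaves -/
  incl : ∀ i, Leaf i → Y
  incl_injective : ∀ i, Function.Injective (incl i)
  incl_holomorphic : ∀ i, ContMDiff 𝓘(ℂ, EuclideanSpace ℂ (Fin d)) 𝓘(ℂ, F) ∞ (incl i)
  incl_immersion : ∀ i a,
    Function.Injective (mfderiv 𝓘(ℂ, EuclideanSpace ℂ (Fin d)) 𝓘(ℂ, F) (incl i) a)
  leaves_disjoint : ∀ i i', i ≠ i' → Disjoint (range (incl i)) (range (incl i'))
  leaves_cover : ⋃ i, range (incl i) = S
  exists_chart : ∀ y ∈ S, ∃ (q : ℕ)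
    (Ψ : EuclideanSpace ℂ (Fin d) × EuclideanSpace ℝ (Fin q) → Y),
    let B : Set (EuclideanSpace ℂ (Fin d)) := Metric.ball 0 1
    let T : Set (EuclideanSpace ℝ (Fin q)) := Metric.ball 0 1
    ContMDiffOn 𝓘(ℝ, EuclideanSpace ℂ (Fin d) × EuclideanSpace ℝ (Fin q)) 𝓘(ℝ, F) ∞ Ψ (B ×ˢ T) ∧
    (∀ a ∈ B ×ˢ T, Function.Injective
      (mfderiv 𝓘(ℝ, EuclideanSpace ℂ (Fin d) × EuclideanSpace ℝ (Fin q)) 𝓘(ℝ, F) Ψ a)) ∧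
    IsEmbedding ((B ×ˢ T).domRestrict Ψ) ∧
    (∃ W : Set Y, IsOpen W ∧ y ∈ W ∧ Ψ '' (B ×ˢ T) = S ∩ W) ∧
    ∀ t ∈ T, ContMDiffOn 𝓘(ℂ, EuclideanSpace ℂ (Fin d)) 𝓘(ℂ, F) ∞ (fun z => Ψ (z, t)) B ∧
      ∃ i, Ψ '' (B ×ˢ {t}) ⊆ range (incl i) ∧ IsOpen (incl i ⁻¹' (Ψ '' (B ×ˢ {t})))

end General

/-! ### The cotangent bundle and the characteristic bundle -/

section Cotangent

variable (E : Type u) [NormedAddCommGroup E] [NormedSpace ℂ E]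
  (X : Type v) [TopologicalSpace X] [ChartedSpace E X] [IsManifold 𝓘(ℂ, E) ∞ X]

/-- The cotangent bundle `T^*X` of a complex manifold with its complex structure. Its points are
pairs of a point `x` and a complex linear form `Φ` on `T_x X`; the real covector that
corresponds to `Φ` is `Re Φ`, and multiplication of `Φ` by `i` corresponds to the
composition of the real covector with the complex structure `J` of `T_x X`. -/
abbrev CotangentBundle : Type (max u v) :=
  Bundle.TotalSpace (E →L[ℂ] ℂ) fun x : X => TangentSpace 𝓘(ℂ, E) x →L[ℂ] Bundle.Trivial X ℂ x

/-- Mathlib's charts of the total space of the bundle of complex linear forms. -/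
instance : ChartedSpace (E × (E →L[ℂ] ℂ)) (CotangentBundle E X) :=
  inferInstanceAs (ChartedSpace (ModelProd E (E →L[ℂ] ℂ)) (CotangentBundle E X))

/-- The cotangent bundle is a complex manifold. -/
instance : IsManifold 𝓘(ℂ, E × (E →L[ℂ] ℂ)) ∞ (CotangentBundle E X) := by
  rw [modelWithCornersSelf_prod]
  exact Bundle.TotalSpace.isManifold (n := ∞) (IB := 𝓘(ℂ, E)) (E →L[ℂ] ℂ)
    (fun x : X => TangentSpace 𝓘(ℂ, E) x →L[ℂ] Bundle.Trivial X ℂ x)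

variable {E X}

/-- The real covector `Re Φ` that corresponds to the complex linear form `Φ`. -/
def realCovector (p : CotangentBundle E X) : TangentSpace 𝓘(ℂ, E) p.proj →ₗ[ℝ] ℝ where
  toFun w := Complex.re (p.snd w)
  map_add' a b := by
    rw [map_add]
    rfl
  map_smul' c a := by
    have h : c • a = (c : ℂ) • a := rfl
    rw [h, map_smul]
    exact Complex.re_ofReal_mul c _

/-- The characteristic bundle `H^0 M` of a generic CR submanifold `M` of `X`, embedded in `T^*X`
as the image under `J^*` of the conormal bundle of `M`: the covectors at points `x` of `M` that
vanish on `J (T_x M)`. They vanish on `H_x M`, and if `M` is generic then restriction to `T_x M`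
identifies them with the real covectors on `T_x M` that vanish on `H_x M`. -/
def characteristicBundle (M : Set X) : Set (CotangentBundle E X) :=
  {p | p.proj ∈ M ∧ ∀ w ∈ tangentAt (F := E) M p.proj, realCovector p (Complex.I • w) = 0}

/-- The nonzero characteristic covectors. -/
def nonzeroCharacteristicBundle (M : Set X) : Set (CotangentBundle E X) :=
  {p | p ∈ characteristicBundle M ∧ realCovector p ≠ 0}

end Cotangent

end CRGeometry

end

/-!
The theorem is local except for the passage to global leaves, and it rests on the fact that the
conormal bundle of `M` is Lagrangian for the imaginary part of the holomorphic symplectic form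
`ω ((a, α), (b, β)) = α b - β a` of `T^*X`.

In a chart let `M` be the zero set of a submersion `ρ`. The characteristic bundle then consists of
the pairs `(x, Φ)` with `ρ x = 0` and `Im Φ = t ∘ Dρ(x)` for some real linear form `t`. If `Q` is the
Hessian of `t ∘ ρ` at `x`, its tangent space at `(x, Φ)` consists of the pairs `(a, α)` with
`a ∈ T_x M` and `Im α = Q(a, ·)` on `T_x M` (`exists_conormal_defining`, `conormalTangent`). As `Q`
is symmetric, `Im ω` vanishes on this space, and the space is maximal with this property. Hence a
tangent vector `v` of `U` is such that `iv` is tangent as well if and only if `Re ω(v, ·) = 0` on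
the tangent space: the holomorphic tangent space of `U` is the null space of the restriction of `ω`
(`mem_holomorphicPart_conormalTangent`). The projection `(a, α) ↦ a` identifies it with the set of
the `a ∈ H_x M` with `Q(a, b) + Q(ia, ib) = 0` for all `b ∈ H_x M`. The Levi form is
`L(V, V) = -(Q(V, V) + Q(iV, iV))` (`levi_eq_hessian`), so this is the null space of the Levi form,
of complex dimension `n - m` (`finrank_holomorphicPart_conormalTangent`).

Because `ω` has constant coefficients in the chart, the null spaces of its restriction to `U` are
involutive (`involutive_kernel`), and this is Levi flatness (`lieBracket_mem_holomorphicPart`).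
Frobenius' theorem gives the foliated charts. It is proved here for a frame of commuting vector
fields `B(·) h` that depends linearly on `h` (`exists_commuting_frame`): the flow `u` with
`∂u/∂z = B(u)` is obtained from the inverse function theorem in a space of continuous curves
(`exists_commuting_flow`). Along the plaques the charts have complex linear differentials, hence
they are holomorphic (`exists_flat_foliated_chart`).

The transverse coordinates of one chart are locally constant on the plaques of another one, since
their differentials vanish on the holomorphic tangent spaces (`FoliatedChart.τ_eventually_eq`).
Therefore the plaques are the charts of a complex manifold structure on the set `U` with a finer
topology (`LeafSpace`), and the leaves are the connected components of this space. Finally, a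
generic submanifold of the dimension of `U` has holomorphic tangent spaces of dimension zero
(`IsDefiningFunction.finrank_eq`), so that `U` is not generic if `m < n`.
-/

noncomputable section

namespace CRGeometry

universe u v

/-! ### Smoothness of substitution operators -/

section Substitution

variable {K : Type*} [TopologicalSpace K] [CompactSpace K]
  {A : Type u} [NormedAddCommGroup A] [NormedSpace ℝ A]
  {A' : Type u} [NormedAddCommGroup A'] [NormedSpace ℝ A']

/-- The bilinear map `(T, v) ↦ β (T(·), v(·))` on continuous functions induced by a bilinear
map `β`. -/
def pointwise {A₁ A₂ A₃ : Type*} [NormedAddCommGroup A₁] [NormedSpace ℝ A₁]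
    [NormedAddCommGroup A₂] [NormedSpace ℝ A₂] [NormedAddCommGroup A₃] [NormedSpace ℝ A₃]
    (K : Type*) [TopologicalSpace K] [CompactSpace K] (β : A₁ →L[ℝ] A₂ →L[ℝ] A₃) :
    C(K, A₁) →L[ℝ] C(K, A₂) →L[ℝ] C(K, A₃) :=
  LinearMap.mkContinuous₂
    (LinearMap.mk₂ ℝ (fun (T : C(K, A₁)) (v : C(K, A₂)) =>
        (⟨fun s => β (T s) (v s), by fun_prop⟩ : C(K, A₃)))
      (fun _ _ _ => by ext; simp) (fun _ _ _ => by ext; simp)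
      (fun _ _ _ => by ext; simp) (fun _ _ _ => by ext; simp)) ‖β‖ (by
    intro T v
    rw [ContinuousMap.norm_le _ (by positivity)]
    intro s
    refine (β.le_opNorm₂ _ _).trans ?_
    gcongr
    exacts [T.norm_coe_le_norm s, v.norm_coe_le_norm s])

section

variable {A₁ A₂ A₃ P : Type*} [NormedAddCommGroup A₁] [NormedSpace ℝ A₁]
  [NormedAddCommGroup A₂] [NormedSpace ℝ A₂] [NormedAddCommGroup A₃] [NormedSpace ℝ A₃]
  [NormedAddCommGroup P] [NormedSpace ℝ P] (β : A₁ →L[ℝ] A₂ →L[ℝ] A₃)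

lemma contDiff_pointwise {T : P → C(K, A₁)} {v : P → C(K, A₂)} (hT : ContDiff ℝ ∞ T)
    (hv : ContDiff ℝ ∞ v) : ContDiff ℝ ∞ fun p => pointwise K β (T p) (v p) :=
  ((pointwise K β).contDiff.comp hT).clm_apply hv

lemma hasFDerivAt_pointwise {T : P → C(K, A₁)} {v : P → C(K, A₂)} {p : P}
    {T' : P →L[ℝ] C(K, A₁)} {v' : P →L[ℝ] C(K, A₂)} (hT : HasFDerivAt T T' p)
    (hv : HasFDerivAt v v' p) : HasFDerivAt (fun p => pointwise K β (T p) (v p))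
      ((pointwise K β (T p)).comp v' + ((pointwise K β).flip (v p)).comp T') p :=
  ((pointwise K β).hasFDerivAt.comp p hT).clm_apply hv

end

/-- Pointwise application of a continuous family of operators to a continuous function. -/
def pointwiseApply (K : Type*) [TopologicalSpace K] [CompactSpace K] (A : Type u)
    [NormedAddCommGroup A] [NormedSpace ℝ A] (A' : Type u) [NormedAddCommGroup A']
    [NormedSpace ℝ A'] :
    C(K, A →L[ℝ] A') →L[ℝ] C(K, A) →L[ℝ] C(K, A') :=
  pointwise K (ContinuousLinearMap.id ℝ (A →L[ℝ] A'))

@[simp] lemma pointwiseApply_apply (T : C(K, A →L[ℝ] A')) (v : C(K, A)) (s : K) :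
    pointwiseApply K A A' T v s = T s (v s) := rfl

lemma norm_pointwiseApply_le (T : C(K, A →L[ℝ] A')) (v : C(K, A)) :
    ‖pointwiseApply K A A' T v‖ ≤ ‖T‖ * ‖v‖ := by
  rw [ContinuousMap.norm_le _ (by positivity)]
  intro s
  exact ((T s).le_opNorm _).trans
    (mul_le_mul (T.norm_coe_le_norm s) (v.norm_coe_le_norm s) (norm_nonneg _) (by positivity))

/-- The substitution operator `v ↦ f ∘ v` on spaces of continuous functions. -/
def substitution (f : C(A, A')) (v : C(K, A)) : C(K, A') := f.comp v

omit [CompactSpace K] [NormedSpace ℝ A] [NormedSpace ℝ A'] in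
@[simp] lemma substitution_apply (f : C(A, A')) (v : C(K, A)) (s : K) :
    substitution f v s = f (v s) := rfl

lemma hasFDerivAt_substitution (f : C(A, A')) (f' : C(A, A →L[ℝ] A'))
    (hf : ∀ x, HasFDerivAt f (f' x) x) (v : C(K, A)) :
    HasFDerivAt (substitution (K := K) f) (pointwiseApply K A A' (substitution f' v)) v := by
  rw [hasFDerivAt_iff_isLittleO_nhds_zero, Asymptotics.isLittleO_iff]
  intro ε hε
  have hc : Continuous (substitution (K := K) f') := ContinuousMap.continuous_postcomp f'
  obtain ⟨δ, hδ, h⟩ := Metric.continuous_iff.1 hc v ε hε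
  filter_upwards [Metric.ball_mem_nhds (0 : C(K, A)) hδ] with w hw
  rw [mem_ball_zero_iff] at hw
  rw [ContinuousMap.norm_le _ (by positivity)]
  intro s
  have key := Convex.norm_image_sub_le_of_norm_hasFDerivWithin_le' (f := f) (f' := f')
    (φ := f' (v s)) (C := ε) (s := segment ℝ (v s) (v s + w s)) (x := v s) (y := v s + w s)
    (fun x _ => (hf x).hasFDerivWithinAt) ?_ (convex_segment _ _) (left_mem_segment _ _ _)
    (right_mem_segment _ _ _)
  · rw [add_sub_cancel_left] at key
    exact key.trans (mul_le_mul_of_nonneg_left (w.norm_coe_le_norm s) hε.le)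
  · rintro x hx
    rw [segment_eq_image'] at hx
    obtain ⟨θ, hθ, rfl⟩ := hx
    have h1 : dist (v + θ • w) v < δ := by
      rw [dist_eq_norm, add_sub_cancel_left, norm_smul, Real.norm_of_nonneg hθ.1]
      exact (mul_le_of_le_one_left (norm_nonneg _) hθ.2).trans_lt hw
    have h2 := (h _ h1).le
    rw [dist_eq_norm] at h2
    have h3 := (ContinuousMap.norm_coe_le_norm _ s).trans h2
    simpa using h3

lemma contDiff_substitution (f : C(A, A')) (hf : ContDiff ℝ ∞ f) :
    ContDiff ℝ ∞ (substitution (K := K) f) := by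
  rw [contDiff_infty]
  intro n
  induction n generalizing A' with
  | zero => exact contDiff_zero.2 (ContinuousMap.continuous_postcomp f)
  | succ n ih =>
    have h1 := (contDiff_infty_iff_fderiv.1 hf)
    rw [Nat.cast_add, Nat.cast_one, contDiff_succ_iff_hasFDerivAt]
    refine ⟨_, ?_, hasFDerivAt_substitution (K := K) f ⟨fderiv ℝ f, h1.2.continuous⟩
      (fun x => (h1.1 x).hasFDerivAt)⟩
    exact (pointwiseApply K A A').contDiff.comp (ih ⟨fderiv ℝ f, h1.2.continuous⟩ h1.2)

end Substitution

/-! ### The inverse function theorem on open sets -/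

/-- The inverse function theorem with smoothness of the inverse on a whole neighbourhood
(smoothness of class `C^∞` at a single point would not give this). -/
lemma exists_openPartialHomeomorph {A A' : Type*} [NormedAddCommGroup A] [NormedSpace ℝ A]
    [CompleteSpace A] [NormedAddCommGroup A'] [NormedSpace ℝ A'] {f : A → A'} {O : Set A}
    (hO : IsOpen O) (hf : ContDiffOn ℝ ∞ f O) {a : A} (ha : a ∈ O) (f' : A ≃L[ℝ] A')
    (hf' : fderiv ℝ f a = f') :
    ∃ e : OpenPartialHomeomorph A A', a ∈ e.source ∧ e.source ⊆ O ∧ (∀ x, e x = f x) ∧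
      ContDiffOn ℝ ∞ e.symm e.target := by
  have hfa : ContDiffAt ℝ ∞ f a := hf.contDiffAt (hO.mem_nhds ha)
  have hd : HasFDerivAt f (f' : A →L[ℝ] A') a := by
    rw [← hf']
    exact (hfa.differentiableAt (by simp)).hasFDerivAt
  set e₀ := hfa.toOpenPartialHomeomorph f hd (by simp) with he₀
  have hcont : ContinuousOn (fderiv ℝ f) O := hf.continuousOn_fderiv_of_isOpen hO (by simp)
  set N : Set A := O ∩ fderiv ℝ f ⁻¹' range ContinuousLinearEquiv.toContinuousLinearMap
  have hN : IsOpen N := hcont.isOpen_inter_preimage hO ContinuousLinearEquiv.isOpen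
  have haN : a ∈ N := ⟨ha, f', hf'.symm⟩
  refine ⟨e₀.restrOpen N hN, ⟨hfa.mem_toOpenPartialHomeomorph_source hd (by simp), haN⟩,
    fun x hx => hx.2.1, fun x => rfl, ?_⟩
  intro y hy
  have hx := (e₀.restrOpen N hN).map_target hy
  obtain ⟨g, hg⟩ := hx.2.2
  have hxO := hf.contDiffAt (hO.mem_nhds hx.2.1)
  refine ((e₀.restrOpen N hN).contDiffAt_symm (f₀' := g) hy ?_ hxO).contDiffWithinAt
  rw [hg]
  exact (hxO.differentiableAt (by simp)).hasFDerivAt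

/-! ### Flows of commuting vector fields -/

section Flow

variable {R : Type u} [NormedAddCommGroup R] [NormedSpace ℝ R]

/-- The operator `g ↦ ∫₀ˢ g` on continuous functions on `[0, 1]`. -/
def primitive (R : Type u) [NormedAddCommGroup R] [NormedSpace ℝ R] :
    C(Icc (0 : ℝ) 1, R) →L[ℝ] C(Icc (0 : ℝ) 1, R) :=
  LinearMap.mkContinuous
    { toFun := fun g => ⟨fun s => ∫ σ in (0 : ℝ)..s, g (projIcc 0 1 zero_le_one σ), by
        have h : Continuous fun σ => g (projIcc 0 1 zero_le_one σ) :=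
          g.continuous.comp continuous_projIcc
        exact (intervalIntegral.continuous_primitive (fun a b => h.intervalIntegrable a b) 0).comp
          continuous_subtype_val⟩
      map_add' := fun f g => by
        ext s
        have h : ∀ g : C(Icc (0 : ℝ) 1, R), Continuous fun σ => g (projIcc 0 1 zero_le_one σ) :=
          fun g => g.continuous.comp continuous_projIcc
        simpa using intervalIntegral.integral_add ((h f).intervalIntegrable 0 s)
          ((h g).intervalIntegrable 0 s)
      map_smul' := fun c g => by
        ext s
        simp } 1 (by
    intro g
    rw [one_mul, ContinuousMap.norm_le _ (norm_nonneg g)]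
    intro s
    have h := intervalIntegral.norm_integral_le_of_norm_le_const (a := (0 : ℝ)) (b := s)
      (f := fun σ => g (projIcc 0 1 zero_le_one σ)) (C := ‖g‖)
      (fun σ _ => g.norm_coe_le_norm _)
    refine h.trans (mul_le_of_le_one_right (norm_nonneg _) ?_)
    rw [sub_zero, abs_of_nonneg s.2.1]
    exact s.2.2)

lemma primitive_apply (g : C(Icc (0 : ℝ) 1, R)) (s : Icc (0 : ℝ) 1) :
    primitive R g s = ∫ σ in (0 : ℝ)..s, g (projIcc 0 1 zero_le_one σ) := rfl

lemma norm_primitive_le (g : C(Icc (0 : ℝ) 1, R)) : ‖primitive R g‖ ≤ ‖g‖ := by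
  simpa using (primitive R).le_of_opNorm_le (LinearMap.mkContinuous_norm_le _ zero_le_one _) g

/-- Constant functions on `[0, 1]`. -/
def constantFun (R : Type u) [NormedAddCommGroup R] [NormedSpace ℝ R] :
    R →L[ℝ] C(Icc (0 : ℝ) 1, R) :=
  LinearMap.mkContinuous
    { toFun := fun r => ContinuousMap.const _ r
      map_add' := fun _ _ => rfl
      map_smul' := fun _ _ => rfl } 1 (by
    intro r
    rw [one_mul, ContinuousMap.norm_le _ (norm_nonneg r)]
    intro s
    exact le_rfl)

@[simp] lemma constantFun_apply (r : R) (s : Icc (0 : ℝ) 1) : constantFun R r s = r := rfl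

variable {Z : Type u} [NormedAddCommGroup Z] [NormedSpace ℝ Z]

/-- The defect `v(s) - t - ∫₀ˢ B(v) z` of the integral equation of the integral curves of the
vector field `B(·) z` with initial value `t`. -/
def flowDefect (B : C(R, Z →L[ℝ] R)) (p : Z × R × C(Icc (0 : ℝ) 1, R)) : C(Icc (0 : ℝ) 1, R) :=
  p.2.2 - constantFun R p.2.1 -
    primitive R (pointwiseApply _ Z R (substitution B p.2.2) (constantFun Z p.1))

lemma contDiff_flowDefect (B : C(R, Z →L[ℝ] R)) (hB : ContDiff ℝ ∞ B) :
    ContDiff ℝ ∞ (flowDefect B) := by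
  have h1 : ContDiff ℝ ∞ fun p : Z × R × C(Icc (0 : ℝ) 1, R) => substitution B p.2.2 :=
    (contDiff_substitution B hB).comp (contDiff_snd.comp contDiff_snd)
  have h1'' : ContDiff ℝ ∞ fun p : Z × R × C(Icc (0 : ℝ) 1, R) => constantFun Z p.1 :=
    (constantFun Z).contDiff.comp contDiff_fst
  have h2 : ContDiff ℝ ∞ fun p : Z × R × C(Icc (0 : ℝ) 1, R) =>
      pointwiseApply _ Z R (substitution B p.2.2) (constantFun Z p.1) :=
    contDiff_pointwise _ h1 h1''
  have h3 := (primitive R).contDiff.comp h2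
  exact ((contDiff_snd.comp contDiff_snd).sub
    ((constantFun R).contDiff.comp (contDiff_fst.comp contDiff_snd))).sub h3

/-- The differential of the defect of the integral equation. -/
lemma hasFDerivAt_flowDefect (B : C(R, Z →L[ℝ] R)) (B' : C(R, R →L[ℝ] Z →L[ℝ] R))
    (hB : ∀ x, HasFDerivAt B (B' x) x) (p : Z × R × C(Icc (0 : ℝ) 1, R)) :
    ∃ L : (Z × R × C(Icc (0 : ℝ) 1, R)) →L[ℝ] C(Icc (0 : ℝ) 1, R),
      HasFDerivAt (flowDefect B) L p ∧ ∀ q, L q = q.2.2 - constantFun R q.2.1 -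
        primitive R (pointwiseApply _ Z R (substitution B p.2.2) (constantFun Z q.1) +
          pointwiseApply _ Z R (pointwiseApply _ R (Z →L[ℝ] R) (substitution B' p.2.2) q.2.2)
            (constantFun Z p.1)) := by
  have h1 := (hasFDerivAt_substitution (K := Icc (0 : ℝ) 1) B B' hB p.2.2).comp p
    (hasFDerivAt_snd.comp p hasFDerivAt_snd)
  have h1'' := ((constantFun Z).hasFDerivAt (x := p.1)).comp p
    (hasFDerivAt_fst (𝕜 := ℝ) (E := Z) (F := R × C(Icc (0 : ℝ) 1, R)))
  have h2 := hasFDerivAt_pointwise (ContinuousLinearMap.id ℝ (Z →L[ℝ] R)) h1 h1''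
  have h3 := (primitive R).hasFDerivAt.comp p h2
  have h4 := (((hasFDerivAt_snd (𝕜 := ℝ)).comp p hasFDerivAt_snd).sub
    ((constantFun R).hasFDerivAt.comp p (hasFDerivAt_fst.comp p hasFDerivAt_snd))).sub h3
  refine ⟨_, h4, fun q => ?_⟩
  simp [Function.comp_def]
  rfl

end Flow

section Flow

variable {R : Type u} [NormedAddCommGroup R] [NormedSpace ℝ R] [CompleteSpace R]
  {Z : Type u} [NormedAddCommGroup Z] [NormedSpace ℝ Z] [CompleteSpace Z]

omit [CompleteSpace Z] in
/-- Let `v` solve `v' = B(v) z`. If `B(·) z` and `B(·) h` commute along `v`, then `s ↦ s B(v(s)) h`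
solves the variational equation for the derivative of the flow in the direction `h` of the
parameter `z`. -/
lemma variational_equation (B : C(R, Z →L[ℝ] R)) (B' : C(R, R →L[ℝ] Z →L[ℝ] R))
    (hB : ∀ x, HasFDerivAt B (B' x) x) (z h : Z) (t : R) (v : C(Icc (0 : ℝ) 1, R))
    (hv : flowDefect B (z, t, v) = 0)
    (hcomm : ∀ s, B' (v s) (B (v s) z) h = B' (v s) (B (v s) h) z)
    (b : C(Icc (0 : ℝ) 1, R)) (hb : ∀ s, b s = (s : ℝ) • B (v s) h) :
    b = primitive R (pointwiseApply _ Z R (substitution B v) (constantFun Z h) +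
      pointwiseApply _ Z R (pointwiseApply _ R (Z →L[ℝ] R) (substitution B' v) b)
        (constantFun Z z)) := by
  set π : ℝ → Icc (0 : ℝ) 1 := projIcc 0 1 zero_le_one with hπ
  have hπc : Continuous π := continuous_projIcc
  -- the solution extended to the real line
  set V : ℝ → R := fun s => t + ∫ σ in (0 : ℝ)..s, B (v (π σ)) z with hV
  have hVc : Continuous fun σ => B (v (π σ)) z := by fun_prop
  have hVd : ∀ s, HasDerivAt V (B (v (π s)) z) s := fun s =>
    (hVc.integral_hasStrictDerivAt 0 s).hasDerivAt.const_add t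
  have hvV : ∀ s : Icc (0 : ℝ) 1, V s = v s := by
    intro s
    have h1 := congrArg (fun g : C(Icc (0 : ℝ) 1, R) => g s) hv
    simp only [flowDefect, ContinuousMap.sub_apply, constantFun_apply, primitive_apply,
      pointwiseApply_apply, substitution_apply, ContinuousMap.zero_apply] at h1
    simp only [hV]
    rw [sub_sub, sub_eq_zero] at h1
    exact h1.symm
  ext s
  rw [primitive_apply]
  simp only [ContinuousMap.add_apply, pointwiseApply_apply, substitution_apply, constantFun_apply]
  have hd : ∀ σ ∈ uIcc (0 : ℝ) s, HasDerivAt (fun σ => σ • B (V σ) h)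
      (B (v (π σ)) h + B' (v (π σ)) (b (π σ)) z) σ := by
    intro σ hσ
    rw [uIcc_of_le s.2.1] at hσ
    have hσ' : σ ∈ Icc (0 : ℝ) 1 := ⟨hσ.1, hσ.2.trans s.2.2⟩
    have hπσ : π σ = ⟨σ, hσ'⟩ := projIcc_of_mem zero_le_one hσ'
    have e1 : V σ = v (π σ) := by rw [hπσ]; exact hvV ⟨σ, hσ'⟩
    have h1 : HasDerivAt (fun σ => B (V σ)) (B' (V σ) (B (v (π σ)) z)) σ :=
      (hB (V σ)).comp_hasDerivAt σ (hVd σ)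
    have h2 := (hasDerivAt_id σ).smul (h1.clm_apply (hasDerivAt_const σ h))
    refine h2.congr_deriv ?_
    rw [hb, e1, hcomm, hπσ]
    simp [add_comm]
  have hcont : Continuous fun σ => B (v (π σ)) h + B' (v (π σ)) (b (π σ)) z := by fun_prop
  rw [intervalIntegral.integral_eq_sub_of_hasDerivAt hd (hcont.intervalIntegrable _ _)]
  rw [hb, hvV]
  simp

omit [CompleteSpace R] [CompleteSpace Z] in
/-- For small `z`, the variational equation has at most one solution: the difference of two
solutions is a fixed point of a contraction. -/
lemma eq_of_variational_equation (B' : C(R, R →L[ℝ] Z →L[ℝ] R)) (z h : Z)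
    (v : C(Icc (0 : ℝ) 1, R)) (T : C(Icc (0 : ℝ) 1, Z →L[ℝ] R))
    (hz : ‖substitution (A' := R →L[ℝ] Z →L[ℝ] R) B' v‖ * ‖z‖ < 1) (a b : C(Icc (0 : ℝ) 1, R))
    (ha : a = primitive R (pointwiseApply _ Z R T (constantFun Z h) +
      pointwiseApply _ Z R (pointwiseApply _ R (Z →L[ℝ] R) (substitution B' v) a)
        (constantFun Z z)))
    (hb : b = primitive R (pointwiseApply _ Z R T (constantFun Z h) +
      pointwiseApply _ Z R (pointwiseApply _ R (Z →L[ℝ] R) (substitution B' v) b)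
        (constantFun Z z))) : a = b := by
  have hdiff : a - b = primitive R (pointwiseApply _ Z R
      (pointwiseApply _ R (Z →L[ℝ] R) (substitution B' v) (a - b)) (constantFun Z z)) := by
    conv_lhs => rw [ha, hb]
    rw [← map_sub, add_sub_add_left_eq_sub]
    refine congrArg _ (ContinuousMap.ext fun s => ?_)
    simp only [ContinuousMap.sub_apply, pointwiseApply_apply, map_sub]
    rfl
  have hn : ‖a - b‖ ≤ ‖substitution (A' := R →L[ℝ] Z →L[ℝ] R) B' v‖ * ‖z‖ * ‖a - b‖ := by
    conv_lhs => rw [hdiff]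
    refine (norm_primitive_le _).trans ((norm_pointwiseApply_le _ _).trans ?_)
    have h1 : ‖constantFun Z z‖ ≤ ‖z‖ := by
      rw [ContinuousMap.norm_le _ (norm_nonneg _)]
      exact fun s => le_rfl
    have h2 := norm_pointwiseApply_le (A' := Z →L[ℝ] R) (substitution B' v) (a - b)
    calc _ ≤ (‖substitution (A' := R →L[ℝ] Z →L[ℝ] R) B' v‖ * ‖a - b‖) * ‖z‖ :=
          mul_le_mul h2 h1 (norm_nonneg _) (by positivity)
      _ = _ := by ring
  by_contra hne
  have hpos : 0 < ‖a - b‖ := norm_pos_iff.2 (sub_ne_zero.2 hne)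
  exact absurd hn (not_le.2 (mul_lt_of_lt_one_left hpos hz))

/-- The joint flow of commuting vector fields `B(·) z`, which depend linearly on `z`: the value
`u (z, t)` is the time-one value of the integral curve of `B(·) z` with initial value `t`, and it
solves the total differential equation `∂u/∂z = B(u)`. This is the analytic content of Frobenius'
theorem. -/
theorem exists_commuting_flow (B : C(R, Z →L[ℝ] R)) (hB : ContDiff ℝ ∞ B) (t₀ : R)
    (hcomm : ∀ᶠ y in 𝓝 t₀, ∀ z h, fderiv ℝ B y (B y z) h = fderiv ℝ B y (B y h) z) :
    ∃ (u : Z × R → R) (N : Set (Z × R)), IsOpen N ∧ (0, t₀) ∈ N ∧ ContDiffOn ℝ ∞ u N ∧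
      (∀ t, (0, t) ∈ N → u (0, t) = t) ∧
      ∀ p ∈ N, HasFDerivAt (fun z => u (z, p.2)) (B (u p)) p.1 := by
  obtain ⟨hBd, hB1⟩ := contDiff_infty_iff_fderiv.1 hB
  set B' : C(R, R →L[ℝ] Z →L[ℝ] R) := ⟨fderiv ℝ B, hB1.continuous⟩ with hB'def
  have hB' : ∀ x, HasFDerivAt B (B' x) x := fun x => (hBd x).hasFDerivAt
  obtain ⟨δ, hδ, hδc⟩ := Metric.eventually_nhds_iff.1 hcomm
  set K := C(Icc (0 : ℝ) 1, R)
  set g := flowDefect B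
  have hg : ContDiff ℝ ∞ g := contDiff_flowDefect B hB
  -- the map to which the inverse function theorem is applied
  set Θ : Z × R × K → Z × R × K := fun p => (p.1, p.2.1, g p) with hΘ
  have hΘs : ContDiff ℝ ∞ Θ := contDiff_fst.prodMk ((contDiff_fst.comp contDiff_snd).prodMk hg)
  set p₀ : Z × R × K := (0, t₀, constantFun R t₀) with hp₀
  set J : Z →L[ℝ] K := (primitive R).comp
    ((pointwiseApply _ Z R (substitution B (constantFun R t₀))).comp (constantFun Z)) with hJ
  have hC₀ : ∃ C₀ : R →L[ℝ] K, ∀ t, C₀ t = constantFun R t := ⟨constantFun R, fun _ => rfl⟩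
  obtain ⟨C₀, hC₀⟩ := hC₀
  set Θ' : (Z × R × K) ≃L[ℝ] (Z × R × K) := ContinuousLinearEquiv.equivOfInverse
    ((ContinuousLinearMap.fst ℝ Z (R × K)).prod
      (((ContinuousLinearMap.fst ℝ R K).comp (ContinuousLinearMap.snd ℝ Z (R × K))).prod
        ((ContinuousLinearMap.snd ℝ R K).comp (ContinuousLinearMap.snd ℝ Z (R × K)) -
          C₀.comp ((ContinuousLinearMap.fst ℝ R K).comp (ContinuousLinearMap.snd ℝ Z (R × K))) -
          J.comp (ContinuousLinearMap.fst ℝ Z (R × K)))))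
    ((ContinuousLinearMap.fst ℝ Z (R × K)).prod
      (((ContinuousLinearMap.fst ℝ R K).comp (ContinuousLinearMap.snd ℝ Z (R × K))).prod
        ((ContinuousLinearMap.snd ℝ R K).comp (ContinuousLinearMap.snd ℝ Z (R × K)) +
          C₀.comp ((ContinuousLinearMap.fst ℝ R K).comp (ContinuousLinearMap.snd ℝ Z (R × K))) +
          J.comp (ContinuousLinearMap.fst ℝ Z (R × K)))))
    (fun p => by
      refine Prod.ext rfl (Prod.ext rfl ?_)
      simp
      abel) (fun p => by
      refine Prod.ext rfl (Prod.ext rfl ?_)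
      simp
      abel) with hΘ'
  have hΘd : fderiv ℝ Θ p₀ = Θ' := by
    obtain ⟨L, hL, hLq⟩ := hasFDerivAt_flowDefect B B' hB' p₀
    have h1 : HasFDerivAt Θ _ p₀ := (hasFDerivAt_fst (𝕜 := ℝ) (p := p₀)).prodMk
      (((hasFDerivAt_fst (𝕜 := ℝ)).comp p₀ hasFDerivAt_snd).prodMk hL)
    rw [h1.fderiv]
    refine ContinuousLinearMap.ext fun q => Prod.ext rfl (Prod.ext rfl ?_)
    change L q = q.2.2 - C₀ q.2.1 - J q.1
    rw [hLq, hC₀]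
    simp only [hp₀, map_zero, add_zero]
    rfl
  obtain ⟨e₀, hp₀e, -, he₀, he₀s⟩ :=
    exists_openPartialHomeomorph isOpen_univ hΘs.contDiffOn (mem_univ p₀) Θ' hΘd
  -- the region where the derivative of the flow is determined by the variational equation
  set S : Set (Z × R × K) := {p | ‖substitution (A' := R →L[ℝ] Z →L[ℝ] R) B' p.2.2‖ * ‖p.1‖ < 1 ∧
    ‖p.2.2 - constantFun R t₀‖ < δ} with hS
  have hSo : IsOpen S := by
    have hc : Continuous fun p : Z × R × K => substitution (A' := R →L[ℝ] Z →L[ℝ] R) B' p.2.2 :=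
      (ContinuousMap.continuous_postcomp B').comp (continuous_snd.comp continuous_snd)
    exact (isOpen_lt (hc.norm.mul continuous_fst.norm) continuous_const).inter
      (isOpen_lt ((continuous_snd.comp continuous_snd).sub continuous_const).norm
        continuous_const)
  have hp₀S : p₀ ∈ S := by
    simpa [hS, hp₀] using hδ
  set e := e₀.restrOpen S hSo with he
  have hes : ContDiffOn ℝ ∞ e.symm e.target := he₀s.mono (by
    intro y hy
    exact hy.1)
  have heΘ : ∀ p, e p = Θ p := he₀
  set ι : Z × R → Z × R × K := fun p => (p.1, p.2, 0)
  have hι : ContDiff ℝ ∞ ι := contDiff_fst.prodMk (contDiff_snd.prodMk contDiff_const)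
  set N : Set (Z × R) := ι ⁻¹' e.target
  have hNo : IsOpen N := e.open_target.preimage hι.continuous
  set ψ : Z × R → K := fun p => (e.symm (ι p)).2.2 with hψ
  have hψs : ContDiffOn ℝ ∞ ψ N :=
    (contDiff_snd.comp contDiff_snd).comp_contDiffOn (hes.comp hι.contDiffOn fun p hp => hp)
  have key : ∀ p ∈ N, e.symm (ι p) = (p.1, p.2, ψ p) ∧ (p.1, p.2, ψ p) ∈ S ∧
      g (p.1, p.2, ψ p) = 0 := by
    intro p hp
    have h1 : Θ (e.symm (ι p)) = ι p := by rw [← heΘ]; exact e.right_inv hp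
    have h2 : e.symm (ι p) = (p.1, p.2, ψ p) :=
      have h3 : (e.symm (ι p)).1 = p.1 := congrArg Prod.fst h1
      have h4 : (e.symm (ι p)).2.1 = p.2 := congrArg (fun q => q.2.1) h1
      Prod.ext h3 (Prod.ext h4 rfl)
    refine ⟨h2, ?_, ?_⟩
    · rw [← h2]
      exact (e.map_target hp).2
    · rw [← h2]
      exact congrArg (fun q => q.2.2) h1
  have hg0 : ∀ (t : R) (v : K), g (0, t, v) = v - constantFun R t := by
    intro t v
    simp [g, flowDefect]
  refine ⟨fun p => ψ p 1, N, hNo, ?_, ?_, ?_, ?_⟩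
  · have h1 : e p₀ = ι (0, t₀) := by
      rw [heΘ]
      refine Prod.ext rfl (Prod.ext rfl ?_)
      change g p₀ = 0
      rw [hp₀, hg0, sub_self]
    change ι (0, t₀) ∈ e.target
    rw [← h1]
    exact e.map_source ⟨hp₀e, hp₀S⟩
  · exact (ContinuousMap.evalCLM ℝ (1 : Icc (0 : ℝ) 1)).contDiff.comp_contDiffOn hψs
  · intro t ht
    have h1 := (key _ ht).2.2
    rw [hg0, sub_eq_zero] at h1
    change ψ (0, t) 1 = t
    rw [h1]
    rfl
  · intro p hp
    obtain ⟨-, ⟨hpS1, hpS2⟩, hgp⟩ := key p hp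
    have hψd : DifferentiableAt ℝ ψ p :=
      (hψs.contDiffAt (hNo.mem_nhds hp)).differentiableAt (by simp)
    have hj : HasFDerivAt (fun z : Z => (z, p.2)) (ContinuousLinearMap.inl ℝ Z R) p.1 :=
      hasFDerivAt_prodMk_left p.1 p.2
    have hψz : HasFDerivAt (fun z => ψ (z, p.2))
        ((fderiv ℝ ψ p).comp (ContinuousLinearMap.inl ℝ Z R)) p.1 :=
      HasFDerivAt.comp p.1 (f := fun z : Z => (z, p.2)) hψd.hasFDerivAt hj
    set Λ := (fderiv ℝ ψ p).comp (ContinuousLinearMap.inl ℝ Z R)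
    obtain ⟨L, hL, hLq⟩ := hasFDerivAt_flowDefect B B' hB' (p.1, p.2, ψ p)
    have hcomp : HasFDerivAt (fun z => g (z, p.2, ψ (z, p.2)))
        (L.comp ((ContinuousLinearMap.id ℝ Z).prod ((0 : Z →L[ℝ] R).prod Λ))) p.1 :=
      HasFDerivAt.comp p.1 (f := fun z : Z => (z, p.2, ψ (z, p.2))) hL
        ((hasFDerivAt_id p.1).prodMk ((hasFDerivAt_const p.2 p.1).prodMk hψz))
    have hzero : L.comp ((ContinuousLinearMap.id ℝ Z).prod ((0 : Z →L[ℝ] R).prod Λ)) = 0 := by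
      refine hcomp.unique ((hasFDerivAt_const (0 : K) p.1).congr_of_eventuallyEq ?_)
      have : ∀ᶠ z in 𝓝 p.1, (z, p.2) ∈ N :=
        (hj.continuousAt).eventually_mem (hNo.mem_nhds hp)
      filter_upwards [this] with z hz
      exact (key _ hz).2.2
    have hΛ : ∀ h : Z, Λ h 1 = B (ψ p 1) h := by
      intro h
      set v := ψ p
      have hw := congrArg (fun T : Z →L[ℝ] K => T h) hzero
      simp only [ContinuousLinearMap.comp_apply, ContinuousLinearMap.prod_apply,
        ContinuousLinearMap.id_apply, _root_.zero_apply, hLq, map_zero,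
        sub_zero] at hw
      rw [sub_eq_zero] at hw
      set b : K := ⟨fun s => (s : ℝ) • B (v s) h, by fun_prop⟩ with hb
      have hbeq := variational_equation B B' hB' p.1 h p.2 v hgp (fun s => by
        refine hδc ?_ p.1 h
        rw [dist_eq_norm]
        exact ((v - constantFun R t₀).norm_coe_le_norm s).trans_lt hpS2) b (fun s => rfl)
      have h0 := eq_of_variational_equation B' p.1 h v (substitution B v) hpS1 (Λ h) b hw hbeq
      rw [h0]
      exact one_smul ℝ _
    have hev := ((ContinuousMap.evalCLM ℝ (1 : Icc (0 : ℝ) 1)).hasFDerivAt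
      (x := ψ (p.1, p.2))).comp p.1 hψz
    refine hev.congr_fderiv (ContinuousLinearMap.ext fun h => ?_)
    exact hΛ h

end Flow

/-! ### Auxiliary facts from calculus -/

/-- A smooth function can be modified away from a point so that it becomes globally smooth. -/
lemma exists_contDiff_eventuallyEq {R A : Type*} [NormedAddCommGroup R] [NormedSpace ℝ R]
    [FiniteDimensional ℝ R] [NormedAddCommGroup A] [NormedSpace ℝ A] {f : R → A} {O : Set R}
    (hO : IsOpen O) (hf : ContDiffOn ℝ ∞ f O) {a : R} (ha : a ∈ O) :
    ∃ g : R → A, ContDiff ℝ ∞ g ∧ g =ᶠ[𝓝 a] f := by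
  obtain ⟨ε, hε, hεO⟩ := Metric.isOpen_iff.1 hO a ha
  let χ : ContDiffBump a := ⟨ε / 3, ε / 2, by positivity, by linarith⟩
  refine ⟨fun x => χ x • f x, contDiff_iff_contDiffAt.2 fun x => ?_, ?_⟩
  · by_cases hx : x ∈ O
    · exact χ.contDiff.contDiffAt.smul (hf.contDiffAt (hO.mem_nhds hx))
    · have hx' : x ∉ tsupport χ := by
        rw [χ.tsupport_eq]
        intro hxb
        exact hx (hεO (Metric.closedBall_subset_ball (by change ε / 2 < ε; linarith) hxb))
      have h0 : (fun x => χ x • f x) =ᶠ[𝓝 x] fun _ => 0 := by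
        filter_upwards [(isClosed_tsupport χ).isOpen_compl.mem_nhds hx'] with y hy
        rw [image_eq_zero_of_notMem_tsupport hy, zero_smul]
      exact contDiffAt_const.congr_of_eventuallyEq h0
  · filter_upwards [χ.eventuallyEq_one] with x hx
    rw [hx]
    simp

lemma minSmoothness_two_le : minSmoothness ℝ 2 ≤ ∞ := by
  rw [minSmoothness_of_isRCLikeNormedField]
  exact WithTop.coe_le_coe.2 (le_top : (2 : ℕ∞) ≤ ⊤)

/-- A smooth map between complex vector spaces whose real derivative is complex linear is
holomorphic. -/
lemma contDiffOn_complex {Z : Type} {A : Type u} [NormedAddCommGroup Z] [NormedSpace ℂ Z]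
    [FiniteDimensional ℂ Z] [NormedAddCommGroup A] [NormedSpace ℂ A]
    [FiniteDimensional ℂ A] {f : Z → A} {O : Set Z} (hO : IsOpen O)
    (hf : ContDiffOn ℝ ∞ f O)
    (hI : ∀ z ∈ O, ∀ h, fderiv ℝ f z (Complex.I • h) = Complex.I • fderiv ℝ f z h) :
    ContDiffOn ℂ ∞ f O := by
  rw [contDiffOn_infty]
  intro n
  induction n generalizing A with
  | zero => exact contDiffOn_zero.2 hf.continuousOn
  | succ n ih =>
    have hd : ∀ z ∈ O, DifferentiableAt ℝ f z := fun z hz =>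
      (hf.contDiffAt (hO.mem_nhds hz)).differentiableAt (by simp)
    have hlin : ∀ z ∈ O, ∃ L : Z →L[ℂ] A, L.restrictScalars ℝ = fderiv ℝ f z := by
      intro z hz
      refine ⟨{ toFun := fderiv ℝ f z
                map_add' := map_add _
                map_smul' := fun c h => ?_
                cont := (fderiv ℝ f z).cont }, rfl⟩
      have h1 : c • h = c.re • h + c.im • (Complex.I • h) := by
        conv_lhs => rw [← Complex.re_add_im c]
        rw [add_smul, mul_smul]
        rfl
      have h2 : c • fderiv ℝ f z h =
          c.re • fderiv ℝ f z h + c.im • (Complex.I • fderiv ℝ f z h) := by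
        conv_lhs => rw [← Complex.re_add_im c]
        rw [add_smul, mul_smul]
        rfl
      rw [RingHom.id_apply, h2, h1, map_add, map_smul, map_smul, hI z hz]
    have hc : ∀ z ∈ O, HasFDerivAt (𝕜 := ℂ) f (fderiv ℂ f z) z := by
      intro z hz
      obtain ⟨L, hL⟩ := hlin z hz
      exact (hasFDerivAt_of_restrictScalars ℝ (hd z hz).hasFDerivAt
        hL).differentiableAt.hasFDerivAt
    have heq : ∀ z ∈ O, (fderiv ℂ f z).restrictScalars ℝ = fderiv ℝ f z := fun z hz =>
      ((hc z hz).restrictScalars ℝ).fderiv.symm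
    rw [Nat.cast_add, Nat.cast_one, contDiffOn_succ_iff_fderiv_of_isOpen hO]
    refine ⟨fun z hz => (hc z hz).differentiableAt.differentiableWithinAt, by simp, ?_⟩
    have hf' : ContDiffOn ℝ ∞ (fderiv ℝ f) O := hf.fderiv_of_isOpen hO (by simp)
    -- `fderiv ℂ f` is recovered from `fderiv ℝ f` by a left inverse of the restriction of scalars
    set ρ : (Z →L[ℂ] A) →ₗ[ℝ] (Z →L[ℝ] A) := ContinuousLinearMap.restrictScalarsₗ ℂ Z A ℝ ℝ
    obtain ⟨l, hl⟩ := LinearMap.exists_leftInverse_of_injective ρ (LinearMap.ker_eq_bot.2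
      fun T T' h => ContinuousLinearMap.ext fun x => DFunLike.congr_fun h x)
    have hs : ContDiffOn ℝ ∞ (fderiv ℂ f) O := by
      refine (l.toContinuousLinearMap.contDiff.comp_contDiffOn hf').congr fun z hz => ?_
      change _ = l (fderiv ℝ f z)
      rw [← heq z hz]
      exact (LinearMap.congr_fun hl (fderiv ℂ f z)).symm
    refine ih hs fun z hz h => ?_
    have hsd : HasFDerivAt (𝕜 := ℝ) (fderiv ℂ f) (fderiv ℝ (fderiv ℂ f) z) z :=
      ((hs.contDiffAt (hO.mem_nhds hz)).differentiableAt (by simp)).hasFDerivAt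
    have hfd : HasFDerivAt (fderiv ℝ f) (fderiv ℝ (fderiv ℝ f) z) z :=
      ((hf'.contDiffAt (hO.mem_nhds hz)).differentiableAt (by simp)).hasFDerivAt
    have h2 : ∀ h k, fderiv ℝ (fderiv ℂ f) z h k = fderiv ℝ (fderiv ℝ f) z h k := by
      intro h k
      have h3 : HasFDerivAt (fun y => fderiv ℝ f y) (ρ.toContinuousLinearMap.comp
          (fderiv ℝ (fderiv ℂ f) z)) z := by
        refine (ρ.toContinuousLinearMap.hasFDerivAt.comp z hsd).congr_of_eventuallyEq ?_
        filter_upwards [hO.mem_nhds hz] with y hy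
        exact (heq y hy).symm
      rw [hfd.unique h3]
      rfl
    have hsymm : ∀ h k, fderiv ℝ (fderiv ℝ f) z h k = fderiv ℝ (fderiv ℝ f) z k h := fun h k =>
      (hf.contDiffAt (hO.mem_nhds hz)).isSymmSndFDerivAt minSmoothness_two_le h k
    have hi : ∀ h k, fderiv ℝ (fderiv ℝ f) z k (Complex.I • h) =
        Complex.I • fderiv ℝ (fderiv ℝ f) z k h := by
      intro h k
      have e1 := hfd.clm_apply (hasFDerivAt_const (Complex.I • h) z)
      have e2 := (hfd.clm_apply (hasFDerivAt_const h z)).const_smul Complex.I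
      have e3 := e1.unique (e2.congr_of_eventuallyEq (by
        filter_upwards [hO.mem_nhds hz] with y hy
        exact hI y hy h))
      simpa using DFunLike.congr_fun e3 k
    ext k
    rw [_root_.smul_apply, h2, h2, hsymm, hi, hsymm]

/-- A function that vanishes on the zero set of a submersion has a differential that vanishes on
the kernel of the differential of the submersion. -/
lemma fderiv_eq_zero_of_vanishing {G H : Type*} [NormedAddCommGroup G] [NormedSpace ℝ G]
    [CompleteSpace G] [NormedAddCommGroup H] [NormedSpace ℝ H] [CompleteSpace H] {ρ : G → H}
    {f : G → ℝ} {y : G} (hρ : ContDiffAt ℝ ∞ ρ y) (hf : ContDiffAt ℝ ∞ f y) (hy : ρ y = 0)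
    (hs : Function.Surjective (fderiv ℝ ρ y)) (h0 : ∀ᶠ z in 𝓝 y, ρ z = 0 → f z = 0) {w : G}
    (hw : fderiv ℝ ρ y w = 0) : fderiv ℝ f y w = 0 := by
  have hfy : f y = 0 := h0.self_of_nhds hy
  have hext : IsLocalExtrOn f {x | ρ x = ρ y} y := by
    refine Or.inl ?_
    filter_upwards [mem_nhdsWithin_of_mem_nhds h0, self_mem_nhdsWithin] with z hz hz'
    rw [hz (hz'.trans hy), hfy]
  obtain ⟨Λ, Λ₀, hne, h⟩ := hext.exists_linear_map_of_hasStrictFDerivAt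
    (hρ.hasStrictFDerivAt (by simp)) (hf.hasStrictFDerivAt (by simp))
  have hΛ₀ : Λ₀ ≠ 0 := by
    rintro rfl
    refine hne (Prod.ext (LinearMap.ext fun x => ?_) rfl)
    obtain ⟨v, rfl⟩ := hs x
    simpa using h v
  have h1 := h w
  rw [hw, map_zero, zero_add, smul_eq_mul] at h1
  exact (mul_eq_zero.1 h1).resolve_left hΛ₀

/-- The kernel of the pullback of a constant alternating two-form by `φ` is involutive: the form is
closed, so that the bracket of two vector fields in the kernel is in the kernel. -/
lemma involutive_kernel {R G V : Type*} [NormedAddCommGroup R] [NormedSpace ℝ R]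
    [NormedAddCommGroup G] [NormedSpace ℝ G] [NormedAddCommGroup V] [NormedSpace ℝ V]
    (σ : G →L[ℝ] G →L[ℝ] V) (hσ : ∀ a b, σ a b = -σ b a) {φ : R → G} {r : R}
    (hφ : ContDiffAt ℝ ∞ φ r) {b₁ b₂ : R → R} (hb₁ : DifferentiableAt ℝ b₁ r)
    (hb₂ : DifferentiableAt ℝ b₂ r)
    (h₁ : ∀ᶠ y in 𝓝 r, ∀ η, σ (fderiv ℝ φ y (b₁ y)) (fderiv ℝ φ y η) = 0)
    (h₂ : ∀ᶠ y in 𝓝 r, ∀ η, σ (fderiv ℝ φ y (b₂ y)) (fderiv ℝ φ y η) = 0) (η : R) :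
    σ (fderiv ℝ φ r (fderiv ℝ b₂ r (b₁ r) - fderiv ℝ b₁ r (b₂ r))) (fderiv ℝ φ r η) = 0 := by
  have hF : HasFDerivAt (fderiv ℝ φ) (fderiv ℝ (fderiv ℝ φ) r) r :=
    ((hφ.fderiv_right (m := 1) (WithTop.coe_le_coe.2 (le_top : (1 + 1 : ℕ∞) ≤ ⊤))).differentiableAt
      (by simp)).hasFDerivAt
  have hsymm : ∀ h k, fderiv ℝ (fderiv ℝ φ) r h k = fderiv ℝ (fderiv ℝ φ) r k h := fun h k =>
    hφ.isSymmSndFDerivAt minSmoothness_two_le h k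
  set F := fderiv ℝ φ
  set F' := fderiv ℝ F r
  -- the derivative of `σ (F b) (F c)` along `ζ`
  have hder : ∀ (b c : R → R), DifferentiableAt ℝ b r → DifferentiableAt ℝ c r →
      (∀ᶠ y in 𝓝 r, σ (F y (b y)) (F y (c y)) = 0) → ∀ ζ,
      σ (F' ζ (b r) + F r (fderiv ℝ b r ζ)) (F r (c r)) +
        σ (F r (b r)) (F' ζ (c r) + F r (fderiv ℝ c r ζ)) = 0 := by
    intro b c hb hc h ζ
    have e1 := (σ.hasFDerivAt.comp r (hF.clm_apply hb.hasFDerivAt)).clm_apply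
      (hF.clm_apply hc.hasFDerivAt)
    have e2 := e1.unique ((hasFDerivAt_const (0 : V) r).congr_of_eventuallyEq h)
    have e3 := DFunLike.congr_fun e2 ζ
    simp only [_root_.add_apply, ContinuousLinearMap.comp_apply,
      ContinuousLinearMap.flip_apply, _root_.zero_apply, Function.comp_apply] at e3
    rw [← e3]
    simp only [map_add, _root_.add_apply]
    abel
  have z₁ := h₁.self_of_nhds
  have z₂ := h₂.self_of_nhds
  have E₂ := hder b₂ (fun _ => η) hb₂ (differentiableAt_const η) (h₂.mono fun y hy => hy η) (b₁ r)
  have E₁ := hder b₁ (fun _ => η) hb₁ (differentiableAt_const η) (h₁.mono fun y hy => hy η) (b₂ r)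
  have E₃ := hder b₁ b₂ hb₁ hb₂ (h₁.mono fun y hy => hy (b₂ y)) η
  simp only [fderiv_fun_const, Pi.zero_apply, _root_.zero_apply, map_zero, add_zero, map_add,
    _root_.add_apply] at E₁ E₂ E₃
  rw [z₁, add_zero, hσ (F r (fderiv ℝ b₁ r η)), z₂, neg_zero, add_zero] at E₃
  rw [hsymm (b₁ r) (b₂ r), hσ (F r (b₂ r)), hsymm (b₁ r) η] at E₂
  rw [hsymm (b₂ r) η] at E₁
  rw [map_sub, map_sub, _root_.sub_apply]
  have E₄ : σ (F' η (b₁ r)) (F r (b₂ r)) = -σ (F r (b₁ r)) (F' η (b₂ r)) :=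
    eq_neg_of_add_eq_zero_left E₃
  rw [E₄, neg_neg] at E₂
  have E₅ : σ (F r (fderiv ℝ b₂ r (b₁ r))) (F r η) - σ (F r (fderiv ℝ b₁ r (b₂ r))) (F r η) =
      (σ (F' (b₂ r) (b₁ r)) (F r η) + σ (F r (fderiv ℝ b₂ r (b₁ r))) (F r η) +
        σ (F r (b₁ r)) (F' η (b₂ r))) - (σ (F' (b₂ r) (b₁ r)) (F r η) +
        σ (F r (fderiv ℝ b₁ r (b₂ r))) (F r η) + σ (F r (b₁ r)) (F' η (b₂ r))) := by abel
  rw [E₅, E₁, E₂, sub_zero]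

/-- The zero set of a submersion `ρ` is locally the graph of a smooth map over any complement of
the kernel of `P`, where `P` restricts to an isomorphism on the tangent space: `φ` is the inverse
of the restriction of `P` to the zero set. -/
lemma exists_graph_parametrization {G H R : Type*} [NormedAddCommGroup G] [NormedSpace ℝ G]
    [FiniteDimensional ℝ G] [NormedAddCommGroup H] [NormedSpace ℝ H]
    [NormedAddCommGroup R] [NormedSpace ℝ R] {ρ : G → H}
    {O : Set G} (hO : IsOpen O) (hρ : ContDiffOn ℝ ∞ ρ O) {y₀ : G} (hy₀ : y₀ ∈ O)
    (P : G →L[ℝ] R)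
    (hP : Function.Bijective fun v => (P v, fderiv ℝ ρ y₀ v)) :
    ∃ (W : Set G) (Ω : Set R) (φ : R → G), IsOpen W ∧ y₀ ∈ W ∧ W ⊆ O ∧ IsOpen Ω ∧
      ContDiffOn ℝ ∞ φ Ω ∧ (∀ r ∈ Ω, φ r ∈ W ∧ ρ (φ r) = 0 ∧ P (φ r) = r) ∧
      (∀ y ∈ W, ρ y = 0 → P y ∈ Ω ∧ φ (P y) = y) ∧
      ∀ r ∈ Ω, (∀ ξ, fderiv ℝ ρ (φ r) (fderiv ℝ φ r ξ) = 0 ∧ P (fderiv ℝ φ r ξ) = ξ) ∧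
        ∀ v, fderiv ℝ ρ (φ r) v = 0 → fderiv ℝ φ r (P v) = v := by
  set Θ : G → R × H := fun y => (P y, ρ y)
  have hΘ : ContDiffOn ℝ ∞ Θ O := P.contDiff.contDiffOn.prodMk hρ
  have hρd : ∀ y ∈ O, HasFDerivAt ρ (fderiv ℝ ρ y) y := fun y hy =>
    ((hρ.contDiffAt (hO.mem_nhds hy)).differentiableAt (by simp)).hasFDerivAt
  have hΘd : ∀ y ∈ O, HasFDerivAt Θ (P.prod (fderiv ℝ ρ y)) y := fun y hy =>
    P.hasFDerivAt.prodMk (hρd y hy)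
  set Θ' : G ≃L[ℝ] R × H := (LinearEquiv.ofBijective
    (P.prod (fderiv ℝ ρ y₀)).toLinearMap hP).toContinuousLinearEquiv
  have hΘ' : fderiv ℝ Θ y₀ = Θ' := by
    rw [(hΘd y₀ hy₀).fderiv]
    rfl
  obtain ⟨e, hye, heO, heΘ, hes⟩ := exists_openPartialHomeomorph hO hΘ hy₀ Θ' hΘ'
  have hι : ContDiff ℝ ∞ fun r : R => (r, (0 : H)) := contDiff_id.prodMk contDiff_const
  set Ω : Set R := (fun r : R => (r, (0 : H))) ⁻¹' e.target
  have hΩ : IsOpen Ω := e.open_target.preimage hι.continuous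
  set φ : R → G := fun r => e.symm (r, 0)
  have hφ : ContDiffOn ℝ ∞ φ Ω := hes.comp hι.contDiffOn fun r hr => hr
  have hφd : ∀ r ∈ Ω, HasFDerivAt φ (fderiv ℝ φ r) r := fun r hr =>
    ((hφ.contDiffAt (hΩ.mem_nhds hr)).differentiableAt (by simp)).hasFDerivAt
  have hφΘ : ∀ r ∈ Ω, Θ (φ r) = (r, 0) := fun r hr => by
    rw [← heΘ]
    exact e.right_inv hr
  have hφe : ∀ r ∈ Ω, φ r ∈ e.source := fun r hr => e.map_target hr
  have hfi : ∀ y ∈ e.source, ρ y = 0 → P y ∈ Ω ∧ φ (P y) = y := by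
    intro y hy h0
    have h1 : e y = (P y, 0) := by rw [heΘ, ← h0]
    refine ⟨?_, ?_⟩
    · change (P y, (0 : H)) ∈ e.target
      rw [← h1]
      exact e.map_source hy
    · change e.symm (P y, 0) = y
      rw [← h1]
      exact e.left_inv hy
  refine ⟨e.source, Ω, φ, e.open_source, hye, heO, hΩ, hφ, fun r hr =>
    ⟨hφe r hr, congrArg Prod.snd (hφΘ r hr), congrArg Prod.fst (hφΘ r hr)⟩, hfi, ?_⟩
  intro r hr
  have h1 := (hΘd _ (heO (hφe r hr))).comp r (hφd r hr)
  have h2 : (P.prod (fderiv ℝ ρ (φ r))).comp (fderiv ℝ φ r) = ContinuousLinearMap.inl ℝ R H := by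
    refine h1.unique (HasFDerivAt.congr_of_eventuallyEq (hasFDerivAt_prodMk_left r (0 : H)) ?_)
    filter_upwards [hΩ.mem_nhds hr] with s hs
    exact hφΘ s hs
  have h3 : ∀ ξ, (P (fderiv ℝ φ r ξ), fderiv ℝ ρ (φ r) (fderiv ℝ φ r ξ)) = (ξ, 0) := fun ξ =>
    DFunLike.congr_fun h2 ξ
  refine ⟨fun ξ => ⟨congrArg Prod.snd (h3 ξ), congrArg Prod.fst (h3 ξ)⟩, fun v hv => ?_⟩
  have h4 : HasFDerivAt e.symm (fderiv ℝ e.symm (Θ (φ r))) (Θ (φ r)) := by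
    have : Θ (φ r) ∈ e.target := by rw [hφΘ r hr]; exact hr
    exact ((hes.contDiffAt (e.open_target.mem_nhds this)).differentiableAt (by simp)).hasFDerivAt
  have h5 := (h4.comp (φ r) (hΘd _ (heO (hφe r hr)))).unique
    ((hasFDerivAt_id (φ r)).congr_of_eventuallyEq (by
      filter_upwards [e.open_source.mem_nhds (hφe r hr)] with y hy
      change e.symm (Θ y) = y
      rw [← heΘ]
      exact e.left_inv hy))
  have h6 := DFunLike.congr_fun h5 v
  have h7 : fderiv ℝ φ r = (fderiv ℝ e.symm (Θ (φ r))).comp (ContinuousLinearMap.inl ℝ R H) := by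
    rw [hφΘ r hr] at h4 ⊢
    exact (hφd r hr).unique (HasFDerivAt.comp r (f := fun s : R => (s, (0 : H))) h4
      (hasFDerivAt_prodMk_left r (0 : H)))
  rw [h7]
  change fderiv ℝ e.symm (Θ (φ r)) (P v, 0) = v
  rw [← hv]
  exact h6

/-! ### The complex part of a real subspace -/

section HolomorphicPart

variable {G : Type u} [NormedAddCommGroup G] [NormedSpace ℂ G]

/-- The largest complex subspace `T ∩ iT` of a real subspace `T` of a complex vector space. -/
def holomorphicPart (T : Submodule ℝ G) : Submodule ℂ G where
  carrier := {w | w ∈ T ∧ Complex.I • w ∈ T}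
  add_mem' := by
    rintro a b ⟨ha, ha'⟩ ⟨hb, hb'⟩
    refine ⟨add_mem ha hb, ?_⟩
    rw [smul_add]
    exact add_mem ha' hb'
  zero_mem' := ⟨zero_mem _, by rw [smul_zero]; exact zero_mem _⟩
  smul_mem' := by
    have key : ∀ (c : ℂ) (a : G), a ∈ T → Complex.I • a ∈ T → c • a ∈ T := by
      intro c a ha ha'
      have h : c • a = c.re • a + c.im • (Complex.I • a) := by
        conv_lhs => rw [← Complex.re_add_im c]
        rw [add_smul, mul_smul]
        rfl
      rw [h]
      exact add_mem (Submodule.smul_mem _ _ ha) (Submodule.smul_mem _ _ ha')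
    rintro c a ⟨ha, ha'⟩
    refine ⟨key c a ha ha', ?_⟩
    rw [smul_smul]
    exact key _ a ha ha'

lemma mem_holomorphicPart {T : Submodule ℝ G} {w : G} :
    w ∈ holomorphicPart T ↔ w ∈ T ∧ Complex.I • w ∈ T := Iff.rfl

lemma mem_holomorphicPart_ker {H : Type*} [NormedAddCommGroup H] [NormedSpace ℝ H]
    {L : G →L[ℝ] H} {w : G} :
    w ∈ holomorphicPart L.ker ↔ L w = 0 ∧ L (Complex.I • w) = 0 := Iff.rfl

variable [FiniteDimensional ℂ G]
  {Z : Type} [NormedAddCommGroup Z] [NormedSpace ℂ Z] [FiniteDimensional ℂ Z]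

/-- Linear coordinates adapted to a real subspace `T`: complex coordinates on `T ∩ iT` and real
coordinates on a complement of `T ∩ iT` in `T`. -/
lemma exists_adapted_coordinates (T : Submodule ℝ G)
    (hd : Module.finrank ℂ (holomorphicPart T) = Module.finrank ℂ Z) :
    ∃ (q : ℕ) (P : G →L[ℂ] Z) (Q : G →L[ℝ] EuclideanSpace ℝ (Fin q)),
      (∀ v ∈ holomorphicPart T, P v = 0 → v = 0) ∧
      (∀ a, ∃ v ∈ holomorphicPart T, P v = a) ∧
      (∀ v ∈ T, P v = 0 → Q v = 0 → v = 0) ∧ ∀ b, ∃ v ∈ T, P v = 0 ∧ Q v = b := by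
  set D := holomorphicPart T
  obtain ⟨p, hp⟩ := LinearMap.exists_leftInverse_of_injective D.subtype D.ker_subtype
  set i : D ≃ₗ[ℂ] Z := LinearEquiv.ofFinrankEq _ _ hd
  set P : G →L[ℂ] Z := (i.toLinearMap.comp p).toContinuousLinearMap with hPdef
  have hP : ∀ v : D, P v = i v := fun v => congrArg i (LinearMap.congr_fun hp v)
  set S : Submodule ℝ G := T ⊓ (P.restrictScalars ℝ).ker
  obtain ⟨s, hs⟩ := LinearMap.exists_leftInverse_of_injective S.subtype S.ker_subtype
  have hq : Module.finrank ℝ S =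
      Module.finrank ℝ (EuclideanSpace ℝ (Fin (Module.finrank ℝ S))) := by simp
  set j : S ≃ₗ[ℝ] EuclideanSpace ℝ (Fin (Module.finrank ℝ S)) := LinearEquiv.ofFinrankEq _ _ hq
  set Q : G →L[ℝ] EuclideanSpace ℝ (Fin (Module.finrank ℝ S)) :=
    (j.toLinearMap.comp s).toContinuousLinearMap
  have hQ : ∀ v : S, Q v = j v := fun v => congrArg j (LinearMap.congr_fun hs v)
  refine ⟨_, P, Q, ?_, ?_, ?_, ?_⟩
  · intro v hv h0
    have h1 := hP ⟨v, hv⟩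
    rw [h0, eq_comm, LinearEquiv.map_eq_zero_iff] at h1
    exact congrArg Subtype.val h1
  · intro a
    refine ⟨i.symm a, (i.symm a).2, ?_⟩
    rw [hP, LinearEquiv.apply_symm_apply]
  · intro v hv h0 hq
    have h1 := hQ ⟨v, hv, h0⟩
    rw [hq, eq_comm, LinearEquiv.map_eq_zero_iff] at h1
    exact congrArg Subtype.val h1
  · intro b
    refine ⟨j.symm b, (j.symm b).2.1, (j.symm b).2.2, ?_⟩
    rw [hQ, LinearEquiv.apply_symm_apply]

/-- The complex parts of the kernels of a smooth family of operators have smooth frames, if their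
dimension is constant along the set `S` that is considered. -/
lemma exists_smooth_frame {H : Type*} [NormedAddCommGroup H] [NormedSpace ℝ H]
    [FiniteDimensional ℝ H]
    {O S : Set G} (hO : IsOpen O) {L : G → G →L[ℝ] H} (hL : ContDiffOn ℝ ∞ L O)
    (hd : ∀ y ∈ O ∩ S, Module.finrank ℂ (holomorphicPart (L y).ker) = Module.finrank ℂ Z)
    {y₀ : G} (hy₀ : y₀ ∈ O ∩ S) (P : G →L[ℂ] Z)
    (hP : ∀ v ∈ holomorphicPart (L y₀).ker, P v = 0 → v = 0)
    (hP' : ∀ a, ∃ v ∈ holomorphicPart (L y₀).ker, P v = a) :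
    ∃ (N : Set G) (A : G → Z →L[ℝ] G), IsOpen N ∧ y₀ ∈ N ∧ N ⊆ O ∧ ContDiffOn ℝ ∞ A N ∧
      ∀ y ∈ N ∩ S, (∀ h, A y h ∈ holomorphicPart (L y).ker ∧ P (A y h) = h) ∧
        ∀ v ∈ holomorphicPart (L y).ker, A y (P v) = v := by
  set J : G →L[ℝ] G := (Complex.I • ContinuousLinearMap.id ℂ G).restrictScalars ℝ
  have hJ : ∀ v, J v = Complex.I • v := fun v => rfl
  set C : G → G →L[ℝ] H × H := fun y => (L y).prod ((L y).comp J)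
  have hCs : ContDiffOn ℝ ∞ C O := by
    have h1 : ContDiffOn ℝ ∞ (fun y => (L y).comp J) O := hL.clm_comp contDiffOn_const
    have h2 : C = fun y => (ContinuousLinearMap.inl ℝ H H).comp (L y) +
        (ContinuousLinearMap.inr ℝ H H).comp ((L y).comp J) := by
      funext y
      ext v <;> simp [C]
    rw [h2]
    exact (contDiffOn_const.clm_comp hL).add (contDiffOn_const.clm_comp h1)
  have hC : ∀ y v, C y v = 0 ↔ v ∈ holomorphicPart (L y).ker := by
    intro y v
    rw [mem_holomorphicPart_ker, ← hJ]
    exact Prod.ext_iff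
  -- restrict the target so that the operator at `y₀` becomes onto
  set V : Submodule ℝ (H × H) := (C y₀).toLinearMap.range
  obtain ⟨π, hπ⟩ := LinearMap.exists_leftInverse_of_injective V.subtype V.ker_subtype
  have hπ' : ∀ v : V, π v = v := fun v => LinearMap.congr_fun hπ v
  set π' : H × H →L[ℝ] V := π.toContinuousLinearMap
  set E : G → G →L[ℝ] Z × V := fun y => (P.restrictScalars ℝ).prod (π'.comp (C y)) with hE
  have hEv : ∀ y v, E y v = (P v, π (C y v)) := fun y v => rfl
  have hEs : ContDiffOn ℝ ∞ E O := by
    have h2 : E = fun y => (ContinuousLinearMap.inl ℝ Z V).comp (P.restrictScalars ℝ) +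
        (ContinuousLinearMap.inr ℝ Z V).comp (π'.comp (C y)) := by
      funext y
      ext v <;> simp [E]
    rw [h2]
    exact contDiffOn_const.add (contDiffOn_const.clm_comp (contDiffOn_const.clm_comp hCs))
  have hE0 : ∀ v, π (C y₀ v) = 0 → C y₀ v = 0 := by
    intro v hv
    have h1 := hπ' ⟨C y₀ v, v, rfl⟩
    rw [hv] at h1
    exact (congrArg Subtype.val h1).symm
  have hbij : Function.Bijective (E y₀) := by
    constructor
    · rw [injective_iff_map_eq_zero]
      intro v hv
      rw [hEv, Prod.mk_eq_zero] at hv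
      exact hP v ((hC _ _).1 (hE0 v hv.2)) hv.1
    · rintro ⟨a, ⟨b, v, rfl⟩⟩
      obtain ⟨w, hw, hwa⟩ := hP' (a - P v)
      refine ⟨v + w, ?_⟩
      rw [hEv, map_add, map_add, hwa, (hC _ _).2 hw, add_zero, add_sub_cancel]
      exact Prod.ext rfl (hπ' ⟨C y₀ v, v, rfl⟩)
  set E₀ : G ≃L[ℝ] Z × V :=
    (LinearEquiv.ofBijective (E y₀).toLinearMap hbij).toContinuousLinearEquiv
  set N : Set G := O ∩ E ⁻¹' range ContinuousLinearEquiv.toContinuousLinearMap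
  have hN : IsOpen N := hEs.continuousOn.isOpen_inter_preimage hO ContinuousLinearEquiv.isOpen
  set A : G → Z →L[ℝ] G := fun y => (E y).inverse.comp (ContinuousLinearMap.inl ℝ Z V)
  have hAs : ContDiffOn ℝ ∞ A N := by
    intro y hy
    obtain ⟨f, hf⟩ := hy.2
    have h1 : ContDiffAt ℝ ∞ ContinuousLinearMap.inverse (E y) := by
      rw [← hf]
      exact contDiffAt_map_inverse f
    have h2 : ContDiffAt ℝ ∞ E y := hEs.contDiffAt (hO.mem_nhds hy.1)
    exact ((h1.comp y h2).clm_comp contDiffAt_const).contDiffWithinAt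
  refine ⟨N, A, hN, ⟨hy₀.1, E₀, rfl⟩, inter_subset_left, hAs, ?_⟩
  rintro y ⟨⟨hyO, f, hf⟩, hyS⟩
  have hEf : ∀ v, E y v = f v := fun v => by rw [← hf]; rfl
  have hA : ∀ h, A y h = f.symm (h, 0) := by
    intro h
    change (E y).inverse (h, 0) = _
    rw [← hf, ContinuousLinearMap.inverse_equiv]
    rfl
  have hPA : ∀ h, P (A y h) = h := by
    intro h
    have h1 : E y (A y h) = (h, 0) := by rw [hEf, hA, ContinuousLinearEquiv.apply_symm_apply]
    exact congrArg Prod.fst h1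
  have hAP : ∀ v ∈ holomorphicPart (L y).ker, A y (P v) = v := by
    intro v hv
    rw [hA, ContinuousLinearEquiv.symm_apply_eq, ← hEf, hEv, (hC _ _).2 hv, map_zero]
  -- a dimension count: `P` maps the complex part of the kernel onto `Z`
  set p : holomorphicPart (L y).ker →ₗ[ℂ] Z := P.toLinearMap.comp (Submodule.subtype _)
  have hp : Function.Injective p := by
    intro v w hvw
    have h1 : P v = P w := hvw
    refine Subtype.ext ?_
    rw [← hAP v v.2, ← hAP w w.2, h1]
  have hp' : Function.Surjective p :=
    (LinearMap.injective_iff_surjective_of_finrank_eq_finrank (hd y ⟨hyO, hyS⟩)).1 hp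
  refine ⟨fun h => ⟨?_, hPA h⟩, hAP⟩
  obtain ⟨v, rfl⟩ := hp' h
  change A y (P v) ∈ _
  rw [hAP v v.2]
  exact v.2

end HolomorphicPart

/-! ### Foliated charts in a complex vector space -/

section FlatFoliation

variable {G : Type u} [NormedAddCommGroup G] [NormedSpace ℂ G] [FiniteDimensional ℂ G]
  {Z : Type} [NormedAddCommGroup Z] [NormedSpace ℂ Z] [FiniteDimensional ℂ Z]
  {H : Type*} [NormedAddCommGroup H] [NormedSpace ℝ H] [FiniteDimensional ℝ H]
  {V : Type*} [NormedAddCommGroup V] [NormedSpace ℝ V]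

omit [FiniteDimensional ℂ G] [FiniteDimensional ℂ Z] [FiniteDimensional ℝ H] in
/-- In a graph parametrization `φ` of the zero set of `ρ`, the complex parts of the tangent spaces
are spanned by commuting vector fields `B(·) h`, which project to the constant fields `h`: they are
involutive as the kernel of a closed two-form `σ`, and a bracket that projects to zero vanishes. -/
lemma exists_commuting_frame {q : ℕ} {O : Set G} {ρ : G → H} (σ : G →L[ℝ] G →L[ℝ] V)
    (hσ : ∀ a b, σ a b = -σ b a)
    (hker : ∀ y ∈ O, ρ y = 0 → ∀ v, fderiv ℝ ρ y v = 0 →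
      (v ∈ holomorphicPart (fderiv ℝ ρ y).ker ↔ ∀ w, fderiv ℝ ρ y w = 0 → σ v w = 0))
    {N : Set G} (hNO : N ⊆ O) {A : G → Z →L[ℝ] G} (hA : ContDiffOn ℝ ∞ A N)
    (P : G →L[ℂ] Z) (Q : G →L[ℝ] EuclideanSpace ℝ (Fin q))
    (hAP : ∀ y ∈ N ∩ {y | ρ y = 0},
      (∀ h, A y h ∈ holomorphicPart (fderiv ℝ ρ y).ker ∧ P (A y h) = h) ∧
        ∀ v ∈ holomorphicPart (fderiv ℝ ρ y).ker, A y (P v) = v)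
    {Ω : Set (Z × EuclideanSpace ℝ (Fin q))} (hΩ : IsOpen Ω)
    {φ : Z × EuclideanSpace ℝ (Fin q) → G} (hφ : ContDiffOn ℝ ∞ φ Ω)
    (hφN : ∀ r ∈ Ω, φ r ∈ N ∧ ρ (φ r) = 0)
    (hφ' : ∀ r ∈ Ω, (∀ ξ, fderiv ℝ ρ (φ r) (fderiv ℝ φ r ξ) = 0 ∧
      ((P.restrictScalars ℝ).prod Q) (fderiv ℝ φ r ξ) = ξ) ∧
        ∀ v, fderiv ℝ ρ (φ r) v = 0 →
          fderiv ℝ φ r (((P.restrictScalars ℝ).prod Q) v) = v) :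
    ∃ B : Z × EuclideanSpace ℝ (Fin q) → Z →L[ℝ] Z × EuclideanSpace ℝ (Fin q),
      ContDiffOn ℝ ∞ B Ω ∧ (∀ r ∈ Ω, ∀ h, fderiv ℝ φ r (B r h) = A (φ r) h ∧ (B r h).1 = h) ∧
      ∀ r ∈ Ω, ∀ z h, fderiv ℝ B r (B r z) h = fderiv ℝ B r (B r h) z := by
  set pr : G →L[ℝ] Z × EuclideanSpace ℝ (Fin q) := (P.restrictScalars ℝ).prod Q
  have hpr : ∀ v, (pr v).1 = P v := fun v => rfl
  set B : Z × EuclideanSpace ℝ (Fin q) → Z →L[ℝ] Z × EuclideanSpace ℝ (Fin q) :=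
    fun r => pr.comp (A (φ r)) with hBdef
  have hB : ContDiffOn ℝ ∞ B Ω :=
    contDiffOn_const.clm_comp (hA.comp hφ fun r hr => (hφN r hr).1)
  have hBr : ∀ r ∈ Ω, ∀ h, fderiv ℝ φ r (B r h) = A (φ r) h ∧ (B r h).1 = h := by
    intro r hr h
    obtain ⟨h1, -⟩ := hAP (φ r) (hφN r hr)
    exact ⟨(hφ' r hr).2 _ (mem_holomorphicPart_ker.1 (h1 h).1).1, (h1 h).2⟩
  refine ⟨B, hB, hBr, fun r hr z h => ?_⟩
  have hBd : HasFDerivAt B (fderiv ℝ B r) r :=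
    ((hB.contDiffAt (hΩ.mem_nhds hr)).differentiableAt (by simp)).hasFDerivAt
  have hb : ∀ k, HasFDerivAt (fun s => B s k) ((fderiv ℝ B r).flip k) r := by
    intro k
    refine (hBd.clm_apply (hasFDerivAt_const k r)).congr_fderiv ?_
    rw [ContinuousLinearMap.comp_zero, zero_add]
  have hvan : ∀ k, ∀ᶠ s in 𝓝 r, ∀ η, σ (fderiv ℝ φ s (B s k)) (fderiv ℝ φ s η) = 0 := by
    intro k
    filter_upwards [hΩ.mem_nhds hr] with s hs η
    have h1 := ((hAP (φ s) (hφN s hs)).1 k).1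
    rw [(hBr s hs k).1]
    exact (hker _ (hNO (hφN s hs).1) (hφN s hs).2 _ (mem_holomorphicPart_ker.1 h1).1).1 h1 _
      ((hφ' s hs).1 η).1
  -- the bracket of `B z` and `B h`
  set X := fderiv ℝ B r (B r z) h - fderiv ℝ B r (B r h) z with hX
  have hinv : ∀ η, σ (fderiv ℝ φ r X) (fderiv ℝ φ r η) = 0 := by
    intro η
    have h1 := involutive_kernel σ hσ (hφ.contDiffAt (hΩ.mem_nhds hr)) (hb z).differentiableAt
      (hb h).differentiableAt (hvan z) (hvan h) η
    rw [(hb z).fderiv, (hb h).fderiv] at h1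
    exact h1
  have hXtan := (hφ' r hr).1 X
  have hXD : fderiv ℝ φ r X ∈ holomorphicPart (fderiv ℝ ρ (φ r)).ker := by
    refine (hker _ (hNO (hφN r hr).1) (hφN r hr).2 _ hXtan.1).2 fun w hw => ?_
    rw [← (hφ' r hr).2 w hw]
    exact hinv _
  have hX1 : X.1 = 0 := by
    have h2 : ∀ k ξ, (fderiv ℝ B r ξ k).1 = 0 := by
      intro k ξ
      have h3 : HasFDerivAt (fun s => (B s k).1)
          ((ContinuousLinearMap.fst ℝ Z (EuclideanSpace ℝ (Fin q))).comp
            ((fderiv ℝ B r).flip k)) r :=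
        (ContinuousLinearMap.fst ℝ Z (EuclideanSpace ℝ (Fin q))).hasFDerivAt.comp r (hb k)
      have h4 := h3.unique ((hasFDerivAt_const k r).congr_of_eventuallyEq (by
        filter_upwards [hΩ.mem_nhds hr] with s hs
        exact (hBr s hs k).2))
      exact DFunLike.congr_fun h4 ξ
    rw [hX, Prod.fst_sub, h2, h2, sub_zero]
  have hX0 : fderiv ℝ φ r X = 0 := by
    rw [← (hAP (φ r) (hφN r hr)).2 _ hXD, ← hpr, hXtan.2, hX1, map_zero]
  have hXz : X = 0 := by
    rw [← hXtan.2, hX0, map_zero]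
  exact sub_eq_zero.1 hXz

/-- A foliated chart of the zero set of a submersion `ρ` near `y₀`. The complex parts of the
tangent spaces have constant dimension and are the kernel of a constant two-form `σ` on the tangent
spaces. The chart `Ψ` has the inverse `(κ, τ)`, where `κ` is a holomorphic function on an open
subset of the ambient space and `τ` is a smooth one. -/
theorem exists_flat_foliated_chart {O : Set G} (hO : IsOpen O) {ρ : G → H}
    (hρ : ContDiffOn ℝ ∞ ρ O) (σ : G →L[ℝ] G →L[ℝ] V) (hσ : ∀ a b, σ a b = -σ b a)
    (hd : ∀ y ∈ O, ρ y = 0 →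
      Module.finrank ℂ (holomorphicPart (fderiv ℝ ρ y).ker) = Module.finrank ℂ Z)
    (hker : ∀ y ∈ O, ρ y = 0 → ∀ v, fderiv ℝ ρ y v = 0 →
      (v ∈ holomorphicPart (fderiv ℝ ρ y).ker ↔ ∀ w, fderiv ℝ ρ y w = 0 → σ v w = 0))
    {y₀ : G} (hy₀ : y₀ ∈ O) (hρy₀ : ρ y₀ = 0)
    (hsurj : Function.Surjective (fderiv ℝ ρ y₀)) :
    ∃ (q : ℕ) (W : Set G) (Ψ : Z × EuclideanSpace ℝ (Fin q) → G) (κ : G → Z)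
      (τ : G → EuclideanSpace ℝ (Fin q)), IsOpen W ∧ y₀ ∈ W ∧ W ⊆ O ∧
      ContDiffOn ℝ ∞ Ψ (Metric.ball 0 1 ×ˢ Metric.ball 0 1) ∧ ContDiffOn ℂ ∞ κ W ∧
      ContDiffOn ℝ ∞ τ W ∧
      (∀ a ∈ Metric.ball (0 : Z) 1 ×ˢ Metric.ball (0 : EuclideanSpace ℝ (Fin q)) 1,
        Ψ a ∈ W ∧ ρ (Ψ a) = 0 ∧ κ (Ψ a) = a.1 ∧ τ (Ψ a) = a.2) ∧
      (∀ y ∈ W, ρ y = 0 → (κ y, τ y) ∈ Metric.ball (0 : Z) 1 ×ˢ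
        Metric.ball (0 : EuclideanSpace ℝ (Fin q)) 1 ∧ Ψ (κ y, τ y) = y) ∧
      ∀ t ∈ Metric.ball (0 : EuclideanSpace ℝ (Fin q)) 1,
        ContDiffOn ℂ ∞ (fun z => Ψ (z, t)) (Metric.ball 0 1) ∧
        ∀ z ∈ Metric.ball (0 : Z) 1, ∀ h, fderiv ℝ (fun z => Ψ (z, t)) z h ∈
          holomorphicPart (fderiv ℝ ρ (Ψ (z, t))).ker := by
  obtain ⟨q, P, Q, hP0, hPs, hQ0, hQs⟩ := exists_adapted_coordinates (Z := Z)
    (fderiv ℝ ρ y₀).ker (hd y₀ hy₀ hρy₀)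
  have hρ' : ContDiffOn ℝ ∞ (fderiv ℝ ρ) O := hρ.fderiv_of_isOpen hO (by simp)
  obtain ⟨N, A, hN, hy₀N, hNO, hA, hAP⟩ := exists_smooth_frame (S := {y | ρ y = 0}) hO hρ'
    (fun y hy => hd y hy.1 hy.2) ⟨hy₀, hρy₀⟩ P hP0 hPs
  set pr : G →L[ℝ] Z × EuclideanSpace ℝ (Fin q) := (P.restrictScalars ℝ).prod Q with hprdef
  have hpr1 : ∀ v, (pr v).1 = P v := fun v => rfl
  have hpr2 : ∀ v, (pr v).2 = Q v := fun v => rfl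
  have hbij : Function.Bijective fun v => (pr v, fderiv ℝ ρ y₀ v) := by
    constructor
    · intro v w hvw
      obtain ⟨h1, h2⟩ := Prod.ext_iff.1 hvw
      obtain ⟨h3, h4⟩ := Prod.ext_iff.1 h1
      refine sub_eq_zero.1 (hQ0 (v - w) ?_ ?_ ?_)
      · rw [LinearMap.mem_ker, map_sub]
        exact sub_eq_zero.2 h2
      · rw [map_sub]
        exact sub_eq_zero.2 h3
      · rw [map_sub]
        exact sub_eq_zero.2 h4
    · rintro ⟨⟨a, b⟩, c⟩
      obtain ⟨v₁, hv₁⟩ := hsurj c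
      obtain ⟨v₂, hv₂, hv₂'⟩ := hPs (a - P v₁)
      obtain ⟨v₃, hv₃, hv₃', hv₃''⟩ := hQs (b - Q (v₁ + v₂))
      refine ⟨v₁ + v₂ + v₃, Prod.ext (Prod.ext ?_ ?_) ?_⟩
      · change P (v₁ + v₂ + v₃) = a
        rw [map_add, map_add, hv₂', hv₃']
        abel
      · change Q (v₁ + v₂ + v₃) = b
        rw [map_add, hv₃'']
        abel
      · change fderiv ℝ ρ y₀ (v₁ + v₂ + v₃) = c
        rw [map_add, map_add, (mem_holomorphicPart_ker.1 hv₂).1,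
          show fderiv ℝ ρ y₀ v₃ = 0 from hv₃, hv₁]
        abel
  obtain ⟨W₀, Ω, φ, hW₀, hy₀W₀, hW₀N, hΩ, hφ, hφr, hφi, hφ'⟩ :=
    exists_graph_parametrization hN (hρ.mono hNO) hy₀N pr hbij
  obtain ⟨B₀, hB₀, hB₀r, hcomm⟩ := exists_commuting_frame σ hσ hker hNO hA P Q hAP hΩ hφ
    (fun r hr => ⟨hW₀N (hφr r hr).1, (hφr r hr).2.1⟩) hφ'
  set r₀ := pr y₀ with hr₀
  have hr₀Ω : r₀ ∈ Ω := (hφi y₀ hy₀W₀ hρy₀).1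
  -- the commuting fields extended to the whole space
  obtain ⟨B, hB, hBB₀⟩ := exists_contDiff_eventuallyEq hΩ hB₀ hr₀Ω
  obtain ⟨Ω', hΩ'B, hΩ', hr₀Ω'⟩ := eventually_nhds_iff.1 hBB₀
  obtain ⟨u, Nu, hNu, h0Nu, hu, hu0, hud⟩ := exists_commuting_flow ⟨B, hB.continuous⟩ hB r₀ (by
    filter_upwards [(hΩ'.inter hΩ).mem_nhds ⟨hr₀Ω', hr₀Ω⟩] with r hr z h
    have h1 : B =ᶠ[𝓝 r] B₀ := by
      filter_upwards [hΩ'.mem_nhds hr.1] with s hs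
      exact hΩ'B s hs
    change fderiv ℝ B r (B r z) h = fderiv ℝ B r (B r h) z
    rw [h1.fderiv_eq, hΩ'B r hr.1]
    exact hcomm r hr.2 z h)
  -- a product of balls on which the flow stays in the region under control
  have hN2 : IsOpen (Nu ∩ u ⁻¹' (Ω' ∩ Ω)) :=
    hu.continuousOn.isOpen_inter_preimage hNu (hΩ'.inter hΩ)
  obtain ⟨ε, hε, hεN⟩ := Metric.isOpen_iff.1 hN2 (0, r₀) ⟨h0Nu, by
    rw [mem_preimage, hu0 _ h0Nu]
    exact ⟨hr₀Ω', hr₀Ω⟩⟩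
  rw [← ball_prod_same] at hεN
  set O₂ : Set (Z × EuclideanSpace ℝ (Fin q)) := Metric.ball 0 ε ×ˢ Metric.ball r₀.2 ε
  have hO₂ : IsOpen O₂ := Metric.isOpen_ball.prod Metric.isOpen_ball
  have hO₂N : ∀ a ∈ O₂, (a.1, (r₀.1, a.2)) ∈ Nu ∧ u (a.1, (r₀.1, a.2)) ∈ Ω' ∩ Ω := by
    rintro ⟨z, s⟩ ⟨hz, hs⟩
    refine hεN ⟨hz, ?_⟩
    change dist (r₀.1, s) r₀ < ε
    rw [Prod.dist_eq, dist_self]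
    exact max_lt hε hs
  set Φ : Z × EuclideanSpace ℝ (Fin q) → Z × EuclideanSpace ℝ (Fin q) :=
    fun a => u (a.1, (r₀.1, a.2)) with hΦ
  have hΦs : ContDiffOn ℝ ∞ Φ O₂ := hu.comp
    (contDiff_fst.prodMk (contDiff_const.prodMk contDiff_snd)).contDiffOn fun a ha => (hO₂N a ha).1
  have hΦz : ∀ a ∈ O₂, HasFDerivAt (fun z => Φ (z, a.2)) (B₀ (Φ a)) a.1 := by
    intro a ha
    have h1 := hud _ (hO₂N a ha).1
    rw [← hΩ'B _ (hO₂N a ha).2.1]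
    exact h1
  have hΦ0 : ∀ s ∈ Metric.ball r₀.2 ε, Φ (0, s) = (r₀.1, s) := fun s hs =>
    hu0 _ (hO₂N (0, s) ⟨Metric.mem_ball_self hε, hs⟩).1
  have hΦ1 : ∀ a ∈ O₂, (Φ a).1 = r₀.1 + a.1 := by
    rintro ⟨z, s⟩ ⟨hz, hs⟩
    have h1 : ∀ z ∈ Metric.ball (0 : Z) ε,
        HasFDerivAt (fun z => (Φ (z, s)).1 - z) (0 : Z →L[ℝ] Z) z := by
      intro z hz
      refine (((ContinuousLinearMap.fst ℝ Z (EuclideanSpace ℝ (Fin q))).hasFDerivAt.comp z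
        (hΦz (z, s) ⟨hz, hs⟩)).sub (hasFDerivAt_id z)).congr_fderiv ?_
      ext1 h
      change (B₀ (Φ (z, s)) h).1 - h = 0
      rw [(hB₀r _ (hO₂N (z, s) ⟨hz, hs⟩).2.2 h).2, sub_self]
    have h2 := Metric.isOpen_ball.is_const_of_fderiv_eq_zero
      (convex_ball (0 : Z) ε).isPreconnected
      (fun z hz => (h1 z hz).differentiableAt.differentiableWithinAt)
      (fun z hz => (h1 z hz).fderiv) hz (Metric.mem_ball_self hε)
    simp only [hΦ0 s hs, sub_zero] at h2
    exact sub_eq_iff_eq_add.1 h2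
  have ha₀ : ((0 : Z), r₀.2) ∈ O₂ := ⟨Metric.mem_ball_self hε, Metric.mem_ball_self hε⟩
  have hΦa₀ : Φ (0, r₀.2) = r₀ := hΦ0 _ (Metric.mem_ball_self hε)
  have hΦd : HasFDerivAt Φ (fderiv ℝ Φ (0, r₀.2)) (0, r₀.2) :=
    ((hΦs.contDiffAt (hO₂.mem_nhds ha₀)).differentiableAt (by simp)).hasFDerivAt
  have hΦd' : ∀ h k, fderiv ℝ Φ (0, r₀.2) (h, k) = B₀ r₀ h + (0, k) := by
    intro h k
    have h1 := (hΦd.comp (0 : Z) (f := fun z : Z => (z, r₀.2))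
      (hasFDerivAt_prodMk_left (0 : Z) r₀.2)).unique (hΦz _ ha₀)
    have h2 := (hΦd.comp r₀.2 (f := fun s => ((0 : Z), s))
      (hasFDerivAt_prodMk_right (0 : Z) r₀.2)).unique
      ((hasFDerivAt_prodMk_right r₀.1 r₀.2).congr_of_eventuallyEq (by
        filter_upwards [Metric.ball_mem_nhds r₀.2 hε] with s hs
        exact hΦ0 s hs))
    have h3 : ((h, k) : Z × EuclideanSpace ℝ (Fin q)) = (h, 0) + (0, k) := by simp
    rw [h3, map_add]
    rw [hΦa₀] at h1
    exact congrArg₂ (· + ·) (DFunLike.congr_fun h1 h) (DFunLike.congr_fun h2 k)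
  have hΦb : Function.Bijective (fderiv ℝ Φ (0, r₀.2)) := by
    have hB1 : ∀ h, (B₀ r₀ h).1 = h := fun h => (hB₀r r₀ hr₀Ω h).2
    constructor
    · rw [injective_iff_map_eq_zero]
      rintro ⟨h, k⟩ h0
      rw [hΦd'] at h0
      obtain ⟨h1, h2⟩ := Prod.ext_iff.1 h0
      simp only [Prod.fst_add, hB1, Prod.fst_zero, add_zero] at h1
      subst h1
      simpa using h2
    · rintro ⟨h, k⟩
      refine ⟨(h, k - (B₀ r₀ h).2), ?_⟩
      rw [hΦd']
      refine Prod.ext ?_ ?_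
      · simp [hB1]
      · simp
  obtain ⟨e, hae, heO, heΦ, hes⟩ := exists_openPartialHomeomorph hO₂ hΦs ha₀
    (LinearEquiv.ofBijective (fderiv ℝ Φ (0, r₀.2)).toLinearMap hΦb).toContinuousLinearEquiv rfl
  obtain ⟨δ, hδ, hδe⟩ := Metric.isOpen_iff.1 e.open_source _ hae
  set m : Z × EuclideanSpace ℝ (Fin q) → Z × EuclideanSpace ℝ (Fin q) :=
    fun a => (δ • a.1, r₀.2 + δ • a.2) with hm
  have hmc : ContDiff ℝ ∞ m := by fun_prop
  have hme : ∀ a ∈ Metric.ball (0 : Z) 1 ×ˢ Metric.ball (0 : EuclideanSpace ℝ (Fin q)) 1,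
      m a ∈ e.source := by
    rintro ⟨z, t⟩ ⟨hz, ht⟩
    rw [mem_ball_zero_iff] at hz ht
    refine hδe ?_
    rw [← ball_prod_same]
    refine ⟨?_, ?_⟩
    · rw [mem_ball_zero_iff, norm_smul, Real.norm_of_nonneg hδ.le]
      exact mul_lt_of_lt_one_right hδ hz
    · rw [mem_ball_iff_norm, add_sub_cancel_left, norm_smul, Real.norm_of_nonneg hδ.le]
      exact mul_lt_of_lt_one_right hδ ht
  set κ : G → Z := fun y => δ⁻¹ • (P y - r₀.1) with hκ
  set τ : G → EuclideanSpace ℝ (Fin q) := fun y => δ⁻¹ • ((e.symm (pr y)).2 - r₀.2) with hτ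
  have hκs : ContDiff ℂ ∞ κ := (P.contDiff.sub contDiff_const).const_smul δ⁻¹
  set W₁ : Set G := W₀ ∩ pr ⁻¹' e.target
  have hW₁ : IsOpen W₁ := hW₀.inter (e.open_target.preimage pr.continuous)
  have hτs : ContDiffOn ℝ ∞ τ W₁ :=
    ((contDiff_snd.comp_contDiffOn (hes.comp pr.contDiff.contDiffOn fun y hy => hy.2)).sub
      contDiffOn_const).const_smul δ⁻¹
  set W : Set G := W₁ ∩ (fun y => (κ y, τ y)) ⁻¹'
    (Metric.ball (0 : Z) 1 ×ˢ Metric.ball (0 : EuclideanSpace ℝ (Fin q)) 1) with hWdef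
  have hW : IsOpen W := (hκs.continuous.continuousOn.prodMk hτs.continuousOn).isOpen_inter_preimage
    hW₁ (Metric.isOpen_ball.prod Metric.isOpen_ball)
  set Ψ : Z × EuclideanSpace ℝ (Fin q) → G := fun a => φ (Φ (m a)) with hΨ
  have hΨΩ : ∀ a ∈ Metric.ball (0 : Z) 1 ×ˢ Metric.ball (0 : EuclideanSpace ℝ (Fin q)) 1,
      Φ (m a) ∈ Ω := fun a ha => (hO₂N _ (heO (hme a ha))).2.2
  have hΨs : ContDiffOn ℝ ∞ Ψ
      (Metric.ball (0 : Z) 1 ×ˢ Metric.ball (0 : EuclideanSpace ℝ (Fin q)) 1) :=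
    hφ.comp (hΦs.comp hmc.contDiffOn fun a ha => heO (hme a ha)) hΨΩ
  have hδ' : δ ≠ 0 := hδ.ne'
  have hinv : ∀ a ∈ Metric.ball (0 : Z) 1 ×ˢ Metric.ball (0 : EuclideanSpace ℝ (Fin q)) 1,
      Ψ a ∈ W₁ ∧ κ (Ψ a) = a.1 ∧ τ (Ψ a) = a.2 := by
    intro a ha
    obtain ⟨h1, h2, h3⟩ := hφr _ (hΨΩ a ha)
    have h4 : pr (Ψ a) = e (m a) := by rw [heΦ]; exact h3
    refine ⟨⟨h1, ?_⟩, ?_, ?_⟩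
    · change pr (Ψ a) ∈ e.target
      rw [h4]
      exact e.map_source (hme a ha)
    · change δ⁻¹ • ((pr (Ψ a)).1 - r₀.1) = a.1
      rw [h4, heΦ, hΦ1 _ (heO (hme a ha)), add_sub_cancel_left]
      exact inv_smul_smul₀ hδ' _
    · change δ⁻¹ • ((e.symm (pr (Ψ a))).2 - r₀.2) = a.2
      rw [h4, e.left_inv (hme a ha)]
      simp only [hm, add_sub_cancel_left]
      exact inv_smul_smul₀ hδ' _
  have hA_I : ∀ y ∈ N, ρ y = 0 → ∀ h, A y (Complex.I • h) = Complex.I • A y h := by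
    intro y hy h0 h
    obtain ⟨h1, h2⟩ := hAP y ⟨hy, h0⟩
    have h3 := h2 _ (Submodule.smul_mem _ Complex.I (h1 h).1)
    rwa [map_smul, (h1 h).2] at h3
  have hΨz : ∀ t ∈ Metric.ball (0 : EuclideanSpace ℝ (Fin q)) 1, ∀ z ∈ Metric.ball (0 : Z) 1,
      HasFDerivAt (fun z => Ψ (z, t)) (δ • A (Ψ (z, t))) z := by
    intro t ht z hz
    have hr := hΨΩ (z, t) ⟨hz, ht⟩
    have h1 := hΦz _ (heO (hme (z, t) ⟨hz, ht⟩))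
    have h2 : HasFDerivAt (fun z : Z => δ • z) (δ • ContinuousLinearMap.id ℝ Z) z :=
      (hasFDerivAt_id z).const_smul δ
    have h3 := (((hφ.contDiffAt (hΩ.mem_nhds hr)).differentiableAt (by simp)).hasFDerivAt).comp z
      (HasFDerivAt.comp z (f := fun z : Z => δ • z) h1 h2)
    refine h3.congr_fderiv ?_
    ext1 h
    change fderiv ℝ φ (Φ (m (z, t))) (B₀ (Φ (m (z, t))) (δ • h)) = δ • A (Ψ (z, t)) h
    rw [(hB₀r _ hr _).1, map_smul]
  refine ⟨q, W, Ψ, κ, τ, hW, ?_, ?_, hΨs, hκs.contDiffOn, hτs.mono inter_subset_left, ?_, ?_, ?_⟩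
  · have h1 : pr y₀ = e (0, r₀.2) := by rw [heΦ, hΦa₀]
    refine ⟨⟨hy₀W₀, ?_⟩, ?_, ?_⟩
    · change pr y₀ ∈ e.target
      rw [h1]
      exact e.map_source hae
    · change δ⁻¹ • (r₀.1 - r₀.1) ∈ _
      rw [sub_self, smul_zero]
      exact Metric.mem_ball_self one_pos
    · change δ⁻¹ • ((e.symm (pr y₀)).2 - r₀.2) ∈ _
      rw [h1, e.left_inv hae, sub_self, smul_zero]
      exact Metric.mem_ball_self one_pos
  · exact fun y hy => hNO (hW₀N hy.1.1)
  · intro a ha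
    obtain ⟨h1, h2, h3⟩ := hinv a ha
    refine ⟨⟨h1, ?_⟩, (hφr _ (hΨΩ a ha)).2.1, h2, h3⟩
    rw [mem_preimage, h2, h3]
    exact ha
  · intro y hy h0
    refine ⟨hy.2, ?_⟩
    have h1 := e.map_target hy.1.2
    have h2 : Φ (e.symm (pr y)) = pr y := by rw [← heΦ]; exact e.right_inv hy.1.2
    have h3 : m (κ y, τ y) = e.symm (pr y) := by
      refine Prod.ext ?_ ?_
      · have h4 := hΦ1 _ (heO h1)
        rw [h2, hpr1] at h4
        change δ • δ⁻¹ • (P y - r₀.1) = _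
        rw [smul_inv_smul₀ hδ', h4, add_sub_cancel_left]
      · change r₀.2 + δ • δ⁻¹ • ((e.symm (pr y)).2 - r₀.2) = _
        rw [smul_inv_smul₀ hδ', add_sub_cancel]
    change φ (Φ (m (κ y, τ y))) = y
    rw [h3, h2]
    exact (hφi y hy.1.1 h0).2
  · intro t ht
    have hmem : ∀ z ∈ Metric.ball (0 : Z) 1, Ψ (z, t) ∈ N ∧ ρ (Ψ (z, t)) = 0 := fun z hz =>
      ⟨hW₀N (hφr _ (hΨΩ (z, t) ⟨hz, ht⟩)).1, (hφr _ (hΨΩ (z, t) ⟨hz, ht⟩)).2.1⟩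
    refine ⟨contDiffOn_complex Metric.isOpen_ball ?_ ?_, ?_⟩
    · exact hΨs.comp (contDiff_id.prodMk contDiff_const).contDiffOn fun z hz => ⟨hz, ht⟩
    · intro z hz h
      rw [(hΨz t ht z hz).fderiv, _root_.smul_apply, _root_.smul_apply,
        hA_I _ (hmem z hz).1 (hmem z hz).2, smul_comm]
    · intro z hz h
      rw [(hΨz t ht z hz).fderiv, _root_.smul_apply, ← map_smul]
      exact ((hAP _ (hmem z hz)).1 _).1

end FlatFoliation

/-! ### Involutivity along a submanifold -/

/-- A projection onto the kernel of a surjective operator completes it to an isomorphism. -/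
lemma exists_kernel_projection {G H : Type*} [NormedAddCommGroup G] [NormedSpace ℝ G]
    [FiniteDimensional ℝ G] [NormedAddCommGroup H] [NormedSpace ℝ H] (f : G →L[ℝ] H)
    (hf : Function.Surjective f) :
    ∃ p : G →L[ℝ] f.ker, (∀ v : f.ker, p v = v) ∧ Function.Bijective fun v => (p v, f v) := by
  obtain ⟨p, hp⟩ := LinearMap.exists_leftInverse_of_injective f.ker.subtype f.ker.ker_subtype
  have hpK : ∀ v : f.ker, p v = v := fun v => LinearMap.congr_fun hp v
  refine ⟨p.toContinuousLinearMap, hpK, ?_, ?_⟩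
  · intro v w hvw
    obtain ⟨h1, h2⟩ := Prod.ext_iff.1 hvw
    have h3 : v - w ∈ f.ker := by
      change f (v - w) = 0
      rw [map_sub]
      exact sub_eq_zero.2 h2
    have h4 : p (v - w) = 0 := by
      rw [map_sub]
      exact sub_eq_zero.2 h1
    have h5 := hpK ⟨v - w, h3⟩
    rw [h4] at h5
    exact sub_eq_zero.1 (congrArg Subtype.val h5).symm
  · rintro ⟨a, c⟩
    obtain ⟨v, rfl⟩ := hf c
    refine ⟨v + (a - p v : f.ker), Prod.ext ?_ ?_⟩
    · change p (v + (a - p v : f.ker)) = a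
      rw [map_add, hpK, add_sub_cancel]
    · change f (v + (a - p v : f.ker)) = _
      have h6 : f (a - p v : f.ker) = 0 := (a - p v).2
      rw [map_add, h6, add_zero]

/-- If the complex parts of the tangent spaces of a submanifold are the kernel of a constant
two-form, then vector fields with values in them have brackets with values in them. -/
lemma lieBracket_mem_holomorphicPart {G : Type u} [NormedAddCommGroup G] [NormedSpace ℂ G]
    [FiniteDimensional ℂ G] {H : Type*} [NormedAddCommGroup H] [NormedSpace ℝ H]
    {V : Type*} [NormedAddCommGroup V] [NormedSpace ℝ V]
    {O : Set G} (hO : IsOpen O) {ρ : G → H}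
    (hρ : ContDiffOn ℝ ∞ ρ O) (σ : G →L[ℝ] G →L[ℝ] V) (hσ : ∀ a b, σ a b = -σ b a)
    (hker : ∀ y ∈ O, ρ y = 0 → ∀ v, fderiv ℝ ρ y v = 0 →
      (v ∈ holomorphicPart (fderiv ℝ ρ y).ker ↔ ∀ w, fderiv ℝ ρ y w = 0 → σ v w = 0))
    {y₀ : G} (hy₀ : y₀ ∈ O) (hρy₀ : ρ y₀ = 0)
    (hsurj : Function.Surjective (fderiv ℝ ρ y₀)) {X₁ X₂ : G → G}
    (hX₁ : ContDiffOn ℝ ∞ X₁ O) (hX₂ : ContDiffOn ℝ ∞ X₂ O)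
    (h₁ : ∀ y ∈ O, ρ y = 0 → X₁ y ∈ holomorphicPart (fderiv ℝ ρ y).ker)
    (h₂ : ∀ y ∈ O, ρ y = 0 → X₂ y ∈ holomorphicPart (fderiv ℝ ρ y).ker) :
    VectorField.lieBracket ℝ X₁ X₂ y₀ ∈ holomorphicPart (fderiv ℝ ρ y₀).ker := by
  obtain ⟨pr, -, hbij⟩ := exists_kernel_projection _ hsurj
  obtain ⟨W, Ω, φ, hW, hyW, hWO, hΩ, hφ, hφr, hφi, hφ'⟩ :=
    exists_graph_parametrization hO hρ hy₀ pr hbij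
  obtain ⟨hr, hφy⟩ := hφi y₀ hyW hρy₀
  set r := pr y₀
  have hφd : HasFDerivAt φ (fderiv ℝ φ r) r :=
    ((hφ.contDiffAt (hΩ.mem_nhds hr)).differentiableAt (by simp)).hasFDerivAt
  have hF : HasFDerivAt (fderiv ℝ φ) (fderiv ℝ (fderiv ℝ φ) r) r :=
    (((hφ.fderiv_of_isOpen (m := ∞) hΩ (by simp)).contDiffAt (hΩ.mem_nhds hr)).differentiableAt
      (by simp)).hasFDerivAt
  have hsymm : ∀ h k, fderiv ℝ (fderiv ℝ φ) r h k = fderiv ℝ (fderiv ℝ φ) r k h := fun h k =>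
    (hφ.contDiffAt (hΩ.mem_nhds hr)).isSymmSndFDerivAt minSmoothness_two_le h k
  -- the fields in the coordinates of the parametrization
  have key : ∀ X : G → G, ContDiffOn ℝ ∞ X O →
      (∀ y ∈ O, ρ y = 0 → X y ∈ holomorphicPart (fderiv ℝ ρ y).ker) →
      DifferentiableAt ℝ (fun s => pr (X (φ s))) r ∧
      (∀ s ∈ Ω, fderiv ℝ φ s (pr (X (φ s))) = X (φ s)) ∧
      (∀ᶠ s in 𝓝 r, ∀ η, σ (fderiv ℝ φ s (pr (X (φ s)))) (fderiv ℝ φ s η) = 0) ∧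
      ∀ ζ, fderiv ℝ X y₀ (fderiv ℝ φ r ζ) = fderiv ℝ (fderiv ℝ φ) r ζ (pr (X (φ r))) +
        fderiv ℝ φ r (fderiv ℝ (fun s => pr (X (φ s))) r ζ) := by
    intro X hX hXm
    have hXd : HasFDerivAt X (fderiv ℝ X y₀) (φ r) := by
      rw [hφy]
      exact ((hX.contDiffAt (hO.mem_nhds hy₀)).differentiableAt (by simp)).hasFDerivAt
    have hb : DifferentiableAt ℝ (fun s => pr (X (φ s))) r :=
      (pr.hasFDerivAt.comp r (hXd.comp r hφd)).differentiableAt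
    have htan : ∀ s ∈ Ω, fderiv ℝ φ s (pr (X (φ s))) = X (φ s) := fun s hs =>
      (hφ' s hs).2 _ (mem_holomorphicPart_ker.1 (hXm _ (hWO (hφr s hs).1) (hφr s hs).2.1)).1
    refine ⟨hb, htan, ?_, fun ζ => ?_⟩
    · filter_upwards [hΩ.mem_nhds hr] with s hs η
      rw [htan s hs]
      have hm := hXm _ (hWO (hφr s hs).1) (hφr s hs).2.1
      exact (hker _ (hWO (hφr s hs).1) (hφr s hs).2.1 _ (mem_holomorphicPart_ker.1 hm).1).1 hm _
        ((hφ' s hs).1 η).1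
    · have h1 := (hXd.comp r hφd).unique ((hF.clm_apply hb.hasFDerivAt).congr_of_eventuallyEq (by
        filter_upwards [hΩ.mem_nhds hr] with s hs
        exact (htan s hs).symm))
      have h2 := DFunLike.congr_fun h1 ζ
      simp only [ContinuousLinearMap.comp_apply, _root_.add_apply,
        ContinuousLinearMap.flip_apply] at h2
      rw [h2, add_comm]
  obtain ⟨hb₁, ht₁, hs₁, hD₁⟩ := key X₁ hX₁ h₁
  obtain ⟨hb₂, ht₂, hs₂, hD₂⟩ := key X₂ hX₂ h₂
  set b₁ := fun s => pr (X₁ (φ s))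
  set b₂ := fun s => pr (X₂ (φ s))
  have hbr : VectorField.lieBracket ℝ X₁ X₂ y₀ =
      fderiv ℝ φ r (fderiv ℝ b₂ r (b₁ r) - fderiv ℝ b₁ r (b₂ r)) := by
    have e₁ : fderiv ℝ φ r (b₁ r) = X₁ y₀ := by rw [ht₁ r hr, hφy]
    have e₂ : fderiv ℝ φ r (b₂ r) = X₂ y₀ := by rw [ht₂ r hr, hφy]
    rw [VectorField.lieBracket, ← e₁, ← e₂, hD₁, hD₂, hsymm (b₂ r), map_sub]
    change _ + _ - (_ + _) = _
    abel
  have htg := (hφ' r hr).1 (fderiv ℝ b₂ r (b₁ r) - fderiv ℝ b₁ r (b₂ r))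
  rw [hφy, ← hbr] at htg
  refine (hker y₀ hy₀ hρy₀ _ htg.1).2 fun w hw => ?_
  have h2 := (hφ' r hr).2 w (by rw [hφy]; exact hw)
  rw [hbr, ← h2]
  exact involutive_kernel σ hσ (hφ.contDiffAt (hΩ.mem_nhds hr)) hb₁ hb₂ hs₁ hs₂ _

/-! ### The tangent spaces of the conormal bundle: linear algebra -/

section ConormalTangent

variable {E : Type u} [NormedAddCommGroup E] [NormedSpace ℂ E] [FiniteDimensional ℂ E]

/-- The imaginary part of a complex linear form, as a real linear form. -/
def imCovector : (E →L[ℂ] ℂ) →L[ℝ] (E →L[ℝ] ℝ) :=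
  (ContinuousLinearMap.compL ℝ E ℂ ℝ Complex.imCLM).comp
    (ContinuousLinearMap.restrictScalarsL ℂ E ℂ ℝ ℝ)

omit [FiniteDimensional ℂ E] in
@[simp] lemma imCovector_apply (Φ : E →L[ℂ] ℂ) (w : E) : imCovector Φ w = (Φ w).im := rfl

omit [FiniteDimensional ℂ E] in
lemma imCovector_surjective : Function.Surjective (imCovector (E := E)) := by
  intro β
  refine ⟨Complex.I • StrongDual.extendRCLike (𝕜 := ℂ) β, ?_⟩
  ext w
  have h : (StrongDual.extendRCLike (𝕜 := ℂ) β w).re = β w :=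
    StrongDual.re_extendRCLike_apply (𝕜 := ℂ) β w
  simp [h]

/-- The holomorphic symplectic form `ω ((a, α), (b, β)) = α b - β a` of the cotangent bundle of a
complex vector space, as a real bilinear map. -/
def symplecticForm : (E × (E →L[ℂ] ℂ)) →L[ℝ] (E × (E →L[ℂ] ℂ)) →L[ℝ] ℂ :=
  LinearMap.mkContinuous₂
    (LinearMap.mk₂ ℝ (fun v w : E × (E →L[ℂ] ℂ) => v.2 w.1 - w.2 v.1)
      (fun a b c => by simp; ring) (fun c a b => by simp; ring)
      (fun a b c => by simp; ring) (fun c a b => by simp; ring)) 2 (by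
    intro v w
    have h1 : ‖v.2 w.1‖ ≤ ‖v‖ * ‖w‖ := (v.2.le_opNorm _).trans
      (mul_le_mul (norm_snd_le v) (norm_fst_le w) (norm_nonneg _) (norm_nonneg _))
    have h2 : ‖w.2 v.1‖ ≤ ‖w‖ * ‖v‖ := (w.2.le_opNorm _).trans
      (mul_le_mul (norm_snd_le w) (norm_fst_le v) (norm_nonneg _) (norm_nonneg _))
    rw [LinearMap.mk₂_apply]
    linarith [norm_sub_le (v.2 w.1) (w.2 v.1)])

omit [FiniteDimensional ℂ E] in
@[simp] lemma symplecticForm_apply (v w : E × (E →L[ℂ] ℂ)) :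
    symplecticForm v w = v.2 w.1 - w.2 v.1 := rfl

omit [FiniteDimensional ℂ E] in
lemma symplecticForm_skew (v w : E × (E →L[ℂ] ℂ)) :
    symplecticForm v w = -symplecticForm w v := by simp

/-- The tangent space, at a point over `x`, of the bundle of the complex linear forms that are real
on the tangent spaces of a submanifold of `E`: here `T` is the tangent space of the submanifold at
`x`, and `Q` is the Hessian of the combination of defining functions whose differential is the
imaginary part of the given form. -/
def conormalTangent (T : Submodule ℝ E) (Q : E →L[ℝ] E →L[ℝ] ℝ) :
    Submodule ℝ (E × (E →L[ℂ] ℂ)) where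
  carrier := {v | v.1 ∈ T ∧ ∀ w ∈ T, (v.2 w).im = Q v.1 w}
  add_mem' := by
    rintro a b ⟨ha, ha'⟩ ⟨hb, hb'⟩
    refine ⟨add_mem ha hb, fun w hw => ?_⟩
    simp [ha' w hw, hb' w hw]
  zero_mem' := ⟨zero_mem _, fun w _ => by simp⟩
  smul_mem' := by
    rintro c a ⟨ha, ha'⟩
    refine ⟨T.smul_mem c ha, fun w hw => ?_⟩
    simp [ha' w hw]

variable {T : Submodule ℝ E} {Q : E →L[ℝ] E →L[ℝ] ℝ}

omit [FiniteDimensional ℂ E] in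
lemma mem_conormalTangent {v : E × (E →L[ℂ] ℂ)} :
    v ∈ conormalTangent T Q ↔ v.1 ∈ T ∧ ∀ w ∈ T, (v.2 w).im = Q v.1 w := Iff.rfl

/-- The tangent space is Lagrangian for the imaginary part of the symplectic form. Therefore its
complex part is the kernel of the restriction of the symplectic form. -/
lemma mem_holomorphicPart_conormalTangent (hQ : ∀ a b, Q a b = Q b a) {v : E × (E →L[ℂ] ℂ)}
    (hv : v ∈ conormalTangent T Q) :
    v ∈ holomorphicPart (conormalTangent T Q) ↔
      ∀ w ∈ conormalTangent T Q, symplecticForm v w = 0 := by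
  have him : ∀ v ∈ conormalTangent T Q, ∀ w ∈ conormalTangent T Q,
      (symplecticForm v w).im = 0 := by
    rintro v ⟨hv, hv'⟩ w ⟨hw, hw'⟩
    rw [symplecticForm_apply, Complex.sub_im, hv' _ hw, hw' _ hv, hQ, sub_self]
  have hI : ∀ w, symplecticForm (Complex.I • v) w = Complex.I * symplecticForm v w := by
    intro w
    simp only [symplecticForm_apply, Prod.smul_snd, Prod.smul_fst, map_smul, _root_.smul_apply,
      smul_eq_mul]
    ring
  rw [mem_holomorphicPart]
  constructor
  · rintro ⟨-, hIv⟩ w hw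
    have h1 := him _ hIv w hw
    rw [hI, Complex.I_mul_im] at h1
    exact Complex.ext h1 (him v hv w hw)
  · intro h
    have h' : ∀ w ∈ conormalTangent T Q,
        (Complex.I • v.2 w.1 - w.2 (Complex.I • v.1)).im = 0 := by
      intro w hw
      have h2 := hI w
      rw [h w hw, mul_zero] at h2
      exact congrArg Complex.im h2
    have hT : Complex.I • v.1 ∈ T := by
      by_contra hn
      obtain ⟨f, hf, hf'⟩ := Submodule.exists_le_ker_of_notMem hn
      obtain ⟨α, hα⟩ := imCovector_surjective (LinearMap.toContinuousLinearMap f)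
      have hαw : ∀ w, (α w).im = f w := fun w => DFunLike.congr_fun hα w
      have h3 := h' (0, α) ⟨zero_mem _, fun w hw => by
        rw [hαw, show f w = 0 from hf' hw]
        simp⟩
      rw [map_zero, smul_zero, zero_sub, Complex.neg_im, hαw, neg_eq_zero] at h3
      exact hf h3
    refine ⟨hv, hT, fun w hw => ?_⟩
    obtain ⟨α, hα⟩ := imCovector_surjective (Q w)
    have hαw : ∀ z, (α z).im = Q w z := fun z => DFunLike.congr_fun hα z
    have h3 := h' (w, α) ⟨hw, fun z _ => hαw z⟩
    rw [Complex.sub_im, hαw, sub_eq_zero] at h3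
    exact h3.trans (hQ _ _)

end ConormalTangent

/-! ### The Levi form and the dimension of the holomorphic tangent spaces -/

section LeviRank

variable {E : Type u} [NormedAddCommGroup E] [NormedSpace ℂ E] [FiniteDimensional ℂ E]
  {T : Submodule ℝ E} {Q : E →L[ℝ] E →L[ℝ] ℝ}

/-- The rank-nullity formula for a sesquilinear form. -/
lemma finrank_ker_add_finrank_range {D : Type*} [AddCommGroup D] [Module ℂ D]
    [FiniteDimensional ℂ D] (L : D →ₗ⋆[ℂ] D →ₗ[ℂ] ℂ) :
    Module.finrank ℂ L.ker + Module.finrank ℂ L.range = Module.finrank ℂ D := by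
  set L' : D →ₗ[ℝ] (D →ₗ[ℂ] ℂ) :=
    { toFun := L
      map_add' := map_add L
      map_smul' := fun c a => by
        have h : c • a = (c : ℂ) • a := rfl
        rw [h, LinearMap.map_smulₛₗ, Complex.conj_ofReal]
        rfl }
  have h1 := L'.finrank_range_add_finrank_ker
  have h2 : L'.range = (L.range).restrictScalars ℝ := by
    ext x
    rfl
  have h3 : L'.ker = (L.ker).restrictScalars ℝ := by
    ext x
    rfl
  rw [h2, h3] at h1
  have e1 := finrank_real_of_complex L.ker
  have e2 := finrank_real_of_complex L.range
  have e3 := finrank_real_of_complex D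
  have h1' : Module.finrank ℝ L.range + Module.finrank ℝ L.ker = Module.finrank ℝ D := h1
  omega

omit [FiniteDimensional ℂ E] in
/-- The Hermitian form that a real quadratic form induces on the complex part of `T` is determined
by polarization. -/
lemma re_of_hermitian (hQ : ∀ a b, Q a b = Q b a)
    (L : holomorphicPart T →ₗ⋆[ℂ] holomorphicPart T →ₗ[ℂ] ℂ)
    (hL : ∀ a b, L a b = conj (L b a))
    (hLQ : ∀ a, L a a = ((-(Q a a + Q (Complex.I • (a : E)) (Complex.I • (a : E))) : ℝ) : ℂ))
    (a b : holomorphicPart T) :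
    (L a b).re = -(Q a b + Q (Complex.I • (a : E)) (Complex.I • (b : E))) := by
  have h1 := congrArg Complex.re (hLQ (a + b))
  have h2 := congrArg Complex.re (hLQ a)
  have h3 := congrArg Complex.re (hLQ b)
  have h4 := congrArg Complex.re (hL b a)
  simp only [Submodule.coe_add, smul_add, map_add, LinearMap.add_apply, Complex.add_re,
    Complex.ofReal_re, _root_.add_apply, Complex.conj_re] at h1 h2 h3 h4
  rw [hQ b a, hQ (Complex.I • (b : E)) (Complex.I • (a : E))] at h1
  linarith

/-- The complex part of the tangent space of the conormal bundle projects isomorphically onto the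
null space of the Levi form. -/
lemma finrank_holomorphicPart_conormalTangent (hQ : ∀ a b, Q a b = Q b a)
    (hgen : ∀ w : E, ∃ a ∈ T, ∃ b ∈ T, w = a + Complex.I • b)
    (L : holomorphicPart T →ₗ⋆[ℂ] holomorphicPart T →ₗ[ℂ] ℂ)
    (hL : ∀ a b, L a b = conj (L b a))
    (hLQ : ∀ a, L a a = ((-(Q a a + Q (Complex.I • (a : E)) (Complex.I • (a : E))) : ℝ) : ℂ)) :
    Module.finrank ℂ (holomorphicPart (conormalTangent T Q)) + Module.finrank ℂ L.range =
      Module.finrank ℂ (holomorphicPart T) := by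
  rw [← finrank_ker_add_finrank_range L]
  congr 1
  have hre := re_of_hermitian hQ L hL hLQ
  have hker : ∀ a : holomorphicPart T, a ∈ L.ker ↔ ∀ b : holomorphicPart T,
      Q a b + Q (Complex.I • (a : E)) (Complex.I • (b : E)) = 0 := by
    intro a
    rw [LinearMap.mem_ker]
    constructor
    · intro h b
      have h1 := hre a b
      rw [h] at h1
      have h2 : (0 : ℝ) = -(Q a b + Q (Complex.I • (a : E)) (Complex.I • (b : E))) := h1
      linarith
    · intro h
      ext b
      refine Complex.ext ?_ ?_
      · rw [hre, h]
        simp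
      · have h1 := hre a (Complex.I • b)
        rw [h, map_smul, smul_eq_mul, Complex.I_mul_re] at h1
        simpa using h1
  have hI : ∀ z : ℂ, (Complex.I * z).im = z.re := fun z => by simp
  set f : holomorphicPart (conormalTangent T Q) →ₗ[ℂ] L.ker :=
    { toFun := fun v => ⟨⟨v.1.1, v.2.1.1, v.2.2.1⟩, by
        rw [hker]
        rintro ⟨b, hb⟩
        have h1 := v.2.1.2 b hb.1
        have h2 := v.2.2.2 (Complex.I • b) hb.2
        have h3 : ((Complex.I • (v : E × (E →L[ℂ] ℂ))).2 (Complex.I • b)).im =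
            -((v : E × (E →L[ℂ] ℂ)).2 b).im := by
          rw [Prod.smul_snd, map_smul, _root_.smul_apply, smul_smul, Complex.I_mul_I]
          simp
        rw [h3, h1] at h2
        change Q v.1.1 b + Q (Complex.I • v.1.1) (Complex.I • b) = 0
        have h5 : -(Q v.1.1 b) = Q (Complex.I • v.1.1) (Complex.I • b) := h2
        linarith⟩
      map_add' := fun v w => rfl
      map_smul' := fun c v => rfl }
  refine (LinearEquiv.ofBijective f ⟨?_, ?_⟩).finrank_eq
  · rw [injective_iff_map_eq_zero]
    intro v hv
    have h0 : v.1.1 = 0 := congrArg (fun a : L.ker => ((a : holomorphicPart T) : E)) hv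
    have h1 : ∀ w ∈ T, v.1.2 w = 0 := by
      intro w hw
      have e1 := v.2.1.2 w hw
      have e2 := v.2.2.2 w hw
      rw [h0] at e1
      rw [Prod.smul_snd, Prod.smul_fst, h0, smul_zero, _root_.smul_apply, smul_eq_mul, hI] at e2
      refine Complex.ext ?_ ?_
      · simpa using e2
      · simpa using e1
    refine Subtype.ext (Prod.ext h0 (ContinuousLinearMap.ext fun w => ?_))
    obtain ⟨a, ha, b, hb, rfl⟩ := hgen w
    rw [map_add, map_smul, h1 a ha, h1 b hb]
    simp
  · rintro ⟨⟨a, ha⟩, hak⟩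
    rw [hker] at hak
    -- the real form which is `Q a` on `T` and `Q (i a)` after multiplication by `i`
    set j : (T × T) →ₗ[ℝ] E :=
      { toFun := fun p => (p.1 : E) + Complex.I • (p.2 : E)
        map_add' := fun p q => by
          simp only [Prod.fst_add, Prod.snd_add, Submodule.coe_add, smul_add]
          abel
        map_smul' := fun c p => by
          simp only [Prod.smul_fst, Prod.smul_snd, Submodule.coe_smul, RingHom.id_apply, smul_add]
          rw [smul_comm] }
    set l : (T × T) →ₗ[ℝ] ℝ :=
      { toFun := fun p => Q a p.1 + Q (Complex.I • a) p.2
        map_add' := fun p q => by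
          simp only [Prod.fst_add, Prod.snd_add, Submodule.coe_add, map_add]
          ring
        map_smul' := fun c p => by
          simp only [Prod.smul_fst, Prod.smul_snd, Submodule.coe_smul, RingHom.id_apply, map_smul,
            smul_eq_mul]
          ring }
    have hjl : j.ker ≤ l.ker := by
      rintro ⟨w, w'⟩ h
      have h1 : (w : E) + Complex.I • (w' : E) = 0 := h
      have h2 : (w : E) = -(Complex.I • (w' : E)) := eq_neg_of_add_eq_zero_left h1
      have h3 : Complex.I • (w : E) = w' := by
        rw [h2, smul_neg, smul_smul, Complex.I_mul_I]
        simp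
      have h4 := hak ⟨w, w.2, by rw [h3]; exact w'.2⟩
      change Q a w + Q (Complex.I • a) w' = 0
      rw [← h3]
      exact h4
    obtain ⟨β, hβ⟩ : ∃ β : E →ₗ[ℝ] ℝ, β.comp j = l := by
      have h1 : l ∈ j.ker.dualAnnihilator := by
        rw [Submodule.mem_dualAnnihilator]
        exact fun w hw => hjl hw
      rw [← LinearMap.range_dualMap_eq_dualAnnihilator_ker] at h1
      exact h1
    have hβ' : ∀ p, β (j p) = l p := fun p => LinearMap.congr_fun hβ p
    obtain ⟨α, hα⟩ := imCovector_surjective (LinearMap.toContinuousLinearMap β)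
    have hα' : ∀ w, (α w).im = β w := fun w => DFunLike.congr_fun hα w
    refine ⟨⟨(a, α), ⟨ha.1, fun w hw => ?_⟩, ha.2, fun w hw => ?_⟩, rfl⟩
    · have h1 := hβ' (⟨w, hw⟩, 0)
      simpa [j, l, hα'] using h1
    · have h1 := hβ' (0, ⟨w, hw⟩)
      have h2 : ((Complex.I • ((a, α) : E × (E →L[ℂ] ℂ))).2 w).im = (α (Complex.I • w)).im := by
        rw [map_smul]
        rfl
      rw [h2, hα']
      simpa [j, l] using h1

end LeviRank

/-! ### Defining functions of the conormal bundle -/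

section ConormalBundle

variable {E : Type u} [NormedAddCommGroup E] [NormedSpace ℂ E] [FiniteDimensional ℂ E]
  {H : Type*} [NormedAddCommGroup H] [NormedSpace ℝ H] [FiniteDimensional ℝ H]
  {K : Type*} [NormedAddCommGroup K] [NormedSpace ℝ K] [FiniteDimensional ℝ K]

omit [FiniteDimensional ℝ H] [FiniteDimensional ℝ K] in
/-- The kernels of a smooth family of surjective operators are smoothly parametrized by one of
them. -/
lemma exists_kernel_family {O : Set E} (hO : IsOpen O) {L : E → E →L[ℝ] H}
    (hL : ContDiffOn ℝ ∞ L O) {x₀ : E} (hx₀ : x₀ ∈ O) (hs : Function.Surjective (L x₀))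
    (i : K ≃L[ℝ] (L x₀).ker) :
    ∃ (N : Set E) (κ : E → K →L[ℝ] E), IsOpen N ∧ x₀ ∈ N ∧ N ⊆ O ∧
      ContDiffOn ℝ ∞ κ N ∧ ∀ y ∈ N, Function.Surjective (L y) ∧ (∀ w, L y (κ y w) = 0) ∧
        Function.Injective (κ y) ∧ ∀ v, L y v = 0 → ∃ w, κ y w = v := by
  obtain ⟨p, hp, hbij⟩ := exists_kernel_projection (L x₀) hs
  set F : E → E →L[ℝ] (L x₀).ker × H := fun y => p.prod (L y)
  have hFs : ContDiffOn ℝ ∞ F O := by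
    have h2 : F = fun y => (ContinuousLinearMap.inl ℝ (L x₀).ker H).comp p +
        (ContinuousLinearMap.inr ℝ (L x₀).ker H).comp (L y) := by
      funext y
      ext v <;> simp [F]
    rw [h2]
    exact contDiffOn_const.add (contDiffOn_const.clm_comp hL)
  set F₀ : E ≃L[ℝ] (L x₀).ker × H :=
    (LinearEquiv.ofBijective (F x₀).toLinearMap hbij).toContinuousLinearEquiv
  set N : Set E := O ∩ F ⁻¹' range ContinuousLinearEquiv.toContinuousLinearMap
  have hN : IsOpen N := hFs.continuousOn.isOpen_inter_preimage hO ContinuousLinearEquiv.isOpen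
  set κ : E → K →L[ℝ] E := fun y =>
    (F y).inverse.comp ((ContinuousLinearMap.inl ℝ (L x₀).ker H).comp i.toContinuousLinearMap)
  refine ⟨N, κ, hN, ⟨hx₀, F₀, rfl⟩, inter_subset_left, ?_, ?_⟩
  · intro y hy
    obtain ⟨f, hf⟩ := hy.2
    have h1 : ContDiffAt ℝ ∞ ContinuousLinearMap.inverse (F y) := by
      rw [← hf]
      exact contDiffAt_map_inverse f
    have h2 : ContDiffAt ℝ ∞ F y := hFs.contDiffAt (hO.mem_nhds hy.1)
    exact ((h1.comp y h2).clm_comp contDiffAt_const).contDiffWithinAt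
  · rintro y ⟨hyO, f, hf⟩
    have hFf : ∀ v, (p v, L y v) = f v := fun v => by
      change F y v = _
      rw [← hf]
      rfl
    have hκ : ∀ w, κ y w = f.symm (i w, 0) := by
      intro w
      change (F y).inverse (i w, 0) = _
      rw [← hf, ContinuousLinearMap.inverse_equiv]
      rfl
    refine ⟨fun c => ⟨f.symm (0, c), ?_⟩, fun w => ?_, fun w w' h => ?_,
      fun v hv => ⟨i.symm (p v), ?_⟩⟩
    · have h1 := hFf (f.symm (0, c))
      rw [ContinuousLinearEquiv.apply_symm_apply] at h1
      exact congrArg Prod.snd h1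
    · have h1 := hFf (κ y w)
      rw [hκ, ContinuousLinearEquiv.apply_symm_apply] at h1
      rw [hκ]
      exact congrArg Prod.snd h1
    · rw [hκ, hκ] at h
      exact i.injective (congrArg Prod.fst (f.symm.injective h))
    · rw [hκ, ContinuousLinearEquiv.symm_apply_eq, ← hFf, hv, i.apply_symm_apply]

/-- The Hessian of `t ∘ ρ` at `x`, for a linear form `t`. -/
def hessian (ρ : E → H) (t : H →L[ℝ] ℝ) (x : E) : E →L[ℝ] E →L[ℝ] ℝ :=
  (ContinuousLinearMap.compL ℝ E H ℝ t).comp (fderiv ℝ (fderiv ℝ ρ) x)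

omit [FiniteDimensional ℂ E] [FiniteDimensional ℝ H] in
@[simp] lemma hessian_apply (ρ : E → H) (t : H →L[ℝ] ℝ) (x a b : E) :
    hessian ρ t x a b = t (fderiv ℝ (fderiv ℝ ρ) x a b) := rfl

omit [FiniteDimensional ℂ E] [FiniteDimensional ℝ H] in
lemma hessian_symm {ρ : E → H} {x : E} (hρ : ContDiffAt ℝ ∞ ρ x) (t : H →L[ℝ] ℝ) (a b : E) :
    hessian ρ t x a b = hessian ρ t x b a :=
  congrArg t (hρ.isSymmSndFDerivAt minSmoothness_two_le a b)

omit [FiniteDimensional ℂ E] in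
/-- A real covector that vanishes on the kernel of an operator factors through it. -/
lemma exists_factor {f : E →L[ℝ] H} {β : E →L[ℝ] ℝ}
    (h : ∀ w, f w = 0 → β w = 0) : ∃ t : H →L[ℝ] ℝ, ∀ w, β w = t (f w) := by
  have h1 : β.toLinearMap ∈ f.toLinearMap.ker.dualAnnihilator := by
    rw [Submodule.mem_dualAnnihilator]
    exact fun w hw => h w hw
  rw [← LinearMap.range_dualMap_eq_dualAnnihilator_ker] at h1
  obtain ⟨t, ht⟩ := h1
  exact ⟨LinearMap.toContinuousLinearMap t, fun w => (LinearMap.congr_fun ht w).symm⟩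

omit [FiniteDimensional ℝ H] [FiniteDimensional ℝ K] in
/-- Let `ρ = 0` define a submanifold of `E`. The set of the complex linear forms that are real on
its tangent spaces is the zero set of a submersion, with the expected tangent spaces. -/
lemma exists_conormal_defining {O : Set E} (hO : IsOpen O) {ρ : E → H} (hρ : ContDiffOn ℝ ∞ ρ O)
    {x₀ : E} (hx₀ : x₀ ∈ O) (hs : Function.Surjective (fderiv ℝ ρ x₀))
    (i : K ≃L[ℝ] (fderiv ℝ ρ x₀).ker) :
    ∃ (N : Set E) (R : E × (E →L[ℂ] ℂ) → H × (K →L[ℝ] ℝ)),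
      IsOpen N ∧ x₀ ∈ N ∧ N ⊆ O ∧ ContDiffOn ℝ ∞ R (N ×ˢ univ) ∧
      ∀ p : E × (E →L[ℂ] ℂ), p.1 ∈ N → Function.Surjective (fderiv ℝ ρ p.1) ∧
        (R p = 0 ↔ ρ p.1 = 0 ∧ ∀ w, fderiv ℝ ρ p.1 w = 0 → (p.2 w).im = 0) ∧
        (R p = 0 → Function.Surjective (fderiv ℝ R p) ∧
          ∀ t : H →L[ℝ] ℝ, (∀ w, (p.2 w).im = t (fderiv ℝ ρ p.1 w)) →
            (fderiv ℝ R p).ker = conormalTangent (fderiv ℝ ρ p.1).ker (hessian ρ t p.1)) := by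
  have hρ' : ContDiffOn ℝ ∞ (fderiv ℝ ρ) O := hρ.fderiv_of_isOpen hO (by simp)
  obtain ⟨N, κ, hN, hx₀N, hNO, hκ, hκN⟩ := exists_kernel_family hO hρ' hx₀ hs i
  set R : E × (E →L[ℂ] ℂ) → H × (K →L[ℝ] ℝ) :=
    fun p => (ρ p.1, (imCovector p.2).comp (κ p.1)) with hR
  have hRs : ContDiffOn ℝ ∞ R (N ×ˢ univ) := by
    have h1 : ContDiffOn ℝ ∞ (fun p : E × (E →L[ℂ] ℂ) => ρ p.1) (N ×ˢ univ) :=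
      (hρ.mono hNO).comp contDiffOn_fst fun p hp => hp.1
    have h2 : ContDiffOn ℝ ∞ (fun p : E × (E →L[ℂ] ℂ) => κ p.1) (N ×ˢ univ) :=
      hκ.comp contDiffOn_fst fun p hp => hp.1
    have h3 : ContDiffOn ℝ ∞ (fun p : E × (E →L[ℂ] ℂ) => imCovector p.2) (N ×ˢ univ) :=
      (imCovector.contDiff.comp contDiff_snd).contDiffOn
    exact h1.prodMk (h3.clm_comp h2)
  refine ⟨N, R, hN, hx₀N, hNO, hRs, fun p hp => ?_⟩
  obtain ⟨hsp, hκ0, hκi, hκs⟩ := hκN p.1 hp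
  have hρd : HasFDerivAt ρ (fderiv ℝ ρ p.1) p.1 :=
    ((hρ.contDiffAt (hO.mem_nhds (hNO hp))).differentiableAt (by simp)).hasFDerivAt
  have hρd' : HasFDerivAt (fderiv ℝ ρ) (fderiv ℝ (fderiv ℝ ρ) p.1) p.1 :=
    ((hρ'.contDiffAt (hO.mem_nhds (hNO hp))).differentiableAt (by simp)).hasFDerivAt
  have hκd : HasFDerivAt κ (fderiv ℝ κ p.1) p.1 :=
    ((hκ.contDiffAt (hN.mem_nhds hp)).differentiableAt (by simp)).hasFDerivAt
  have hRd : ∀ v, fderiv ℝ R p v = (fderiv ℝ ρ p.1 v.1,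
      (imCovector v.2).comp (κ p.1) + (imCovector p.2).comp (fderiv ℝ κ p.1 v.1)) := by
    intro v
    have h1 := hρd.comp p (hasFDerivAt_fst (𝕜 := ℝ) (E := E) (F := E →L[ℂ] ℂ))
    have h2 := hκd.comp p (hasFDerivAt_fst (𝕜 := ℝ) (E := E) (F := E →L[ℂ] ℂ))
    have h3 := (imCovector (E := E)).hasFDerivAt.comp p
      (hasFDerivAt_snd (𝕜 := ℝ) (E := E) (F := E →L[ℂ] ℂ))
    have h4 : HasFDerivAt R _ p := h1.prodMk (h3.clm_comp h2)
    rw [h4.fderiv]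
    refine Prod.ext rfl ?_
    exact add_comm _ _
  -- differentiate `ρ' ∘ κ = 0`
  have hdiff : ∀ a w, fderiv ℝ (fderiv ℝ ρ) p.1 a (κ p.1 w) +
      fderiv ℝ ρ p.1 (fderiv ℝ κ p.1 a w) = 0 := by
    intro a w
    have h1 := hρd'.clm_apply (hκd.clm_apply (hasFDerivAt_const w p.1))
    have h2 := h1.unique ((hasFDerivAt_const (0 : H) p.1).congr_of_eventuallyEq (by
      filter_upwards [hN.mem_nhds hp] with y hy
      exact (hκN y hy).2.1 w))
    have h3 := DFunLike.congr_fun h2 a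
    simp at h3
    rw [add_comm]
    exact h3
  refine ⟨hsp, ?_, fun hp0 => ⟨?_, fun t ht => ?_⟩⟩
  · rw [hR, Prod.mk_eq_zero]
    refine and_congr_right fun _ => ⟨fun h w hw => ?_, fun h => ?_⟩
    · obtain ⟨k, rfl⟩ := hκs w hw
      exact DFunLike.congr_fun h k
    · ext k
      exact h _ (hκ0 k)
  · rintro ⟨c, β⟩
    obtain ⟨a, rfl⟩ := hsp c
    -- extend a functional along the injective map `κ`
    obtain ⟨l, hl⟩ := LinearMap.exists_leftInverse_of_injective (κ p.1).toLinearMap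
      (LinearMap.ker_eq_bot.2 hκi)
    obtain ⟨α, hα⟩ := imCovector_surjective
      ((β - (imCovector p.2).comp (fderiv ℝ κ p.1 a)).comp (LinearMap.toContinuousLinearMap l))
    refine ⟨(a, α), ?_⟩
    rw [hRd]
    refine Prod.ext rfl ?_
    ext w
    have h1 : l (κ p.1 w) = w := LinearMap.congr_fun hl w
    change imCovector α (κ p.1 w) + imCovector p.2 (fderiv ℝ κ p.1 a w) = β w
    rw [hα]
    change (β - (imCovector p.2).comp (fderiv ℝ κ p.1 a)) (l (κ p.1 w)) + _ = _
    rw [h1, _root_.sub_apply]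
    exact sub_add_cancel _ _
  · ext v
    rw [LinearMap.mem_ker, mem_conormalTangent]
    change fderiv ℝ R p v = 0 ↔ fderiv ℝ ρ p.1 v.1 = 0 ∧ ∀ w, fderiv ℝ ρ p.1 w = 0 → _
    rw [hRd, Prod.mk_eq_zero]
    have h1 : ∀ k, (v.2 (κ p.1 k)).im + (p.2 (fderiv ℝ κ p.1 v.1 k)).im =
        (v.2 (κ p.1 k)).im - hessian ρ t p.1 v.1 (κ p.1 k) := by
      intro k
      rw [ht, eq_neg_of_add_eq_zero_right (hdiff v.1 k), map_neg, hessian_apply, sub_eq_add_neg]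
    refine and_congr_right fun _ => ⟨fun h w hw => ?_, fun h => ?_⟩
    · obtain ⟨k, rfl⟩ := hκs w hw
      refine sub_eq_zero.1 ((h1 k).symm.trans ?_)
      exact DFunLike.congr_fun h k
    · ext k
      refine (h1 k).trans (sub_eq_zero.2 (h _ (hκ0 k)))

/-- The Levi form of a submanifold, computed from the Hessian of a defining function. -/
lemma levi_eq_hessian {O : Set E} (hO : IsOpen O) {ρ : E → H} (hρ : ContDiffOn ℝ ∞ ρ O)
    {x : E} (hx : x ∈ O) (hρx : ρ x = 0) (hs : Function.Surjective (fderiv ℝ ρ x)) {V : E → E}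
    (hV : ContDiffOn ℝ ∞ V O)
    (hVm : ∀ y ∈ O, ρ y = 0 → V y ∈ holomorphicPart (fderiv ℝ ρ y).ker) (t : H →L[ℝ] ℝ) :
    t (fderiv ℝ ρ x (Complex.I • VectorField.lieBracket ℝ (fun y => Complex.I • V y) V x)) =
      -(hessian ρ t x (V x) (V x) +
        hessian ρ t x (Complex.I • V x) (Complex.I • V x)) := by
  have hρ' : ContDiffOn ℝ ∞ (fderiv ℝ ρ) O := hρ.fderiv_of_isOpen hO (by simp)
  have hρd' : HasFDerivAt (fderiv ℝ ρ) (fderiv ℝ (fderiv ℝ ρ) x) x :=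
    ((hρ'.contDiffAt (hO.mem_nhds hx)).differentiableAt (by simp)).hasFDerivAt
  have hd : ∀ X : E → E, ContDiffOn ℝ ∞ X O → (∀ y ∈ O, ρ y = 0 → fderiv ℝ ρ y (X y) = 0) →
      ∀ w, fderiv ℝ ρ x w = 0 →
        hessian ρ t x w (X x) + t (fderiv ℝ ρ x (fderiv ℝ X x w)) = 0 := by
    intro X hX h0 w hw
    have hXd : HasFDerivAt X (fderiv ℝ X x) x :=
      ((hX.contDiffAt (hO.mem_nhds hx)).differentiableAt (by simp)).hasFDerivAt
    have h1 : ContDiffOn ℝ ∞ (fun y => t (fderiv ℝ ρ y (X y))) O :=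
      t.contDiff.comp_contDiffOn (hρ'.clm_apply hX)
    have h2 := fderiv_eq_zero_of_vanishing (hρ.contDiffAt (hO.mem_nhds hx))
      (h1.contDiffAt (hO.mem_nhds hx)) hρx hs (by
        filter_upwards [hO.mem_nhds hx] with y hy hy0
        rw [h0 y hy hy0, map_zero]) hw
    have h3 := (t.hasFDerivAt.comp x (hρd'.clm_apply hXd)).fderiv
    rw [show (fun y => t (fderiv ℝ ρ y (X y))) = t ∘ fun y => fderiv ℝ ρ y (X y) from rfl,
      h3] at h2
    simp only [ContinuousLinearMap.comp_apply, _root_.add_apply, ContinuousLinearMap.flip_apply,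
      map_add] at h2
    rw [add_comm]
    exact h2
  have hVx := mem_holomorphicPart_ker.1 (hVm x hx hρx)
  have hIV : ContDiffOn ℝ ∞ (fun y => Complex.I • V y) O := hV.const_smul Complex.I
  have e1 := hd V hV (fun y hy h0 => (mem_holomorphicPart_ker.1 (hVm y hy h0)).1) (V x) hVx.1
  have e2 := hd _ hIV (fun y hy h0 => (mem_holomorphicPart_ker.1 (hVm y hy h0)).2)
    (Complex.I • V x) hVx.2
  have hVd : DifferentiableAt ℝ V x :=
    (hV.contDiffAt (hO.mem_nhds hx)).differentiableAt (by simp)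
  have hfd : fderiv ℝ (fun y => Complex.I • V y) x = Complex.I • fderiv ℝ V x :=
    fderiv_const_smul hVd Complex.I
  rw [hfd, _root_.smul_apply] at e2
  have hbr : Complex.I • VectorField.lieBracket ℝ (fun y => Complex.I • V y) V x =
      Complex.I • fderiv ℝ V x (Complex.I • V x) + fderiv ℝ V x (V x) := by
    rw [VectorField.lieBracket, hfd, _root_.smul_apply, smul_sub, smul_smul, Complex.I_mul_I,
      neg_one_smul, sub_neg_eq_add]
  rw [hbr, map_add, map_add]
  linarith

end ConormalBundle

section Charts

variable {F : Type*} [NormedAddCommGroup F] [NormedSpace ℂ F]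
  {Y : Type v} [TopologicalSpace Y] [ChartedSpace F Y]

/-- Complex differentials are real differentials. -/
lemma hasMFDerivAt_real {F' : Type*} [NormedAddCommGroup F'] [NormedSpace ℂ F'] {Y' : Type*}
    [TopologicalSpace Y'] [ChartedSpace F' Y'] {f : Y → Y'} {y : Y} {f' : F →L[ℂ] F'}
    (h : HasMFDerivAt 𝓘(ℂ, F) 𝓘(ℂ, F') f y f') :
    HasMFDerivAt 𝓘(ℝ, F) 𝓘(ℝ, F') f y (f'.restrictScalars ℝ) :=
  ⟨h.1, HasFDerivWithinAt.restrictScalars ℝ h.2⟩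

variable (F) in
/-- The differential at `y` of the preferred chart at `y₀`. -/
def chartDeriv (y₀ y : Y) : F →L[ℂ] F := mfderiv 𝓘(ℂ, F) 𝓘(ℂ, F) (chartAt F y₀) y

variable [IsManifold 𝓘(ℂ, F) ∞ Y] {y₀ y : Y}

lemma hasMFDerivAt_chart_complex (hy : y ∈ (chartAt F y₀).source) :
    HasMFDerivAt 𝓘(ℂ, F) 𝓘(ℂ, F) (chartAt F y₀) y (chartDeriv F y₀ y) := by
  have : IsManifold 𝓘(ℂ, F) 1 Y := .of_le (n := ∞) (by simp)
  exact (mdifferentiableAt_atlas (chart_mem_atlas F y₀) hy).hasMFDerivAt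

lemma hasMFDerivAt_chart (hy : y ∈ (chartAt F y₀).source) :
    HasMFDerivAt 𝓘(ℝ, F) 𝓘(ℝ, F) (chartAt F y₀) y ((chartDeriv F y₀ y).restrictScalars ℝ) :=
  hasMFDerivAt_real (hasMFDerivAt_chart_complex hy)

lemma chartDeriv_bijective (hy : y ∈ (chartAt F y₀).source) :
    Function.Bijective (chartDeriv F y₀ y : F → F) := by
  have : IsManifold 𝓘(ℂ, F) 1 Y := .of_le (n := ∞) (by simp)
  exact (mdifferentiable_chart y₀).mfderiv_bijective hy

lemma chartDeriv_self : chartDeriv F y₀ y₀ = ContinuousLinearMap.id ℂ F := by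
  have : IsManifold 𝓘(ℂ, F) 1 Y := .of_le (n := ∞) (by simp)
  exact mfderiv_extChartAt_self (I := 𝓘(ℂ, F)) (x := y₀)

lemma contMDiffOn_chart_real : ContMDiffOn 𝓘(ℝ, F) 𝓘(ℝ, F) ∞ (chartAt F y₀)
    (chartAt F y₀).source :=
  contMDiffOn_chart

lemma contMDiffOn_chart_symm_real : ContMDiffOn 𝓘(ℝ, F) 𝓘(ℝ, F) ∞ (chartAt F y₀).symm
    (chartAt F y₀).target :=
  contMDiffOn_chart_symm

lemma chartDeriv_mfderiv_symm {x : F} (hx : x ∈ (chartAt F y₀).target) (v : F) :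
    chartDeriv F y₀ ((chartAt F y₀).symm x)
      (mfderiv 𝓘(ℝ, F) 𝓘(ℝ, F) (chartAt F y₀).symm x v) = v := by
  have : IsManifold 𝓘(ℝ, F) 1 Y := .of_le (n := ∞) (by simp)
  have h := (mdifferentiable_chart (I := 𝓘(ℝ, F)) y₀).comp_symm_deriv hx
  rw [(hasMFDerivAt_chart ((chartAt F y₀).map_target hx)).mfderiv] at h
  exact DFunLike.congr_fun h v

lemma mfderiv_symm_chartDeriv {x : F} (hx : x ∈ (chartAt F y₀).target) (v : F) :
    mfderiv 𝓘(ℝ, F) 𝓘(ℝ, F) (chartAt F y₀).symm x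
      (chartDeriv F y₀ ((chartAt F y₀).symm x) v) = v :=
  (chartDeriv_bijective ((chartAt F y₀).map_target hx)).1 (chartDeriv_mfderiv_symm hx _)

/-- A vector field in a chart. -/
def inChart (y₀ : Y) (V : Y → F) : F → F := fun x =>
  chartDeriv F y₀ ((chartAt F y₀).symm x) (V ((chartAt F y₀).symm x))

omit [IsManifold 𝓘(ℂ, F) ∞ Y] in
lemma inChart_smul (y₀ : Y) (V : Y → F) :
    inChart y₀ (fun y => Complex.I • V y) = fun x => Complex.I • inChart y₀ V x := by
  funext x
  exact (chartDeriv F y₀ _).map_smul _ _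

lemma mpullbackWithin_eventuallyEq_inChart (V : (y : Y) → TangentSpace 𝓘(ℝ, F) y) :
    VectorField.mpullbackWithin 𝓘(ℝ, F) 𝓘(ℝ, F) (extChartAt 𝓘(ℝ, F) y₀).symm V
      (range 𝓘(ℝ, F)) =ᶠ[𝓝 (chartAt F y₀ y₀)] inChart y₀ V := by
  filter_upwards [(chartAt F y₀).open_target.mem_nhds (mem_chart_target F y₀)] with x hx
  have h2 : mfderivWithin 𝓘(ℝ, F) 𝓘(ℝ, F) (extChartAt 𝓘(ℝ, F) y₀).symm (range 𝓘(ℝ, F)) x =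
      mfderiv 𝓘(ℝ, F) 𝓘(ℝ, F) (chartAt F y₀).symm x := by
    rw [modelWithCornersSelf_coe, range_id, mfderivWithin_univ]
    rfl
  rw [VectorField.mpullbackWithin_apply, h2]
  set f : F ≃L[ℝ] F := ContinuousLinearEquiv.equivOfInverse
    (mfderiv 𝓘(ℝ, F) 𝓘(ℝ, F) (chartAt F y₀).symm x)
    ((chartDeriv F y₀ ((chartAt F y₀).symm x)).restrictScalars ℝ)
    (chartDeriv_mfderiv_symm hx) (mfderiv_symm_chartDeriv hx) with hf
  exact DFunLike.congr_fun (ContinuousLinearMap.inverse_equiv f) _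

/-- The bracket at `y₀` is the bracket in the chart at `y₀`. -/
lemma mlieBracket_eq_inChart (V W : (y : Y) → TangentSpace 𝓘(ℝ, F) y) :
    VectorField.mlieBracket 𝓘(ℝ, F) V W y₀ =
      VectorField.lieBracket ℝ (inChart y₀ V) (inChart y₀ W) (chartAt F y₀ y₀) := by
  have : IsManifold 𝓘(ℝ, F) 1 Y := .of_le (n := ∞) (by simp)
  rw [← VectorField.mlieBracketWithin_univ, VectorField.mlieBracketWithin_apply]
  rw [mfderiv_extChartAt_self]
  have h4 : (ContinuousLinearMap.id ℝ F).inverse = ContinuousLinearMap.id ℝ F :=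
    ContinuousLinearMap.inverse_id
  have h5 : ((extChartAt 𝓘(ℝ, F) y₀).symm ⁻¹' univ ∩ range 𝓘(ℝ, F)) = univ := by
    simp
  rw [h5]
  refine (DFunLike.congr_fun h4 _).trans ?_
  refine (congrFun (VectorField.lieBracketWithin_univ (𝕜 := ℝ)) _).trans ?_
  exact (mpullbackWithin_eventuallyEq_inChart V).lieBracket_vectorField_eq
    (mpullbackWithin_eventuallyEq_inChart W)

/-- A vector field is smooth if and only if it is smooth in a chart. -/
lemma contMDiffOn_vectorField_iff {V : (y : Y) → TangentSpace 𝓘(ℝ, F) y} {O : Set F}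
    (hO : IsOpen O) (hOt : O ⊆ (chartAt F y₀).target) :
    ContMDiffOn 𝓘(ℝ, F) 𝓘(ℝ, F).tangent ∞
      (fun y => (⟨y, V y⟩ : TangentBundle 𝓘(ℝ, F) Y))
      ((chartAt F y₀).source ∩ chartAt F y₀ ⁻¹' O) ↔ ContDiffOn ℝ ∞ (inChart y₀ V) O := by
  have : IsManifold 𝓘(ℝ, F) 1 Y := .of_le (n := ∞) (by simp)
  have : IsManifold 𝓘(ℝ, F) (∞ + 1) Y := isManifold_real
  have : ContMDiffVectorBundle ∞ F (TangentSpace 𝓘(ℝ, F) : Y → Type _) 𝓘(ℝ, F) :=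
    TangentBundle.contMDiffVectorBundle (n := ∞)
  set e := chartAt F y₀
  have hW : IsOpen (e.source ∩ e ⁻¹' O) := e.isOpen_inter_preimage hO
  set T := trivializationAt F (TangentSpace 𝓘(ℝ, F) : Y → Type _) y₀ with hT
  have h1 := T.contMDiffOn_section_iff (IB := 𝓘(ℝ, F)) (n := ∞) (s := V) hW
    (fun y hy => hy.1)
  have h2 : EqOn (fun y => ((T ⟨y, V y⟩).2 : F)) (fun y => chartDeriv F y₀ y (V y))
      (e.source ∩ e ⁻¹' O) := by
    intro y hy
    have h3 := TangentBundle.continuousLinearMapAt_trivializationAt (I := 𝓘(ℝ, F)) (x₀ := y₀) hy.1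
    have h4 := (hasMFDerivAt_chart hy.1).mfderiv
    have h5 : T.continuousLinearMapAt ℝ y (V y) = (T ⟨y, V y⟩).2 := by
      rw [Bundle.Trivialization.continuousLinearMapAt_apply,
        Bundle.Trivialization.linearMapAt_apply]
      exact if_pos hy.1
    refine h5.symm.trans ((DFunLike.congr_fun h3 _).trans ?_)
    exact DFunLike.congr_fun h4 (V y)
  refine h1.trans ((contMDiffOn_congr h2).trans ?_)
  rw [← contMDiffOn_iff_contDiffOn]
  constructor
  · intro h
    exact h.comp (contMDiffOn_chart_symm_real.mono hOt) fun x hx =>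
      ⟨e.map_target (hOt hx), by rw [mem_preimage, e.right_inv (hOt hx)]; exact hx⟩
  · intro h
    refine (h.comp (contMDiffOn_chart_real.mono inter_subset_left) fun y hy => hy.2).congr ?_
    intro y hy
    change _ = chartDeriv F y₀ (e.symm (e y)) (V (e.symm (e y)))
    rw [e.left_inv hy.1]

end Charts

/-! ### Local defining functions in charts -/

section Defining

variable {F : Type*} [NormedAddCommGroup F] [NormedSpace ℂ F] [FiniteDimensional ℂ F]
  {Y : Type v} [TopologicalSpace Y] [ChartedSpace F Y]
  {H : Type*} [NormedAddCommGroup H] [NormedSpace ℝ H] [FiniteDimensional ℝ H]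

/-- In the preferred chart at `y₀`, over the open set `O`, the set `S` is the zero set of the
submersion `ρ`. -/
structure IsDefiningFunction (S : Set Y) (y₀ : Y) (O : Set F) (ρ : F → H) : Prop where
  isOpen : IsOpen O
  subset_target : O ⊆ (chartAt F y₀).target
  center_mem : chartAt F y₀ y₀ ∈ O
  contDiffOn : ContDiffOn ℝ ∞ ρ O
  surjective : ∀ x ∈ O, ρ x = 0 → Function.Surjective (fderiv ℝ ρ x)
  mem_iff : ∀ x ∈ O, (chartAt F y₀).symm x ∈ S ↔ ρ x = 0

namespace IsDefiningFunction

variable {S : Set Y} {y₀ y : Y} {O : Set F} {ρ : F → H}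

omit [FiniteDimensional ℂ F] [FiniteDimensional ℝ H] in
lemma isOpen_preimage (h : IsDefiningFunction S y₀ O ρ) :
    IsOpen ((chartAt F y₀).source ∩ chartAt F y₀ ⁻¹' O) :=
  (chartAt F y₀).isOpen_inter_preimage h.isOpen

omit [FiniteDimensional ℂ F] [FiniteDimensional ℝ H] in
lemma mem_iff' (h : IsDefiningFunction S y₀ O ρ) (hy : y ∈ (chartAt F y₀).source)
    (hyO : chartAt F y₀ y ∈ O) : y ∈ S ↔ ρ (chartAt F y₀ y) = 0 := by
  rw [← h.mem_iff _ hyO, (chartAt F y₀).left_inv hy]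

omit [FiniteDimensional ℂ F] [FiniteDimensional ℝ H] in
lemma contDiffAt (h : IsDefiningFunction S y₀ O ρ) {x : F} (hx : x ∈ O) : ContDiffAt ℝ ∞ ρ x :=
  h.contDiffOn.contDiffAt (h.isOpen.mem_nhds hx)

omit [FiniteDimensional ℂ F] [FiniteDimensional ℝ H] in
/-- Defining functions may be composed with linear isomorphisms. -/
lemma linear_comp {H' : Type*} [NormedAddCommGroup H'] [NormedSpace ℝ H']
    (h : IsDefiningFunction S y₀ O ρ) (l : H ≃L[ℝ] H') :
    IsDefiningFunction S y₀ O (fun x => l (ρ x)) where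
  isOpen := h.isOpen
  subset_target := h.subset_target
  center_mem := h.center_mem
  contDiffOn := l.contDiff.comp_contDiffOn h.contDiffOn
  surjective x hx hx0 := by
    have h1 : HasFDerivAt (fun x => l (ρ x)) _ x :=
      l.hasFDerivAt.comp x ((h.contDiffAt hx).differentiableAt (by simp)).hasFDerivAt
    rw [h1.fderiv]
    exact l.surjective.comp (h.surjective x hx (l.map_eq_zero_iff.1 hx0))
  mem_iff x hx := by rw [h.mem_iff x hx, l.map_eq_zero_iff]

variable [IsManifold 𝓘(ℂ, F) ∞ Y]

lemma mem_tangentAt (h : IsDefiningFunction S y₀ O ρ) (hy : y ∈ (chartAt F y₀).source)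
    (hyO : chartAt F y₀ y ∈ O) (hyS : y ∈ S) (w : F) :
    w ∈ tangentAt (F := F) S y ↔ fderiv ℝ ρ (chartAt F y₀ y) (chartDeriv F y₀ y w) = 0 := by
  set e := chartAt F y₀ with he
  have hy0 : ρ (e y) = 0 := (h.mem_iff' hy hyO).1 hyS
  have hρd := (h.contDiffAt hyO).differentiableAt (by simp)
  constructor
  · intro hw
    by_contra hne
    obtain ⟨l, -, hl⟩ := exists_dual_vector ℝ (fderiv ℝ ρ (e y) (chartDeriv F y₀ y w))
      (norm_ne_zero_iff.2 hne)
    have h1 := hw (e.source ∩ e ⁻¹' O) (fun z => l (ρ (e z))) h.isOpen_preimage ⟨hy, hyO⟩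
      ((l.contMDiff.comp_contMDiffOn (h.contDiffOn.contMDiffOn)).comp
        (contMDiffOn_chart_real.mono inter_subset_left) fun z hz => hz.2)
      (fun z hz => by
        rw [(h.mem_iff' hz.2.1 hz.2.2).1 hz.1, map_zero])
    have h2 : HasMFDerivAt 𝓘(ℝ, F) 𝓘(ℝ, ℝ) ((l ∘ ρ) ∘ e) y _ :=
      ((l.hasFDerivAt.comp (e y) hρd.hasFDerivAt).hasMFDerivAt).comp y (hasMFDerivAt_chart hy)
    have h3 := DFunLike.congr_fun h2.mfderiv w
    have h4 : l (fderiv ℝ ρ (e y) (chartDeriv F y₀ y w)) = 0 := h3.symm.trans h1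
    rw [h4] at hl
    exact hne (norm_eq_zero.1 (by exact_mod_cast hl.symm))
  · intro hw W f hW hyW hf h0
    have hO' : IsOpen (e.target ∩ e.symm ⁻¹' W) := e.symm.isOpen_inter_preimage hW
    have hyO' : e y ∈ e.target ∩ e.symm ⁻¹' W :=
      ⟨e.map_source hy, by rw [mem_preimage, e.left_inv hy]; exact hyW⟩
    have hg : ContDiffOn ℝ ∞ (f ∘ e.symm) (e.target ∩ e.symm ⁻¹' W) := by
      rw [← contMDiffOn_iff_contDiffOn]
      exact hf.comp (contMDiffOn_chart_symm_real.mono inter_subset_left) fun z hz => hz.2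
    have hga := hg.contDiffAt (hO'.mem_nhds hyO')
    have h1 := fderiv_eq_zero_of_vanishing (h.contDiffAt hyO) hga hy0 (h.surjective _ hyO hy0)
      (by
        filter_upwards [hO'.mem_nhds hyO', h.isOpen.mem_nhds hyO] with z hz hzO hz0
        exact h0 _ ⟨(h.mem_iff z hzO).2 hz0, hz.2⟩) hw
    have h2 : HasMFDerivAt 𝓘(ℝ, F) 𝓘(ℝ, ℝ) ((f ∘ e.symm) ∘ e) y _ :=
      ((hga.differentiableAt (by simp)).hasFDerivAt.hasMFDerivAt).comp y (hasMFDerivAt_chart hy)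
    have h3 : f =ᶠ[𝓝 y] (f ∘ e.symm) ∘ e := by
      filter_upwards [e.open_source.mem_nhds hy] with z hz
      change f z = f (e.symm (e z))
      rw [e.left_inv hz]
    have h4 := (h2.congr_of_eventuallyEq h3).mfderiv
    exact (DFunLike.congr_fun h4 w).trans h1

lemma mem_crTangentAt (h : IsDefiningFunction S y₀ O ρ) (hy : y ∈ (chartAt F y₀).source)
    (hyO : chartAt F y₀ y ∈ O) (hyS : y ∈ S) (w : F) :
    w ∈ crTangentAt (F := F) S y ↔
      chartDeriv F y₀ y w ∈ holomorphicPart (fderiv ℝ ρ (chartAt F y₀ y)).ker := by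
  rw [mem_holomorphicPart_ker, ← map_smul]
  exact and_congr (h.mem_tangentAt hy hyO hyS w) (h.mem_tangentAt hy hyO hyS _)

lemma finrank_crTangentAt (h : IsDefiningFunction S y₀ O ρ) (hy : y ∈ (chartAt F y₀).source)
    (hyO : chartAt F y₀ y ∈ O) (hyS : y ∈ S) :
    Module.finrank ℂ (crTangentAt (F := F) S y) =
      Module.finrank ℂ (holomorphicPart (fderiv ℝ ρ (chartAt F y₀ y)).ker) := by
  set f : F ≃ₗ[ℂ] F := LinearEquiv.ofBijective (chartDeriv F y₀ y).toLinearMap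
    (chartDeriv_bijective hy)
  have h1 : (crTangentAt (F := F) S y : Submodule ℂ F).map f.toLinearMap =
      holomorphicPart (fderiv ℝ ρ (chartAt F y₀ y)).ker := by
    ext w
    constructor
    · rintro ⟨v, hv, rfl⟩
      exact (h.mem_crTangentAt hy hyO hyS v).1 hv
    · intro hw
      obtain ⟨v, rfl⟩ := (chartDeriv_bijective hy).2 w
      exact ⟨v, (h.mem_crTangentAt hy hyO hyS v).2 hw, rfl⟩
  rw [← h1]
  exact (f.finrank_map_eq _).symm

lemma crTangentAt_center (h : IsDefiningFunction S y₀ O ρ) (hyS : y₀ ∈ S) :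
    crTangentAt (F := F) S y₀ = holomorphicPart (fderiv ℝ ρ (chartAt F y₀ y₀)).ker := by
  ext w
  have h1 := h.mem_crTangentAt (mem_chart_source F y₀) h.center_mem hyS w
  rw [chartDeriv_self] at h1
  exact h1

lemma mem_tangentAt_center (h : IsDefiningFunction S y₀ O ρ) (hyS : y₀ ∈ S) (w : F) :
    w ∈ tangentAt (F := F) S y₀ ↔ fderiv ℝ ρ (chartAt F y₀ y₀) w = 0 := by
  have h1 := h.mem_tangentAt (mem_chart_source F y₀) h.center_mem hyS w
  rw [chartDeriv_self] at h1
  exact h1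

end IsDefiningFunction

variable [IsManifold 𝓘(ℂ, F) ∞ Y] {S : Set Y}

omit [FiniteDimensional ℂ F] in
lemma IsSmoothSubmanifold.exists_definingFunction {d : ℕ} (h : IsSmoothSubmanifold (F := F) S d)
    {y₀ : Y} (hy₀ : y₀ ∈ S) : ∃ c : ℕ, d + c = Module.finrank ℝ F ∧
      ∃ (O : Set F) (ρ : F → (Fin c → ℝ)), IsDefiningFunction S y₀ O ρ := by
  obtain ⟨c, hc, W, ρ, hW, hyW, hρ, hS, hs⟩ := h y₀ hy₀
  set e := chartAt F y₀ with he
  have hO : IsOpen (e.target ∩ e.symm ⁻¹' W) := e.symm.isOpen_inter_preimage hW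
  have hg : ContDiffOn ℝ ∞ (ρ ∘ e.symm) (e.target ∩ e.symm ⁻¹' W) := by
    rw [← contMDiffOn_iff_contDiffOn]
    exact hρ.comp (contMDiffOn_chart_symm_real.mono inter_subset_left) fun z hz => hz.2
  refine ⟨c, hc, e.target ∩ e.symm ⁻¹' W, ρ ∘ e.symm, hO, inter_subset_left, ?_, hg, ?_, ?_⟩
  · refine ⟨mem_chart_target F y₀, ?_⟩
    rw [mem_preimage, e.left_inv (mem_chart_source F y₀)]
    exact hyW
  · intro x hx hx0
    have h1 : HasMFDerivAt 𝓘(ℝ, F) 𝓘(ℝ, Fin c → ℝ) ((ρ ∘ e.symm) ∘ e) (e.symm x)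
        ((fderiv ℝ (ρ ∘ e.symm) x).comp
          ((chartDeriv F y₀ (e.symm x)).restrictScalars ℝ)) := by
      refine HasMFDerivAt.comp (e.symm x) (g' := fderiv ℝ (ρ ∘ e.symm) x) ?_
        (hasMFDerivAt_chart (e.map_target hx.1))
      have h0 : ∀ x', x' = x → HasMFDerivAt 𝓘(ℝ, F) 𝓘(ℝ, Fin c → ℝ) (ρ ∘ e.symm) x'
          (fderiv ℝ (ρ ∘ e.symm) x) := by
        rintro _ rfl
        exact ((hg.contDiffAt (hO.mem_nhds hx)).differentiableAt
          (by simp)).hasFDerivAt.hasMFDerivAt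
      exact h0 _ (e.right_inv hx.1)
    have h3 : ρ =ᶠ[𝓝 (e.symm x)] (ρ ∘ e.symm) ∘ e := by
      filter_upwards [e.open_source.mem_nhds (e.map_target hx.1)] with z hz
      change ρ z = ρ (e.symm (e z))
      rw [e.left_inv hz]
    have h4 := (h1.congr_of_eventuallyEq h3).mfderiv
    have h5 := hs (e.symm x) ⟨(hS _ hx.2).2 hx0, hx.2⟩
    rw [h4] at h5
    exact Function.Surjective.of_comp h5
  · intro x hx
    exact hS _ hx.2

omit [FiniteDimensional ℂ F] in
lemma isSmoothSubmanifold_of_definingFunction {d : ℕ}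
    (h : ∀ y₀ ∈ S, ∃ c : ℕ, d + c = Module.finrank ℝ F ∧
      ∃ (O : Set F) (ρ : F → (Fin c → ℝ)), IsDefiningFunction S y₀ O ρ) :
    IsSmoothSubmanifold (F := F) S d := by
  intro y₀ hy₀
  obtain ⟨c, hc, O, ρ, hρ⟩ := h y₀ hy₀
  refine ⟨c, hc, (chartAt F y₀).source ∩ chartAt F y₀ ⁻¹' O, ρ ∘ chartAt F y₀,
    hρ.isOpen_preimage, ⟨mem_chart_source F y₀, hρ.center_mem⟩, ?_, ?_, ?_⟩
  · exact hρ.contDiffOn.contMDiffOn.comp (contMDiffOn_chart_real.mono inter_subset_left)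
      fun z hz => hz.2
  · intro z hz
    exact hρ.mem_iff' hz.1 hz.2
  · intro z hz
    have h1 : HasMFDerivAt 𝓘(ℝ, F) 𝓘(ℝ, Fin c → ℝ) (ρ ∘ chartAt F y₀) z _ :=
      (((hρ.contDiffAt hz.2.2).differentiableAt (by simp)).hasFDerivAt.hasMFDerivAt).comp z
        (hasMFDerivAt_chart hz.2.1)
    rw [h1.mfderiv]
    exact (hρ.surjective _ hz.2.2 ((hρ.mem_iff' hz.2.1 hz.2.2).1 hz.1)).comp
      (chartDeriv_bijective hz.2.1).2

end Defining

/-! ### Charts of the cotangent bundle -/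

section CotangentCharts

variable {E : Type u} [NormedAddCommGroup E] [NormedSpace ℂ E]
  {X : Type v} [TopologicalSpace X] [ChartedSpace E X] [IsManifold 𝓘(ℂ, E) ∞ X]
  {p q : CotangentBundle E X}

lemma chartAt_cotangent (p : CotangentBundle E X) :
    chartAt (E × (E →L[ℂ] ℂ)) p =
      (trivializationAt (E →L[ℂ] ℂ) (fun x : X => TangentSpace 𝓘(ℂ, E) x →L[ℂ]
        Bundle.Trivial X ℂ x) p.proj).toOpenPartialHomeomorph ≫ₕ
        (chartAt E p.proj).prod (OpenPartialHomeomorph.refl (E →L[ℂ] ℂ)) :=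
  FiberBundle.chartedSpace_chartAt p

lemma mem_chart_cotangent_source :
    q ∈ (chartAt (E × (E →L[ℂ] ℂ)) p).source ↔ q.proj ∈ (chartAt E p.proj).source := by
  rw [chartAt_cotangent, OpenPartialHomeomorph.trans_source]
  simp only [mem_inter_iff, mem_preimage]
  constructor
  · rintro ⟨h, -⟩
    exact (((Bundle.Trivialization.mem_source _).1 h).1)
  · intro h
    refine ⟨(Bundle.Trivialization.mem_source _).2 ⟨h, mem_univ _⟩, ?_, mem_univ _⟩
    exact h

lemma chartAt_cotangent_fst :
    (chartAt (E × (E →L[ℂ] ℂ)) p q).1 = chartAt E p.proj q.proj := by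
  rw [chartAt_cotangent]
  rfl

/-- The fibre coordinate of a covector is its composition with the inverse of the differential of
the chart of the base. -/
lemma chartAt_cotangent_snd (hq : q.proj ∈ (chartAt E p.proj).source) (w : E) :
    (chartAt (E × (E →L[ℂ] ℂ)) p q).2 (chartDeriv E p.proj q.proj w) = q.snd w := by
  have : IsManifold 𝓘(ℂ, E) 1 X := .of_le (n := ∞) (by simp)
  have h1 : (chartAt (E × (E →L[ℂ] ℂ)) p q).2 =
      ContinuousLinearMap.inCoordinates E (TangentSpace 𝓘(ℂ, E)) ℂ (Bundle.Trivial X ℂ)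
        p.proj q.proj p.proj q.proj q.snd := by
    rw [chartAt_cotangent]
    rfl
  rw [h1, ContinuousLinearMap.inCoordinates]
  have h2 := TangentBundle.continuousLinearMapAt_trivializationAt (I := 𝓘(ℂ, E)) (x₀ := p.proj) hq
  have h3 : (trivializationAt E (TangentSpace 𝓘(ℂ, E)) p.proj).symmL ℂ q.proj
      (chartDeriv E p.proj q.proj w) = w := by
    have h4 : chartDeriv E p.proj q.proj w =
      (trivializationAt E (TangentSpace 𝓘(ℂ, E)) p.proj).continuousLinearMapAt ℂ q.proj w :=
      (DFunLike.congr_fun h2 w).symm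
    rw [h4]
    exact (trivializationAt E (TangentSpace 𝓘(ℂ, E)) p.proj).symmL_continuousLinearMapAt
      (R := ℂ) hq (show TangentSpace 𝓘(ℂ, E) q.proj from w)
  change (Bundle.Trivialization.continuousLinearMapAt ℂ
    (trivializationAt ℂ (Bundle.Trivial X ℂ) p.proj) q.proj) (q.snd
    ((trivializationAt E (TangentSpace 𝓘(ℂ, E)) p.proj).symmL ℂ q.proj
      (chartDeriv E p.proj q.proj w))) = _
  rw [h3]
  simp

lemma chartAt_cotangent_target :
    (chartAt (E × (E →L[ℂ] ℂ)) p).target = (chartAt E p.proj).target ×ˢ univ := by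
  rw [chartAt_cotangent, OpenPartialHomeomorph.trans_target]
  ext a
  constructor
  · intro h
    exact h.1
  · intro h
    refine ⟨h, ?_⟩
    rw [mem_preimage, Bundle.Trivialization.target_eq]
    refine ⟨?_, mem_univ _⟩
    exact ⟨(chartAt E p.proj).map_target h.1, mem_univ _⟩

lemma chartAt_cotangent_symm_proj {a : E × (E →L[ℂ] ℂ)} (ha : a.1 ∈ (chartAt E p.proj).target) :
    ((chartAt (E × (E →L[ℂ] ℂ)) p).symm a).proj = (chartAt E p.proj).symm a.1 :=
  FiberBundle.chartedSpace_chartAt_symm_fst p a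
    (by
      change a ∈ (chartAt (E × (E →L[ℂ] ℂ)) p).target
      rw [chartAt_cotangent_target]
      exact ⟨ha, mem_univ _⟩)

lemma chartAt_cotangent_symm_snd {a : E × (E →L[ℂ] ℂ)} (ha : a.1 ∈ (chartAt E p.proj).target)
    (w : E) : ((chartAt (E × (E →L[ℂ] ℂ)) p).symm a).snd w =
      a.2 (chartDeriv E p.proj ((chartAt E p.proj).symm a.1) w) := by
  have h1 : a ∈ (chartAt (E × (E →L[ℂ] ℂ)) p).target := by
    rw [chartAt_cotangent_target]
    exact ⟨ha, mem_univ _⟩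
  have h2 := mem_chart_cotangent_source.1 ((chartAt (E × (E →L[ℂ] ℂ)) p).map_target h1)
  have h3 := chartAt_cotangent_snd h2 w
  rw [(chartAt (E × (E →L[ℂ] ℂ)) p).right_inv h1, chartAt_cotangent_symm_proj ha] at h3
  exact h3.symm

end CotangentCharts

/-! ### The characteristic bundle in a chart -/

section Characteristic

variable {E : Type u} [NormedAddCommGroup E] [NormedSpace ℂ E] [FiniteDimensional ℂ E]
  {X : Type v} [TopologicalSpace X] [ChartedSpace E X] [IsManifold 𝓘(ℂ, E) ∞ X]
  {H : Type*} [NormedAddCommGroup H] [NormedSpace ℝ H] [FiniteDimensional ℝ H]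
  {p : CotangentBundle E X} {M : Set X} {O : Set E} {ρ : E → H}

omit [FiniteDimensional ℂ E] [IsManifold 𝓘(ℂ, E) ∞ X] in
lemma realCovector_I_smul (q : CotangentBundle E X) (w : TangentSpace 𝓘(ℂ, E) q.proj) :
    realCovector q (Complex.I • w) = -(q.snd w).im := by
  change (q.snd (Complex.I • w)).re = _
  rw [map_smul]
  exact Complex.I_mul_re _

lemma mem_characteristicBundle_iff (h : IsDefiningFunction M p.proj O ρ) {a : E × (E →L[ℂ] ℂ)}
    (ha : a.1 ∈ O) :
    (chartAt (E × (E →L[ℂ] ℂ)) p).symm a ∈ characteristicBundle M ↔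
      ρ a.1 = 0 ∧ ∀ w, fderiv ℝ ρ a.1 w = 0 → (a.2 w).im = 0 := by
  have hat := h.subset_target ha
  have hsrc := (chartAt E p.proj).map_target hat
  have h1 := chartAt_cotangent_symm_proj hat
  change _ ∧ _ ↔ _
  rw [h1, h.mem_iff _ ha]
  refine and_congr_right fun h0 => ?_
  have hS := (h.mem_iff _ ha).2 h0
  have hri := (chartAt E p.proj).right_inv hat
  have h2 : ∀ w : E, w ∈ tangentAt (F := E) M ((chartAt E p.proj).symm a.1) ↔ _ :=
    h.mem_tangentAt hsrc (by rwa [hri]) hS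
  rw [hri] at h2
  have hre : ∀ w : E, realCovector ((chartAt (E × (E →L[ℂ] ℂ)) p).symm a)
      (show E from Complex.I • w) =
      -(a.2 (chartDeriv E p.proj ((chartAt E p.proj).symm a.1) w)).im := fun w =>
    (realCovector_I_smul _ w).trans
      (congrArg (fun z : ℂ => -z.im) (chartAt_cotangent_symm_snd hat w))
  constructor
  · intro h3 w hw
    obtain ⟨v, rfl⟩ := (chartDeriv_bijective hsrc).2 w
    have h4 := h3 v ((h2 v).2 hw)
    exact neg_eq_zero.1 ((hre v).symm.trans h4)
  · intro h3 w hw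
    refine (hre w).trans ?_
    rw [h3 _ ((h2 w).1 hw), neg_zero]

omit [FiniteDimensional ℂ E] in
lemma realCovector_eq_zero_iff {a : E × (E →L[ℂ] ℂ)} (ha : a.1 ∈ (chartAt E p.proj).target) :
    realCovector ((chartAt (E × (E →L[ℂ] ℂ)) p).symm a) = 0 ↔ a.2 = 0 := by
  constructor
  · intro h
    have h1 : ∀ w : E, (((chartAt (E × (E →L[ℂ] ℂ)) p).symm a).snd w).re = 0 :=
      fun w => LinearMap.congr_fun h w
    ext w
    obtain ⟨v, rfl⟩ := (chartDeriv_bijective ((chartAt E p.proj).map_target ha)).2 w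
    rw [← chartAt_cotangent_symm_snd ha]
    refine Complex.ext (h1 v) ?_
    have h2 := h1 (Complex.I • v)
    have h3 := realCovector_I_smul ((chartAt (E × (E →L[ℂ] ℂ)) p).symm a) v
    exact neg_eq_zero.1 (h3.symm.trans h2)
  · intro h
    ext w
    change (((chartAt (E × (E →L[ℂ] ℂ)) p).symm a).snd w).re = 0
    have h1 := chartAt_cotangent_symm_snd ha (show E from w)
    rw [h] at h1
    exact congrArg Complex.re h1

end Characteristic

/-! ### The Levi form in a chart -/

section LeviForm

variable {F : Type u} [NormedAddCommGroup F] [NormedSpace ℂ F] [FiniteDimensional ℂ F]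
  {Y : Type v} [TopologicalSpace Y] [ChartedSpace F Y] [IsManifold 𝓘(ℂ, F) ∞ Y]
  {H : Type*} [NormedAddCommGroup H] [NormedSpace ℝ H] [FiniteDimensional ℝ H]
  {S : Set Y} {y₀ : Y} {O : Set F} {ρ : F → H}

lemma IsDefiningFunction.isCRSection_iff (h : IsDefiningFunction S y₀ O ρ) {N : Set F}
    (hN : IsOpen N) (hNO : N ⊆ O) (V : Y → F) :
    IsCRSection S ((chartAt F y₀).source ∩ chartAt F y₀ ⁻¹' N) V ↔
      ContDiffOn ℝ ∞ (inChart y₀ V) N ∧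
        ∀ x ∈ N, ρ x = 0 → inChart y₀ V x ∈ holomorphicPart (fderiv ℝ ρ x).ker := by
  set e := chartAt F y₀
  have hsm := contMDiffOn_vectorField_iff (V := V) hN (hNO.trans h.subset_target)
  constructor
  · intro hV
    refine ⟨hsm.1 hV.smooth, fun x hx hx0 => ?_⟩
    have hxt := h.subset_target (hNO hx)
    have h1 := (h.mem_crTangentAt (e.map_target hxt) (by
        change e _ ∈ O
        rw [e.right_inv hxt]; exact hNO hx) ((h.mem_iff x (hNO hx)).2 hx0) _).1
      (hV.mem _ ⟨(h.mem_iff x (hNO hx)).2 hx0, e.map_target hxt, by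
        rw [mem_preimage, e.right_inv hxt]; exact hx⟩)
    change _ ∈ holomorphicPart (fderiv ℝ ρ (e _)).ker at h1
    rw [e.right_inv hxt] at h1
    exact h1
  · rintro ⟨h1, h2⟩
    refine ⟨e.isOpen_inter_preimage hN, hsm.2 h1, fun y hy => ?_⟩
    refine (h.mem_crTangentAt hy.2.1 (hNO hy.2.2) hy.1 (V y)).2 ?_
    have h3 := h2 _ hy.2.2 ((h.mem_iff' hy.2.1 (hNO hy.2.2)).1 hy.1)
    rw [inChart, e.left_inv hy.2.1] at h3
    exact h3

omit [FiniteDimensional ℂ F] in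
lemma IsCRSection.mono {W W' : Set Y} {V : Y → F} (h : IsCRSection S W V) (hW' : IsOpen W')
    (hWW' : W' ⊆ W) : IsCRSection S W' V :=
  ⟨hW', h.smooth.mono hWW', fun y hy => h.mem y ⟨hy.1, hWW' hy.2⟩⟩

/-- If the holomorphic tangent spaces are the null spaces of the restrictions of a two-form that is
constant in a chart, then the Levi forms vanish. -/
lemma IsDefiningFunction.isLeviForm_zero {V' : Type*} [NormedAddCommGroup V'] [NormedSpace ℝ V']
    (h : IsDefiningFunction S y₀ O ρ) (hy₀ : y₀ ∈ S)
    (σ : F →L[ℝ] F →L[ℝ] V') (hσ : ∀ a b, σ a b = -σ b a)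
    (hker : ∀ y ∈ O, ρ y = 0 → ∀ v, fderiv ℝ ρ y v = 0 →
      (v ∈ holomorphicPart (fderiv ℝ ρ y).ker ↔ ∀ w, fderiv ℝ ρ y w = 0 → σ v w = 0))
    (ξ : TangentSpace 𝓘(ℂ, F) y₀ →ₗ[ℝ] ℝ) (hξ : ∀ w ∈ crTangentAt (F := F) S y₀, ξ w = 0) :
    IsLeviForm S y₀ ξ 0 := by
  refine ⟨fun a b => by simp, fun W V hV hy => ?_⟩
  set e := chartAt F y₀ with he
  have hN : IsOpen (O ∩ (e.target ∩ e.symm ⁻¹' W)) :=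
    h.isOpen.inter (e.symm.isOpen_inter_preimage hV.isOpen)
  have hyN : e y₀ ∈ O ∩ (e.target ∩ e.symm ⁻¹' W) := by
    refine ⟨h.center_mem, mem_chart_target F y₀, ?_⟩
    rw [mem_preimage, e.left_inv (mem_chart_source F y₀)]
    exact hy.2
  have h1 := (h.isCRSection_iff hN inter_subset_left V).1 (hV.mono (e.isOpen_inter_preimage hN)
    fun y hy => by
      have h2 := hy.2.2.2
      rw [mem_preimage, e.left_inv hy.1] at h2
      exact h2)
  have hy0 := (h.mem_iff' (mem_chart_source F y₀) h.center_mem).1 hy₀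
  have h2 := lieBracket_mem_holomorphicPart hN (h.contDiffOn.mono inter_subset_left) σ hσ
    (fun y hy => hker y hy.1) hyN hy0 (h.surjective _ h.center_mem hy0)
    (h1.1.const_smul Complex.I) h1.1
    (fun y hy h0 => Submodule.smul_mem _ Complex.I (h1.2 y hy h0)) h1.2
  have h3 : VectorField.mlieBracket 𝓘(ℝ, F) (fun z => Complex.I • V z) V y₀ ∈
      crTangentAt (F := F) S y₀ := by
    rw [h.crTangentAt_center hy₀]
    have h4 := mlieBracket_eq_inChart (y₀ := y₀) (fun z => Complex.I • V z) V
    have h5 : inChart y₀ (fun z => Complex.I • V z) = fun x => Complex.I • inChart y₀ V x :=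
      inChart_smul y₀ V
    have h6 : ∀ w : F, w = VectorField.lieBracket ℝ (inChart y₀ fun z => Complex.I • V z)
        (inChart y₀ V) (e y₀) → w ∈ holomorphicPart (fderiv ℝ ρ (e y₀)).ker := by
      rintro _ rfl
      rw [h5]
      exact h2
    exact h6 _ h4
  rw [hξ _ h3]
  simp

/-- The values of the Levi form are computed by sections of the holomorphic tangent bundle in a
chart. -/
lemma IsDefiningFunction.exists_section {n : ℕ} (h : IsDefiningFunction S y₀ O ρ) (hy₀ : y₀ ∈ S)
    (hn : ∀ y ∈ S, Module.finrank ℂ (crTangentAt (F := F) S y) = n)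
    {ξ : TangentSpace 𝓘(ℂ, F) y₀ →ₗ[ℝ] ℝ}
    {L : crTangentAt (F := F) S y₀ →ₗ⋆[ℂ] crTangentAt (F := F) S y₀ →ₗ[ℂ] ℂ}
    (hL : IsLeviForm S y₀ ξ L) (a : crTangentAt (F := F) S y₀) :
    ∃ (N : Set F) (v : F → F), IsOpen N ∧ chartAt F y₀ y₀ ∈ N ∧ N ⊆ O ∧ ContDiffOn ℝ ∞ v N ∧
      (∀ x ∈ N, ρ x = 0 → v x ∈ holomorphicPart (fderiv ℝ ρ x).ker) ∧
      v (chartAt F y₀ y₀) = a.1 ∧ L a a = ((ξ (VectorField.lieBracket (E := F) ℝ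
        (fun x => Complex.I • v x) v (chartAt F y₀ y₀)) : ℝ) : ℂ) := by
  set e := chartAt F y₀ with he
  have hy0 := (h.mem_iff' (mem_chart_source F y₀) h.center_mem).1 hy₀
  have hd : ∀ x ∈ O ∩ {x | ρ x = 0}, Module.finrank ℂ (holomorphicPart (fderiv ℝ ρ x).ker) =
      Module.finrank ℂ (EuclideanSpace ℂ (Fin n)) := by
    rintro x ⟨hx, hx0⟩
    have hxt := h.subset_target hx
    have h1 := h.finrank_crTangentAt (e.map_target hxt) (by
        change e _ ∈ O
        rw [e.right_inv hxt]; exact hx) ((h.mem_iff x hx).2 hx0)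
    rw [← he, e.right_inv hxt, hn _ ((h.mem_iff x hx).2 hx0)] at h1
    rw [← h1]
    simp
  obtain ⟨q, P, Q, hP, hP', -⟩ := exists_adapted_coordinates (Z := EuclideanSpace ℂ (Fin n))
    (fderiv ℝ ρ (e y₀)).ker (hd _ ⟨h.center_mem, hy0⟩)
  obtain ⟨N, A, hN, hyN, hNO, hA, hAP⟩ := exists_smooth_frame h.isOpen
    (h.contDiffOn.fderiv_of_isOpen h.isOpen (by simp)) hd ⟨h.center_mem, hy0⟩ P hP hP'
  -- the field with constant coordinate `P a` in a frame of the holomorphic tangent spaces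
  set v : F → F := fun x => A x (P a.1) with hv
  have hva : v (e y₀) = a.1 := (hAP _ ⟨hyN, hy0⟩).2 _
    ((SetLike.ext_iff.1 (h.crTangentAt_center hy₀) _).1 a.2)
  have hvs : ContDiffOn ℝ ∞ v N := hA.clm_apply contDiffOn_const
  have hvm : ∀ x ∈ N, ρ x = 0 → v x ∈ holomorphicPart (fderiv ℝ ρ x).ker :=
    fun x hx hx0 => ((hAP x ⟨hx, hx0⟩).1 _).1
  refine ⟨N, v, hN, hyN, hNO, hvs, hvm, hva, ?_⟩
  -- the field `v` of the chart, transported to the manifold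
  set V : Y → F := fun y => mfderiv 𝓘(ℝ, F) 𝓘(ℝ, F) e.symm (e y) (v (e y)) with hV
  have hVv : ∀ x ∈ e.target, inChart y₀ V x = v x := by
    intro x hx
    have h1 := chartDeriv_mfderiv_symm (y₀ := y₀) hx (v x)
    change chartDeriv F y₀ (e.symm x)
      (mfderiv 𝓘(ℝ, F) 𝓘(ℝ, F) e.symm (e (e.symm x)) (v (e (e.symm x)))) = _
    rw [e.right_inv hx]
    exact h1
  have hNt : N ⊆ e.target := hNO.trans h.subset_target
  have hsec : IsCRSection S (e.source ∩ e ⁻¹' N) V := by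
    rw [h.isCRSection_iff hN hNO]
    refine ⟨hvs.congr fun x hx => hVv x (hNt hx), fun x hx hx0 => ?_⟩
    rw [hVv x (hNt hx)]
    exact hvm x hx hx0
  have h1 := hL.2 _ V hsec ⟨hy₀, mem_chart_source F y₀, hyN⟩
  have hVa : V y₀ = a.1 := by
    have h2 := hVv (e y₀) (mem_chart_target F y₀)
    rw [inChart, ← he, e.left_inv (mem_chart_source F y₀), chartDeriv_self, hva] at h2
    exact h2
  have hVa' : (⟨V y₀, hsec.mem y₀ ⟨hy₀, mem_chart_source F y₀, hyN⟩⟩ :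
      crTangentAt (F := F) S y₀) = a := Subtype.ext hVa
  rw [hVa'] at h1
  rw [h1]
  have h4 := mlieBracket_eq_inChart (y₀ := y₀) (fun z => Complex.I • V z) V
  rw [inChart_smul] at h4
  have h5 : inChart y₀ V =ᶠ[𝓝 (e y₀)] v := by
    filter_upwards [e.open_target.mem_nhds (mem_chart_target F y₀)] with x hx using hVv x hx
  have h6 : VectorField.lieBracket ℝ (fun x => Complex.I • inChart y₀ V x) (inChart y₀ V) (e y₀) =
      VectorField.lieBracket ℝ (fun x => Complex.I • v x) v (e y₀) :=
    Filter.EventuallyEq.lieBracket_vectorField_eq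
      (by filter_upwards [h5] with x hx; rw [hx]) h5
  exact congrArg (fun w : F => ((ξ w : ℝ) : ℂ)) (h4.trans h6)

end LeviForm

/-! ### Dimensions -/

/-- A real subspace `T` of `G` with `T + iT = G` has codimension as large as `T ∩ iT` allows. -/
lemma two_mul_finrank_of_generic {G : Type*} [NormedAddCommGroup G] [NormedSpace ℂ G]
    [FiniteDimensional ℂ G] (T : Submodule ℝ G)
    (hgen : ∀ w : G, ∃ a ∈ T, ∃ b ∈ T, w = a + Complex.I • b) :
    2 * Module.finrank ℝ T = Module.finrank ℝ G + 2 * Module.finrank ℂ (holomorphicPart T) := by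
  have : FiniteDimensional ℝ G := FiniteDimensional.complexToReal G
  set j : (T × T) →ₗ[ℝ] G :=
    { toFun := fun p => (p.1 : G) + Complex.I • (p.2 : G)
      map_add' := fun p q => by
        simp only [Prod.fst_add, Prod.snd_add, Submodule.coe_add, smul_add]
        abel
      map_smul' := fun c p => by
        simp only [Prod.smul_fst, Prod.smul_snd, Submodule.coe_smul, RingHom.id_apply, smul_add]
        rw [smul_comm] }
  have hj : Function.Surjective j := by
    intro w
    obtain ⟨a, ha, b, hb, rfl⟩ := hgen w
    exact ⟨(⟨a, ha⟩, ⟨b, hb⟩), rfl⟩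
  have h1 := j.finrank_range_add_finrank_ker
  rw [LinearMap.range_eq_top.2 hj, finrank_top, Module.finrank_prod] at h1
  set f : j.ker →ₗ[ℝ] holomorphicPart T :=
    { toFun := fun p => ⟨p.1.2, p.1.2.2, by
        have h2 : (p.1.1 : G) + Complex.I • (p.1.2 : G) = 0 := p.2
        rw [← neg_eq_of_add_eq_zero_right h2]
        exact neg_mem p.1.1.2⟩
      map_add' := fun p q => rfl
      map_smul' := fun c p => rfl }
  have hf : Function.Bijective f := by
    constructor
    · rw [injective_iff_map_eq_zero]
      rintro ⟨⟨a, b⟩, hab⟩ h0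
      have hb : (b : G) = 0 := congrArg Subtype.val h0
      have h2 : (a : G) + Complex.I • (b : G) = 0 := hab
      rw [hb, smul_zero, add_zero] at h2
      exact Subtype.ext (Prod.ext (Subtype.ext h2) (Subtype.ext hb))
    · rintro ⟨b, hb, hb'⟩
      refine ⟨⟨(⟨-(Complex.I • b), neg_mem hb'⟩, ⟨b, hb⟩), ?_⟩, rfl⟩
      exact neg_add_cancel (Complex.I • b)
  have h2 := (LinearEquiv.ofBijective f hf).finrank_eq
  have h3 := finrank_real_of_complex (holomorphicPart T)
  omega

/-! ### The characteristic covectors with Levi forms of constant rank -/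

section Structure

variable {E : Type u} [NormedAddCommGroup E] [NormedSpace ℂ E] [FiniteDimensional ℂ E]
  {X : Type v} [TopologicalSpace X] [ChartedSpace E X] [IsManifold 𝓘(ℂ, E) ∞ X]

lemma finrank_dual {𝕜 : Type*} [RCLike 𝕜] (K : Type*) [NormedAddCommGroup K] [NormedSpace 𝕜 K]
    [FiniteDimensional 𝕜 K] : Module.finrank 𝕜 (K →L[𝕜] 𝕜) = Module.finrank 𝕜 K := by
  rw [← Subspace.dual_finrank_eq (K := 𝕜) (V := K)]
  exact (LinearMap.toContinuousLinearMap (𝕜 := 𝕜) (E := K) (F' := 𝕜)).finrank_eq.symm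

lemma finrank_cotangent_model :
    Module.finrank ℝ (E × (E →L[ℂ] ℂ)) = 2 * Module.finrank ℝ E := by
  have : FiniteDimensional ℝ E := FiniteDimensional.complexToReal E
  have h2 := finrank_real_of_complex (E →L[ℂ] ℂ)
  have h3 := finrank_real_of_complex E
  rw [Module.finrank_prod, h2, h3, finrank_dual]
  omega

lemma IsDefiningFunction.finrank_eq {F : Type u} [NormedAddCommGroup F] [NormedSpace ℂ F]
    [FiniteDimensional ℂ F] {Y : Type v} [TopologicalSpace Y] [ChartedSpace F Y]
    [IsManifold 𝓘(ℂ, F) ∞ Y] {c : ℕ} {S : Set Y} {y₀ : Y} {O : Set F} {ρ : F → (Fin c → ℝ)}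
    (h : IsDefiningFunction S y₀ O ρ) (hy₀ : y₀ ∈ S)
    (hgen : ∀ w : TangentSpace 𝓘(ℂ, F) y₀,
      ∃ a ∈ tangentAt S y₀, ∃ b ∈ tangentAt S y₀, w = a + Complex.I • b) :
    Module.finrank ℝ F =
      2 * c + 2 * Module.finrank ℂ (crTangentAt (F := F) S y₀) := by
  have : FiniteDimensional ℝ F := FiniteDimensional.complexToReal F
  have hy0 := (h.mem_iff' (mem_chart_source F y₀) h.center_mem).1 hy₀
  have h1 := two_mul_finrank_of_generic (fderiv ℝ ρ (chartAt F y₀ y₀)).ker (fun w => by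
    obtain ⟨a, ha, b, hb, hw⟩ := hgen w
    exact ⟨a, (h.mem_tangentAt_center hy₀ a).1 ha, b, (h.mem_tangentAt_center hy₀ b).1 hb, hw⟩)
  have h2 := (fderiv ℝ ρ (chartAt F y₀ y₀)).toLinearMap.finrank_range_add_finrank_ker
  rw [LinearMap.range_eq_top.2 (h.surjective _ h.center_mem hy0), finrank_top] at h2
  have h3 : Module.finrank ℂ (crTangentAt (F := F) S y₀) =
      Module.finrank ℂ (holomorphicPart (fderiv ℝ ρ (chartAt F y₀ y₀)).ker) := by
    rw [h.crTangentAt_center hy₀]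
    rfl
  have h4 : Module.finrank ℝ (Fin c → ℝ) = c := by simp
  rw [h3]
  omega

variable {n k m : ℕ} {M : Set X} {U O' : Set (CotangentBundle E X)}

set_option maxHeartbeats 1000000 in
/-- Near each of its points, the bundle of the nonzero characteristic covectors with Levi forms of
rank `m` is the zero set of a submersion. The complex parts of its tangent spaces are the null
spaces of the restrictions of the symplectic form, and their dimension is given by the rank of the
Levi form. -/
theorem exists_definingFunction_characteristic (hM : IsCRSubmanifold (F := E) M n k)
    (hgen : IsGeneric (F := E) M) (hO' : IsOpen O')
    (hU : U = O' ∩ nonzeroCharacteristicBundle M) {p : CotangentBundle E X} (hp : p ∈ U)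
    (hrank : HasLeviRank (F := E) M p.proj (realCovector p) m) :
    Module.finrank ℝ (E × (E →L[ℂ] ℂ)) = 2 * (2 * n + 2 * k) ∧
    ∃ (O : Set (E × (E →L[ℂ] ℂ))) (R : E × (E →L[ℂ] ℂ) → (Fin (2 * n + 2 * k) → ℝ)),
      IsDefiningFunction U p O R ∧
      (∀ a ∈ O, R a = 0 → ∀ v, fderiv ℝ R a v = 0 →
        (v ∈ holomorphicPart (fderiv ℝ R a).ker ↔
          ∀ w, fderiv ℝ R a w = 0 → symplecticForm v w = 0)) ∧
      Module.finrank ℂ (crTangentAt (F := E × (E →L[ℂ] ℂ)) U p) + m = n := by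
  have : FiniteDimensional ℝ E := FiniteDimensional.complexToReal E
  have : FiniteDimensional ℝ (E →L[ℂ] ℂ) := FiniteDimensional.complexToReal _
  have hpM : p.proj ∈ M := by
    rw [hU] at hp
    exact hp.2.1.1
  obtain ⟨c, hc, O, ρ, h⟩ := hM.1.exists_definingFunction hpM
  have hcr := hM.2 _ hpM
  have hdim := h.finrank_eq hpM (hgen _ hpM)
  rw [hcr] at hdim
  obtain rfl : c = k := by omega
  have hE := finrank_cotangent_model (E := E)
  refine ⟨by omega, ?_⟩
  set e := chartAt E p.proj with he
  have hx0 : ρ (e p.proj) = 0 := (h.mem_iff' (mem_chart_source E p.proj) h.center_mem).1 hpM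
  have hs := h.surjective _ h.center_mem hx0
  have hker : Module.finrank ℝ (EuclideanSpace ℝ (Fin (2 * n + c))) =
      Module.finrank ℝ (fderiv ℝ ρ (e p.proj)).ker := by
    have h2 := (fderiv ℝ ρ (e p.proj)).toLinearMap.finrank_range_add_finrank_ker
    rw [LinearMap.range_eq_top.2 hs, finrank_top, Module.finrank_fin_fun] at h2
    rw [finrank_euclideanSpace_fin]
    omega
  obtain ⟨N, R, hN, hxN, hNO, hR, hRp⟩ := exists_conormal_defining h.isOpen h.contDiffOn
    h.center_mem hs (LinearEquiv.ofFinrankEq _ _ hker).toContinuousLinearEquiv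
  set e' := chartAt (E × (E →L[ℂ] ℂ)) p with he'
  have het : e'.target = e.target ×ˢ univ := chartAt_cotangent_target
  set O₁ : Set (E × (E →L[ℂ] ℂ)) :=
    (N ×ˢ univ) ∩ {a | a.2 ≠ 0} ∩ (e'.target ∩ e'.symm ⁻¹' O') with hO₁
  have hO₁o : IsOpen O₁ := ((hN.prod isOpen_univ).inter
    (isOpen_ne.preimage continuous_snd)).inter (e'.symm.isOpen_inter_preimage hO')
  have hmem : ∀ a ∈ O₁, e'.symm a ∈ U ↔ R a = 0 := by
    rintro a ⟨⟨haN, ha0⟩, ha⟩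
    have hat : a.1 ∈ e.target := h.subset_target (hNO haN.1)
    rw [hU, (hRp a haN.1).2.1, ← mem_characteristicBundle_iff h (hNO haN.1)]
    constructor
    · intro h1
      exact h1.2.1
    · intro h1
      refine ⟨ha.2, h1, fun h2 => ha0 ?_⟩
      exact (realCovector_eq_zero_iff hat).1 h2
  have hpe : e'.symm (e' p) = p := e'.left_inv (mem_chart_source _ p)
  have hfst : (e' p).1 = e p.proj := chartAt_cotangent_fst
  have hcen : e' p ∈ O₁ := by
    refine ⟨⟨⟨by rw [hfst]; exact hxN, mem_univ _⟩, ?_⟩, mem_chart_target _ p, ?_⟩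
    · intro h0
      have h1 := (realCovector_eq_zero_iff (p := p) (a := e' p)
        (by rw [hfst]; exact mem_chart_target E p.proj)).2 h0
      rw [← he', hpe] at h1
      rw [hU] at hp
      exact hp.2.2 h1
    · rw [mem_preimage, hpe]
      rw [hU] at hp
      exact hp.1
  have hdef : IsDefiningFunction U p O₁ R :=
    { isOpen := hO₁o
      subset_target := fun a ha => ha.2.1
      center_mem := hcen
      contDiffOn := hR.mono fun a ha => ha.1.1
      surjective := fun a ha ha0 => ((hRp a ha.1.1.1).2.2 ha0).1
      mem_iff := hmem }
  -- the tangent spaces in terms of the form `t` that represents the imaginary part of the covector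
  have htan : ∀ a ∈ O₁, R a = 0 → ∃ t : (Fin c → ℝ) →L[ℝ] ℝ,
      (∀ w, (a.2 w).im = t (fderiv ℝ ρ a.1 w)) ∧
      (fderiv ℝ R a).ker = conormalTangent (fderiv ℝ ρ a.1).ker (hessian ρ t a.1) := by
    intro a ha ha0
    obtain ⟨h1, h2, h3⟩ := hRp a ha.1.1.1
    obtain ⟨t, ht⟩ := exists_factor (f := fderiv ℝ ρ a.1) (β := imCovector a.2) (h2.1 ha0).2
    exact ⟨t, ht, (h3 ha0).2 t ht⟩
  -- the codimension of the bundle is `k + (2 n + k)`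
  have hRc : Module.finrank ℝ ((Fin c → ℝ) × (EuclideanSpace ℝ (Fin (2 * n + c)) →L[ℝ] ℝ)) =
      Module.finrank ℝ (Fin (2 * n + 2 * c) → ℝ) := by
    rw [Module.finrank_prod, finrank_dual, finrank_euclideanSpace_fin, Module.finrank_fin_fun,
      Module.finrank_fin_fun]
    omega
  set l := (LinearEquiv.ofFinrankEq _ _ hRc).toContinuousLinearEquiv
  have hkerl : ∀ a ∈ O₁, ∀ v, fderiv ℝ (fun x => l (R x)) a v = 0 ↔ fderiv ℝ R a v = 0 := by
    intro a ha v
    have h1 : HasFDerivAt (fun x => l (R x)) _ a :=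
      l.hasFDerivAt.comp a ((hdef.contDiffAt ha).differentiableAt (by simp)).hasFDerivAt
    rw [h1.fderiv]
    exact l.map_eq_zero_iff
  refine ⟨O₁, fun x => l (R x), hdef.linear_comp l, ?_, ?_⟩
  · intro a ha ha0 v hv
    have ha0' : R a = 0 := l.map_eq_zero_iff.1 ha0
    obtain ⟨t, -, ht⟩ := htan a ha ha0'
    have h1 : (fderiv ℝ (fun x => l (R x)) a).ker =
        conormalTangent (fderiv ℝ ρ a.1).ker (hessian ρ t a.1) := by
      rw [← ht]
      ext v
      exact hkerl a ha v
    have h2 := mem_holomorphicPart_conormalTangent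
      (hessian_symm (h.contDiffAt (hNO ha.1.1.1)) t) (v := v) (by rw [← h1]; exact hv)
    rw [h1, h2, ← h1]
    rfl
  · have hcen0 : R (e' p) = 0 := by
      rw [← hmem _ hcen, hpe]
      exact hp
    obtain ⟨t, ht, htk⟩ := htan _ hcen hcen0
    obtain ⟨L, hL, hLm⟩ := hrank
    have h1 := hdef.crTangentAt_center hp
    rw [← he', htk, hfst] at h1
    have h2 := h.crTangentAt_center hpM
    rw [← he] at h2
    have hsnd : ∀ w : E, (e' p).2 w = p.snd w := by
      intro w
      have h3 := chartAt_cotangent_snd (p := p) (q := p) (mem_chart_source E p.proj) w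
      rw [chartDeriv_self] at h3
      exact h3
    -- the characteristic covector is `Re Φ`, and `Re Φ(w) = Im Φ(i w) = t (Dρ (i w))`
    have hLQ : ∀ a : crTangentAt (F := E) M p.proj, L a a =
        ((-(hessian ρ t (e p.proj) a.1 a.1 + hessian ρ t (e p.proj)
          (Complex.I • (show E from a.1)) (Complex.I • (show E from a.1))) : ℝ) : ℂ) := by
      intro a
      obtain ⟨N', v, hN', hxN', hN'O, hv, hvm, hva, hLa⟩ := h.exists_section hpM hM.2 hL a
      have h3 := levi_eq_hessian hN' (h.contDiffOn.mono hN'O) hxN' hx0 hs hv hvm t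
      rw [hLa, ← hva, ← h3]
      congr 1
      rw [← he, ← hfst, ← ht, map_smul]
      rw [hfst, hsnd, smul_eq_mul, Complex.I_mul_im]
      rfl
    have hmain : ∀ (D : Submodule ℂ E), D = holomorphicPart (fderiv ℝ ρ (e p.proj)).ker →
        ∀ L : D →ₗ⋆[ℂ] D →ₗ[ℂ] ℂ, (∀ a b, L a b = conj (L b a)) →
        (∀ a : D, L a a = ((-(hessian ρ t (e p.proj) a.1 a.1 + hessian ρ t (e p.proj)
          (Complex.I • a.1) (Complex.I • a.1)) : ℝ) : ℂ)) →
        Module.finrank ℂ (holomorphicPart (conormalTangent (fderiv ℝ ρ (e p.proj)).ker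
          (hessian ρ t (e p.proj)))) + Module.finrank ℂ L.range = Module.finrank ℂ D := by
      rintro D rfl L hL hLQ
      refine finrank_holomorphicPart_conormalTangent
        (hessian_symm (h.contDiffAt h.center_mem) t) ?_ L hL hLQ
      intro w
      obtain ⟨a, ha, b, hb, hw⟩ := hgen _ hpM w
      exact ⟨a, (h.mem_tangentAt_center hpM a).1 ha, b, (h.mem_tangentAt_center hpM b).1 hb, hw⟩
    have h3 := hmain _ h2 L hL.1 hLQ
    rw [h1, ← hLm, ← hcr]
    exact h3

end Structure

/-! ### Foliated charts -/

section FoliatedCharts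

variable {F : Type u} [NormedAddCommGroup F] [NormedSpace ℂ F]
  {Y : Type v} [TopologicalSpace Y] [ChartedSpace F Y]

/-- A foliated chart `Ψ` of an open piece `S ∩ W` of `S`, together with extensions `κ` and `τ` to
`W` of the two components of its inverse; only their values on `S ∩ W` and their regularity
matter. The plaques `Ψ (ball × {t})` are complex submanifolds
that are tangent to the holomorphic tangent spaces of `S`. -/
structure FoliatedChart (F : Type u) [NormedAddCommGroup F] [NormedSpace ℂ F]
    {Y : Type v} [TopologicalSpace Y] [ChartedSpace F Y] (S : Set Y) (d : ℕ) where
  /-- the codimension of the plaques -/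
  q : ℕ
  /-- the domain of the inverse -/
  W : Set Y
  /-- the parametrization -/
  Ψ : EuclideanSpace ℂ (Fin d) × EuclideanSpace ℝ (Fin q) → Y
  /-- the coordinates along the plaques -/
  κ : Y → EuclideanSpace ℂ (Fin d)
  /-- the coordinates transverse to the plaques -/
  τ : Y → EuclideanSpace ℝ (Fin q)
  isOpen : IsOpen W
  contMDiffOn_Ψ : ContMDiffOn 𝓘(ℝ, EuclideanSpace ℂ (Fin d) × EuclideanSpace ℝ (Fin q)) 𝓘(ℝ, F) ∞
    Ψ (Metric.ball 0 1 ×ˢ Metric.ball 0 1)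
  contMDiffOn_κ : ContMDiffOn 𝓘(ℂ, F) 𝓘(ℂ, EuclideanSpace ℂ (Fin d)) ∞ κ W
  contMDiffOn_τ : ContMDiffOn 𝓘(ℝ, F) 𝓘(ℝ, EuclideanSpace ℝ (Fin q)) ∞ τ W
  mapsTo : ∀ z ∈ Metric.ball (0 : EuclideanSpace ℂ (Fin d)) 1,
    ∀ t ∈ Metric.ball (0 : EuclideanSpace ℝ (Fin q)) 1, Ψ (z, t) ∈ S ∩ W
  κ_Ψ : ∀ z ∈ Metric.ball (0 : EuclideanSpace ℂ (Fin d)) 1,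
    ∀ t ∈ Metric.ball (0 : EuclideanSpace ℝ (Fin q)) 1, κ (Ψ (z, t)) = z
  τ_Ψ : ∀ z ∈ Metric.ball (0 : EuclideanSpace ℂ (Fin d)) 1,
    ∀ t ∈ Metric.ball (0 : EuclideanSpace ℝ (Fin q)) 1, τ (Ψ (z, t)) = t
  κ_mem : ∀ y ∈ S ∩ W, κ y ∈ Metric.ball (0 : EuclideanSpace ℂ (Fin d)) 1
  τ_mem : ∀ y ∈ S ∩ W, τ y ∈ Metric.ball (0 : EuclideanSpace ℝ (Fin q)) 1
  Ψ_κ_τ : ∀ y ∈ S ∩ W, Ψ (κ y, τ y) = y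
  holomorphic : ∀ t ∈ Metric.ball (0 : EuclideanSpace ℝ (Fin q)) 1,
    ContMDiffOn 𝓘(ℂ, EuclideanSpace ℂ (Fin d)) 𝓘(ℂ, F) ∞ (fun z => Ψ (z, t)) (Metric.ball 0 1)
  tangent : ∀ t ∈ Metric.ball (0 : EuclideanSpace ℝ (Fin q)) 1,
    ∀ z ∈ Metric.ball (0 : EuclideanSpace ℂ (Fin d)) 1, ∀ h : EuclideanSpace ℂ (Fin d),
      (mfderiv 𝓘(ℝ, EuclideanSpace ℂ (Fin d)) 𝓘(ℝ, F) (fun z => Ψ (z, t)) z h : F) ∈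
        crTangentAt (F := F) S (Ψ (z, t))

/-- Holomorphic maps are smooth for the underlying real structures. -/
lemma contMDiffOn_real {F' : Type*} [NormedAddCommGroup F'] [NormedSpace ℂ F'] {Y' : Type*}
    [TopologicalSpace Y'] [ChartedSpace F' Y'] {f : Y → Y'} {A : Set Y}
    (h : ContMDiffOn 𝓘(ℂ, F) 𝓘(ℂ, F') ∞ f A) : ContMDiffOn 𝓘(ℝ, F) 𝓘(ℝ, F') ∞ f A :=
  fun x hx => ⟨(h x hx).1, ContDiffWithinAt.restrict_scalars ℝ (h x hx).2⟩

variable [FiniteDimensional ℂ F] [IsManifold 𝓘(ℂ, F) ∞ Y] {S : Set Y} {d : ℕ}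

set_option maxHeartbeats 1000000 in
/-- If the holomorphic tangent spaces of `S` have constant dimension and are the null spaces of the
restrictions of a two-form that is constant in a chart, then there are foliated charts. -/
theorem IsDefiningFunction.exists_foliatedChart {H : Type*} [NormedAddCommGroup H]
    [NormedSpace ℝ H] [FiniteDimensional ℝ H] {V : Type*} [NormedAddCommGroup V] [NormedSpace ℝ V]
    {y₀ : Y} {O : Set F} {ρ : F → H} (h : IsDefiningFunction S y₀ O ρ) (hy₀ : y₀ ∈ S)
    (hd : ∀ y ∈ S, Module.finrank ℂ (crTangentAt (F := F) S y) = d)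
    (σ : F →L[ℝ] F →L[ℝ] V) (hσ : ∀ a b, σ a b = -σ b a)
    (hker : ∀ y ∈ O, ρ y = 0 → ∀ v, fderiv ℝ ρ y v = 0 →
      (v ∈ holomorphicPart (fderiv ℝ ρ y).ker ↔ ∀ w, fderiv ℝ ρ y w = 0 → σ v w = 0)) :
    ∃ c : FoliatedChart F S d, y₀ ∈ c.W := by
  set e := chartAt F y₀ with he
  have hy0 := (h.mem_iff' (mem_chart_source F y₀) h.center_mem).1 hy₀
  have hd' : ∀ x ∈ O, ρ x = 0 → Module.finrank ℂ (holomorphicPart (fderiv ℝ ρ x).ker) =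
      Module.finrank ℂ (EuclideanSpace ℂ (Fin d)) := by
    intro x hx hx0
    have hxt := h.subset_target hx
    have h1 := h.finrank_crTangentAt (e.map_target hxt) (by
        change e _ ∈ O
        rw [e.right_inv hxt]; exact hx) ((h.mem_iff x hx).2 hx0)
    rw [← he, e.right_inv hxt, hd _ ((h.mem_iff x hx).2 hx0)] at h1
    rw [← h1]
    simp
  obtain ⟨q, W, Ψ, κ, τ, hW, hyW, hWO, hΨ, hκ, hτ, hΨW, hWΨ, hΨt⟩ :=
    exists_flat_foliated_chart h.isOpen h.contDiffOn σ hσ hd' hker h.center_mem hy0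
      (h.surjective _ h.center_mem hy0)
  have hWt : W ⊆ e.target := hWO.trans h.subset_target
  have heΨ : ∀ a ∈ Metric.ball (0 : EuclideanSpace ℂ (Fin d)) 1 ×ˢ
      Metric.ball (0 : EuclideanSpace ℝ (Fin q)) 1, e (e.symm (Ψ a)) = Ψ a :=
    fun a ha => e.right_inv (hWt (hΨW a ha).1)
  have hW0 : ∀ y ∈ S ∩ (e.source ∩ e ⁻¹' W), ρ (e y) = 0 := fun y hy =>
    (h.mem_iff' hy.2.1 (hWO hy.2.2)).1 hy.1
  have hΨ' : ContMDiffOn 𝓘(ℝ, EuclideanSpace ℂ (Fin d) × EuclideanSpace ℝ (Fin q)) 𝓘(ℝ, F) ∞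
      (fun a => e.symm (Ψ a)) (Metric.ball 0 1 ×ˢ Metric.ball 0 1) :=
    (contMDiffOn_chart_symm_real (y₀ := y₀)).comp hΨ.contMDiffOn
      fun a ha => hWt (hΨW a ha).1
  have hκ' : ContMDiffOn 𝓘(ℂ, F) 𝓘(ℂ, EuclideanSpace ℂ (Fin d)) ∞ (fun y => κ (e y))
      (e.source ∩ e ⁻¹' W) :=
    hκ.contMDiffOn.comp (contMDiffOn_chart.mono inter_subset_left) fun y hy => hy.2
  have hτ' : ContMDiffOn 𝓘(ℝ, F) 𝓘(ℝ, EuclideanSpace ℝ (Fin q)) ∞ (fun y => τ (e y))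
      (e.source ∩ e ⁻¹' W) :=
    hτ.contMDiffOn.comp (contMDiffOn_chart_real.mono inter_subset_left) fun y hy => hy.2
  refine ⟨{ q := q
            W := e.source ∩ e ⁻¹' W
            Ψ := fun a => e.symm (Ψ a)
            κ := fun y => κ (e y)
            τ := fun y => τ (e y)
            isOpen := e.isOpen_inter_preimage hW
            contMDiffOn_Ψ := hΨ'
            contMDiffOn_κ := hκ'
            contMDiffOn_τ := hτ'
            mapsTo := fun z hz t ht => ?_
            κ_Ψ := fun z hz t ht => ?_
            τ_Ψ := fun z hz t ht => ?_
            κ_mem := fun y hy => (hWΨ (e y) hy.2.2 (hW0 y hy)).1.1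
            τ_mem := fun y hy => (hWΨ (e y) hy.2.2 (hW0 y hy)).1.2
            Ψ_κ_τ := fun y hy => ?_
            holomorphic := fun t ht => ?_
            tangent := fun t ht z hz v => ?_ }, mem_chart_source F y₀, hyW⟩
  · have h1 := hΨW (z, t) (mk_mem_prod hz ht)
    refine ⟨(h.mem_iff _ (hWO h1.1)).2 h1.2.1, e.map_target (hWt h1.1), ?_⟩
    rw [mem_preimage, heΨ (z, t) (mk_mem_prod hz ht)]
    exact h1.1
  · rw [heΨ (z, t) (mk_mem_prod hz ht)]
    exact (hΨW (z, t) (mk_mem_prod hz ht)).2.2.1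
  · rw [heΨ (z, t) (mk_mem_prod hz ht)]
    exact (hΨW (z, t) (mk_mem_prod hz ht)).2.2.2
  · rw [(hWΨ (e y) hy.2.2 (hW0 y hy)).2, e.left_inv hy.2.1]
  · exact (contMDiffOn_chart_symm (I := 𝓘(ℂ, F)) (x := y₀)).comp (hΨt t ht).1.contMDiffOn
      fun z hz => hWt (hΨW (z, t) (mk_mem_prod hz ht)).1
  · have h1 := hΨW (z, t) (mk_mem_prod hz ht)
    have hsrc := e.map_target (hWt h1.1)
    have hS := (h.mem_iff _ (hWO h1.1)).2 h1.2.1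
    have hri := heΨ (z, t) (mk_mem_prod hz ht)
    refine (h.mem_crTangentAt hsrc (by rw [← he, hri]; exact hWO h1.1) hS _).2 ?_
    rw [← he, hri]
    have h2 : DifferentiableAt ℝ (fun z => Ψ (z, t)) z :=
      (((hΨt t ht).1.restrict_scalars ℝ).contDiffAt
        (Metric.isOpen_ball.mem_nhds hz)).differentiableAt (by simp)
    have h3 : MDifferentiableAt 𝓘(ℝ, F) 𝓘(ℝ, F) e.symm (Ψ (z, t)) :=
      ((contMDiffOn_chart_symm_real (y₀ := y₀)).contMDiffAt
        (e.open_target.mem_nhds (hWt h1.1))).mdifferentiableAt (by simp)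
    have h4 := h3.hasMFDerivAt.comp z h2.hasFDerivAt.hasMFDerivAt
    have h5 := DFunLike.congr_fun h4.mfderiv v
    have h6 := chartDeriv_mfderiv_symm (y₀ := y₀) (hWt h1.1) (fderiv ℝ (fun z => Ψ (z, t)) z v)
    have h7 : chartDeriv F y₀ (e.symm (Ψ (z, t)))
        (mfderiv 𝓘(ℝ, EuclideanSpace ℂ (Fin d)) 𝓘(ℝ, F) (fun z => e.symm (Ψ (z, t))) z v) =
        fderiv ℝ (fun z => Ψ (z, t)) z v :=
      (congrArg (chartDeriv F y₀ (e.symm (Ψ (z, t)))) h5).trans h6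
    rw [h7]
    exact (hΨt t ht).2 z hz v

namespace FoliatedChart

variable (c c' : FoliatedChart F S d)

omit [IsManifold 𝓘(ℂ, F) ∞ Y] in
/-- The differential of `τ` vanishes on the holomorphic tangent spaces: they are spanned by the
tangent vectors of the plaques, for reasons of dimension. -/
lemma mfderiv_τ_eq_zero (hd : ∀ y ∈ S, Module.finrank ℂ (crTangentAt (F := F) S y) = d)
    {y : Y} (hy : y ∈ S ∩ c.W) (v : F) (hv : v ∈ crTangentAt (F := F) S y) :
    mfderiv 𝓘(ℝ, F) 𝓘(ℝ, EuclideanSpace ℝ (Fin c.q)) c.τ y v = 0 := by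
  set z₀ := c.κ y with hz₀
  set t := c.τ y with ht₀
  have hz := c.κ_mem y hy
  have ht := c.τ_mem y hy
  have hΨy : c.Ψ (z₀, t) = y := c.Ψ_κ_τ y hy
  set g : EuclideanSpace ℂ (Fin d) → Y := fun z => c.Ψ (z, t) with hg
  have hgd : MDifferentiableAt 𝓘(ℝ, EuclideanSpace ℂ (Fin d)) 𝓘(ℝ, F) g z₀ :=
    ((contMDiffOn_real (c.holomorphic t ht)).contMDiffAt
      (Metric.isOpen_ball.mem_nhds hz)).mdifferentiableAt (by simp)
  have hW := c.isOpen.mem_nhds hy.2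
  have hκd : MDifferentiableAt 𝓘(ℝ, F) 𝓘(ℝ, EuclideanSpace ℂ (Fin d)) c.κ y :=
    ((contMDiffOn_real c.contMDiffOn_κ).contMDiffAt hW).mdifferentiableAt (by simp)
  have hτd : MDifferentiableAt 𝓘(ℝ, F) 𝓘(ℝ, EuclideanSpace ℝ (Fin c.q)) c.τ y :=
    (c.contMDiffOn_τ.contMDiffAt hW).mdifferentiableAt (by simp)
  set D : EuclideanSpace ℂ (Fin d) →L[ℝ] F :=
    mfderiv 𝓘(ℝ, EuclideanSpace ℂ (Fin d)) 𝓘(ℝ, F) g z₀ with hD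
  have hgy : g z₀ = y := hΨy
  rw [← hgy] at hκd hτd
  -- `κ` is a left inverse of the parametrization of the plaque, and `τ` is constant on the plaque
  have hκD : ∀ h, mfderiv 𝓘(ℝ, F) 𝓘(ℝ, EuclideanSpace ℂ (Fin d)) c.κ (g z₀) (D h) = h := by
    intro h
    have h1 := hκd.hasMFDerivAt.comp z₀ hgd.hasMFDerivAt
    have h2 : id =ᶠ[𝓝 z₀] c.κ ∘ g := by
      filter_upwards [Metric.isOpen_ball.mem_nhds hz] with z hz
      exact (c.κ_Ψ z hz t ht).symm
    have h3 := hasMFDerivAt_unique (h1.congr_of_eventuallyEq h2) (hasMFDerivAt_id z₀)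
    exact DFunLike.congr_fun h3 h
  have hτD : ∀ h, mfderiv 𝓘(ℝ, F) 𝓘(ℝ, EuclideanSpace ℝ (Fin c.q)) c.τ (g z₀) (D h) = 0 := by
    intro h
    have h1 := hτd.hasMFDerivAt.comp z₀ hgd.hasMFDerivAt
    have h2 : (fun _ => t) =ᶠ[𝓝 z₀] c.τ ∘ g := by
      filter_upwards [Metric.isOpen_ball.mem_nhds hz] with z hz
      exact (c.τ_Ψ z hz t ht).symm
    have h3 := hasMFDerivAt_unique (h1.congr_of_eventuallyEq h2) (hasMFDerivAt_const t z₀)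
    exact DFunLike.congr_fun h3 h
  have hDm : ∀ h, D h ∈ crTangentAt (F := F) S (g z₀) := fun h => c.tangent t ht z₀ hz h
  have hfr := hd (g z₀) (by rw [hgy]; exact hy.1)
  have hv' : v ∈ crTangentAt (F := F) S (g z₀) := by
    rw [hgy]
    exact hv
  rw [← hgy]
  have hspan : ∀ T : Submodule ℂ F, Module.finrank ℂ T = d → (∀ h, D h ∈ T) →
      ∀ v ∈ T, ∃ h, D h = v := by
    intro T hT hDT v hv
    set f : EuclideanSpace ℂ (Fin d) →ₗ[ℝ] T.restrictScalars ℝ :=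
      D.toLinearMap.codRestrict (T.restrictScalars ℝ) hDT
    have hf : Function.Injective f := by
      intro a b hab
      have h1 : D a = D b := congrArg Subtype.val hab
      rw [← hκD a, h1, hκD b]
    have h2 : Module.finrank ℝ (EuclideanSpace ℂ (Fin d)) =
        Module.finrank ℝ (T.restrictScalars ℝ) := by
      rw [finrank_real_of_complex, finrank_euclideanSpace_fin, ← hT]
      exact (finrank_real_of_complex T).symm
    have : FiniteDimensional ℝ F := FiniteDimensional.complexToReal F
    obtain ⟨a, ha⟩ := (LinearMap.injective_iff_surjective_of_finrank_eq_finrank h2).1 hf ⟨v, hv⟩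
    exact ⟨a, congrArg Subtype.val ha⟩
  obtain ⟨h, rfl⟩ := hspan _ hfr hDm v hv'
  exact hτD h

omit [IsManifold 𝓘(ℂ, F) ∞ Y] in
/-- The transverse coordinates of one foliated chart are locally constant on the plaques of another
one. -/
lemma τ_eventually_eq (hd : ∀ y ∈ S, Module.finrank ℂ (crTangentAt (F := F) S y) = d)
    {t : EuclideanSpace ℝ (Fin c.q)} (ht : t ∈ Metric.ball 0 1) {z₀ : EuclideanSpace ℂ (Fin d)}
    (hz₀ : z₀ ∈ Metric.ball 0 1) (hW : c.Ψ (z₀, t) ∈ c'.W) :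
    ∀ᶠ z in 𝓝 z₀, z ∈ Metric.ball 0 1 ∧ c.Ψ (z, t) ∈ c'.W ∧
      c'.τ (c.Ψ (z, t)) = c'.τ (c.Ψ (z₀, t)) := by
  set B : Set (EuclideanSpace ℂ (Fin d)) := Metric.ball 0 1
  set g : EuclideanSpace ℂ (Fin d) → Y := fun z => c.Ψ (z, t) with hg
  have hgs := contMDiffOn_real (c.holomorphic t ht)
  have hA : IsOpen (B ∩ g ⁻¹' c'.W) :=
    hgs.continuousOn.isOpen_inter_preimage Metric.isOpen_ball c'.isOpen
  obtain ⟨ε, hε, hball⟩ := Metric.isOpen_iff.1 hA z₀ ⟨hz₀, hW⟩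
  have hderiv : ∀ z ∈ B ∩ g ⁻¹' c'.W, HasFDerivAt (c'.τ ∘ g)
      (0 : EuclideanSpace ℂ (Fin d) →L[ℝ] EuclideanSpace ℝ (Fin c'.q)) z := by
    intro z hz
    have hgd : MDifferentiableAt 𝓘(ℝ, EuclideanSpace ℂ (Fin d)) 𝓘(ℝ, F) g z :=
      (hgs.contMDiffAt (Metric.isOpen_ball.mem_nhds hz.1)).mdifferentiableAt (by simp)
    have hτd : MDifferentiableAt 𝓘(ℝ, F) 𝓘(ℝ, EuclideanSpace ℝ (Fin c'.q)) c'.τ (g z) :=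
      (c'.contMDiffOn_τ.contMDiffAt (c'.isOpen.mem_nhds hz.2)).mdifferentiableAt (by simp)
    have h1 := (hτd.hasMFDerivAt.comp z hgd.hasMFDerivAt).hasFDerivAt
    refine h1.congr_fderiv ?_
    ext1 h
    exact c'.mfderiv_τ_eq_zero hd ⟨(c.mapsTo z hz.1 t ht).1, hz.2⟩ _ (c.tangent t ht z hz.1 h)
  filter_upwards [Metric.ball_mem_nhds z₀ hε] with z hz
  refine ⟨(hball hz).1, (hball hz).2, ?_⟩
  exact Metric.isOpen_ball.is_const_of_fderiv_eq_zero (𝕜 := ℝ) (f := c'.τ ∘ g)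
    (convex_ball z₀ ε).isPreconnected
    (fun w hw => (hderiv w (hball hw)).differentiableAt.differentiableWithinAt)
    (fun w hw => (hderiv w (hball hw)).fderiv) hz (Metric.mem_ball_self hε)

end FoliatedChart

end FoliatedCharts

/-! ### The leaves -/

section Leaves

variable {F : Type u} [NormedAddCommGroup F] [NormedSpace ℂ F]
  {Y : Type v} [TopologicalSpace Y] [ChartedSpace F Y]
  {S : Set Y} {d : ℕ}

/-- A family of foliated charts whose domains cover `S`. -/
structure FoliatedAtlas (F : Type u) [NormedAddCommGroup F] [NormedSpace ℂ F]
    {Y : Type v} [TopologicalSpace Y] [ChartedSpace F Y] (S : Set Y) (d : ℕ) where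
  /-- the foliated chart around a point -/
  chart : S → FoliatedChart F S d
  mem_chart : ∀ y : S, (y : Y) ∈ (chart y).W
  finrank_eq : ∀ y ∈ S, Module.finrank ℂ (crTangentAt (F := F) S y) = d

/-- The set `S` with the leaf topology, in which the plaques are open. -/
def LeafSpace (_A : FoliatedAtlas F S d) : Type v := S

variable {A : FoliatedAtlas F S d}

/-- The inclusion of the union of the leaves. -/
def LeafSpace.val (y : LeafSpace A) : Y := Subtype.val (p := (· ∈ S)) y

/-- The parametrization of the plaque of a foliated chart at `t`. Outside the unit ball it has a
junk value. -/
def plaqueMap (A : FoliatedAtlas F S d) (y : S) {t : EuclideanSpace ℝ (Fin (A.chart y).q)}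
    (ht : t ∈ Metric.ball 0 1) (z : EuclideanSpace ℂ (Fin d)) : LeafSpace A :=
  open Classical in
  if hz : z ∈ Metric.ball 0 1 then ⟨(A.chart y).Ψ (z, t), ((A.chart y).mapsTo z hz t ht).1⟩
  else ⟨(A.chart y).Ψ (0, t), ((A.chart y).mapsTo 0 (Metric.mem_ball_self one_pos) t ht).1⟩

lemma plaqueMap_val {y : S} {t : EuclideanSpace ℝ (Fin (A.chart y).q)}
    (ht : t ∈ Metric.ball 0 1) {z : EuclideanSpace ℂ (Fin d)} (hz : z ∈ Metric.ball 0 1) :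
    (plaqueMap A y ht z).val = (A.chart y).Ψ (z, t) := by
  rw [plaqueMap]
  exact congrArg (LeafSpace.val (A := A)) (dif_pos hz)

lemma LeafSpace.ext {a b : LeafSpace A} (h : a.val = b.val) : a = b := Subtype.ext h

lemma LeafSpace.val_mem (a : LeafSpace A) : a.val ∈ S := Subtype.property (p := (· ∈ S)) a

/-- The leaf topology is the finest one for which the parametrizations of the plaques are
continuous. -/
instance : TopologicalSpace (LeafSpace A) where
  IsOpen V := ∀ (y : S) (t : EuclideanSpace ℝ (Fin (A.chart y).q)) (ht : t ∈ Metric.ball 0 1),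
    IsOpen (Metric.ball 0 1 ∩ plaqueMap A y ht ⁻¹' V)
  isOpen_univ y t ht := by simp
  isOpen_inter V V' h h' y t ht := by
    have h1 := (h y t ht).inter (h' y t ht)
    rwa [← inter_inter_distrib_left, ← preimage_inter] at h1
  isOpen_sUnion s hs y t ht := by
    rw [preimage_sUnion, inter_iUnion₂]
    exact isOpen_biUnion fun V hV => hs V hV y t ht

lemma LeafSpace.isOpen_iff {V : Set (LeafSpace A)} : IsOpen V ↔
    ∀ (y : S) (t : EuclideanSpace ℝ (Fin (A.chart y).q)) (ht : t ∈ Metric.ball 0 1),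
      IsOpen (Metric.ball 0 1 ∩ plaqueMap A y ht ⁻¹' V) := Iff.rfl

lemma continuousOn_plaqueMap {y : S} {t : EuclideanSpace ℝ (Fin (A.chart y).q)}
    (ht : t ∈ Metric.ball 0 1) : ContinuousOn (plaqueMap A y ht) (Metric.ball 0 1) := by
  rw [continuousOn_open_iff Metric.isOpen_ball]
  exact fun V hV => hV y t ht

lemma mem_plaque_iff {y : S} {t : EuclideanSpace ℝ (Fin (A.chart y).q)}
    (ht : t ∈ Metric.ball 0 1) {D : Set (EuclideanSpace ℂ (Fin d))} (hDB : D ⊆ Metric.ball 0 1)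
    {a : LeafSpace A} : a ∈ plaqueMap A y ht '' D ↔
      a.val ∈ (A.chart y).W ∧ (A.chart y).τ a.val = t ∧ (A.chart y).κ a.val ∈ D := by
  constructor
  · rintro ⟨z, hz, rfl⟩
    rw [plaqueMap_val ht (hDB hz), (A.chart y).τ_Ψ z (hDB hz) t ht,
      (A.chart y).κ_Ψ z (hDB hz) t ht]
    exact ⟨((A.chart y).mapsTo z (hDB hz) t ht).2, rfl, hz⟩
  · rintro ⟨h1, rfl, h3⟩
    refine ⟨_, h3, LeafSpace.ext ?_⟩
    rw [plaqueMap_val ht (hDB h3)]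
    exact (A.chart y).Ψ_κ_τ _ ⟨a.val_mem, h1⟩

variable [FiniteDimensional ℂ F] [IsManifold 𝓘(ℂ, F) ∞ Y]

omit [IsManifold 𝓘(ℂ, F) ∞ Y] in
/-- The plaques are open: the transverse coordinate of their chart is locally constant on the
plaques of the other charts. -/
lemma isOpen_plaque {y : S} {t : EuclideanSpace ℝ (Fin (A.chart y).q)}
    (ht : t ∈ Metric.ball 0 1) {D : Set (EuclideanSpace ℂ (Fin d))} (hD : IsOpen D)
    (hDB : D ⊆ Metric.ball 0 1) : IsOpen (plaqueMap A y ht '' D) := by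
  rw [LeafSpace.isOpen_iff]
  intro y' t' ht'
  rw [isOpen_iff_mem_nhds]
  rintro z₀ ⟨hz₀, h₀⟩
  rw [mem_preimage, mem_plaque_iff ht hDB, plaqueMap_val ht' hz₀] at h₀
  obtain ⟨hW, hτ, hκ⟩ := h₀
  have hg : ContinuousAt (fun z => (A.chart y').Ψ (z, t')) z₀ :=
    ((A.chart y').holomorphic t' ht').continuousOn.continuousAt (Metric.isOpen_ball.mem_nhds hz₀)
  have hκc : ContinuousAt (A.chart y).κ ((A.chart y').Ψ (z₀, t')) :=
    (A.chart y).contMDiffOn_κ.continuousOn.continuousAt ((A.chart y).isOpen.mem_nhds hW)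
  filter_upwards [FoliatedChart.τ_eventually_eq (A.chart y') (A.chart y) A.finrank_eq ht' hz₀ hW,
    (hκc.comp (f := fun z => (A.chart y').Ψ (z, t')) hg).preimage_mem_nhds (hD.mem_nhds hκ)]
    with z hz hz'
  refine ⟨hz.1, ?_⟩
  rw [mem_preimage, mem_plaque_iff ht hDB, plaqueMap_val ht' hz.1]
  exact ⟨hz.2.1, hz.2.2.trans hτ, hz'⟩

/-- The inverse of the parametrization of a plaque. -/
def plaqueChart (A : FoliatedAtlas F S d) (y : S) {t : EuclideanSpace ℝ (Fin (A.chart y).q)}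
    (ht : t ∈ Metric.ball 0 1) :
    OpenPartialHomeomorph (LeafSpace A) (EuclideanSpace ℂ (Fin d)) where
  toFun a := (A.chart y).κ a.val
  invFun := plaqueMap A y ht
  source := plaqueMap A y ht '' Metric.ball 0 1
  target := Metric.ball 0 1
  map_source' a ha := ((mem_plaque_iff ht subset_rfl).1 ha).2.2
  map_target' z hz := mem_image_of_mem _ hz
  left_inv' := by
    rintro _ ⟨z, hz, rfl⟩
    rw [plaqueMap_val ht hz, (A.chart y).κ_Ψ z hz t ht]
  right_inv' z hz := by rw [plaqueMap_val ht hz, (A.chart y).κ_Ψ z hz t ht]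
  open_source := isOpen_plaque ht Metric.isOpen_ball subset_rfl
  open_target := Metric.isOpen_ball
  continuousOn_toFun := by
    rw [continuousOn_open_iff (isOpen_plaque ht Metric.isOpen_ball subset_rfl)]
    intro D hD
    convert isOpen_plaque (A := A) ht (Metric.isOpen_ball.inter hD) inter_subset_left using 1
    ext a
    rw [mem_plaque_iff ht inter_subset_left, mem_inter_iff, mem_plaque_iff ht subset_rfl]
    simp only [mem_preimage, mem_inter_iff]
    tauto
  continuousOn_invFun := continuousOn_plaqueMap ht

instance : ChartedSpace (EuclideanSpace ℂ (Fin d)) (LeafSpace A) where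
  atlas := {e | ∃ (y : S) (t : EuclideanSpace ℝ (Fin (A.chart y).q)) (ht : t ∈ Metric.ball 0 1),
    e = plaqueChart A y ht}
  chartAt a := plaqueChart A a ((A.chart a).τ_mem _ ⟨a.val_mem, A.mem_chart a⟩)
  mem_chart_source a := (mem_plaque_iff _ subset_rfl).2
    ⟨A.mem_chart a, rfl, (A.chart a).κ_mem _ ⟨a.val_mem, A.mem_chart a⟩⟩
  chart_mem_atlas a := ⟨a, _, _, rfl⟩

instance : IsManifold 𝓘(ℂ, EuclideanSpace ℂ (Fin d)) ∞ (LeafSpace A) := by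
  refine isManifold_of_contDiffOn _ _ _ ?_
  rintro _ _ ⟨y, t, ht, rfl⟩ ⟨y', t', ht', rfl⟩
  rw [← contMDiffOn_iff_contDiffOn]
  have h1 := (A.chart y').contMDiffOn_κ.comp (((A.chart y).holomorphic t ht).mono
    (t := Metric.ball 0 1 ∩ plaqueMap A y ht ⁻¹' (plaqueChart A y' ht').source)
    inter_subset_left) (fun z hz => by
      have h2 := ((mem_plaque_iff ht' subset_rfl).1 hz.2).1
      rwa [plaqueMap_val ht hz.1] at h2)
  refine (h1.mono ?_).congr ?_
  · rintro z ⟨⟨hz, hz'⟩, -⟩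
    exact ⟨hz, hz'⟩
  · rintro z ⟨⟨hz, hz'⟩, -⟩
    exact congrArg (A.chart y').κ (plaqueMap_val ht hz)

omit [IsManifold 𝓘(ℂ, F) ∞ Y] in
lemma LeafSpace.contMDiff_val :
    ContMDiff 𝓘(ℂ, EuclideanSpace ℂ (Fin d)) 𝓘(ℂ, F) ∞ (LeafSpace.val : LeafSpace A → Y) := by
  intro a
  set ht := (A.chart a).τ_mem _ ⟨a.val_mem, A.mem_chart a⟩
  have h1 : ContMDiffAt 𝓘(ℂ, EuclideanSpace ℂ (Fin d)) 𝓘(ℂ, EuclideanSpace ℂ (Fin d)) ∞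
      (chartAt (EuclideanSpace ℂ (Fin d)) a) a :=
    contMDiffOn_chart.contMDiffAt ((chartAt _ a).open_source.mem_nhds (mem_chart_source _ a))
  have h2 : ContMDiffAt 𝓘(ℂ, EuclideanSpace ℂ (Fin d)) 𝓘(ℂ, F) ∞
      (fun z => (A.chart a).Ψ (z, (A.chart a).τ a.val))
      (chartAt (EuclideanSpace ℂ (Fin d)) a a) :=
    ((A.chart a).holomorphic _ ht).contMDiffAt
      (Metric.isOpen_ball.mem_nhds ((A.chart a).κ_mem _ ⟨a.val_mem, A.mem_chart a⟩))
  refine (h2.comp a h1).congr_of_eventuallyEq ?_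
  filter_upwards [(chartAt (EuclideanSpace ℂ (Fin d)) a).open_source.mem_nhds
    (mem_chart_source _ a)] with b hb
  have h3 := (mem_plaque_iff ht subset_rfl).1 hb
  have h4 := (A.chart a).Ψ_κ_τ _ ⟨b.val_mem, h3.1⟩
  rw [h3.2.1] at h4
  exact h4.symm

instance : LocallyConnectedSpace (LeafSpace A) :=
  ChartedSpace.locallyConnectedSpace (EuclideanSpace ℂ (Fin d)) _

/-- A leaf: a connected component for the leaf topology. -/
def leaf (A : FoliatedAtlas F S d) (i : ConnectedComponents (LeafSpace A)) :
    TopologicalSpace.Opens (LeafSpace A) :=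
  ⟨ConnectedComponents.mk ⁻¹' {i}, by
    obtain ⟨a, rfl⟩ := ConnectedComponents.surjective_coe i
    rw [connectedComponents_preimage_singleton]
    exact isOpen_connectedComponent⟩

instance (i : ConnectedComponents (LeafSpace A)) : ConnectedSpace (leaf A i) := by
  refine isConnected_iff_connectedSpace.1 ?_
  obtain ⟨a, rfl⟩ := ConnectedComponents.surjective_coe i
  change IsConnected (ConnectedComponents.mk ⁻¹' {ConnectedComponents.mk a})
  rw [connectedComponents_preimage_singleton]
  exact isConnected_connectedComponent

omit [IsManifold 𝓘(ℂ, F) ∞ Y] in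
/-- The leaves are immersed: the coordinate `κ` along the plaques is defined on an open subset of
the ambient manifold and restricts to a chart of the leaf. -/
lemma mfderiv_leaf_injective (i : ConnectedComponents (LeafSpace A)) (a : leaf A i) :
    Function.Injective (mfderiv 𝓘(ℂ, EuclideanSpace ℂ (Fin d)) 𝓘(ℂ, F)
      (fun a : leaf A i => a.1.val) a) := by
  have : IsManifold 𝓘(ℂ, EuclideanSpace ℂ (Fin d)) 1 (leaf A i) := .of_le (n := ∞) (by simp)
  have h1 : MDifferentiableAt 𝓘(ℂ, EuclideanSpace ℂ (Fin d)) 𝓘(ℂ, F)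
      (fun a : leaf A i => a.1.val) a :=
    ((LeafSpace.contMDiff_val.comp contMDiff_subtype_val).mdifferentiable (by simp)) a
  have h2 : MDifferentiableAt 𝓘(ℂ, F) 𝓘(ℂ, EuclideanSpace ℂ (Fin d)) (A.chart a.1).κ a.1.val :=
    ((A.chart a.1).contMDiffOn_κ.contMDiffAt
      ((A.chart a.1).isOpen.mem_nhds (A.mem_chart a.1))).mdifferentiableAt (by simp)
  have h3 := (mdifferentiable_chart (I := 𝓘(ℂ, EuclideanSpace ℂ (Fin d))) a).mfderiv_injective
    (mem_chart_source _ a)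
  have h4 : (chartAt (EuclideanSpace ℂ (Fin d)) a : leaf A i → EuclideanSpace ℂ (Fin d)) =
      (A.chart a.1).κ ∘ fun a : leaf A i => a.1.val := rfl
  rw [h4, mfderiv_comp a h2 h1] at h3
  exact Function.Injective.of_comp h3

end Leaves

/-! ### The foliation -/

section Foliation

variable {F : Type u} [NormedAddCommGroup F] [NormedSpace ℂ F]
  {Y : Type v} [TopologicalSpace Y] [ChartedSpace F Y]
  {S : Set Y} {d : ℕ}

namespace FoliatedChart

variable (c : FoliatedChart F S d)

lemma mfderiv_Ψ_injective (a : EuclideanSpace ℂ (Fin d) × EuclideanSpace ℝ (Fin c.q))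
    (ha : a ∈ Metric.ball (0 : EuclideanSpace ℂ (Fin d)) 1 ×ˢ
      Metric.ball (0 : EuclideanSpace ℝ (Fin c.q)) 1) :
    Function.Injective (mfderiv 𝓘(ℝ, EuclideanSpace ℂ (Fin d) × EuclideanSpace ℝ (Fin c.q))
      𝓘(ℝ, F) c.Ψ a) := by
  have hB : IsOpen (Metric.ball (0 : EuclideanSpace ℂ (Fin d)) 1 ×ˢ
      Metric.ball (0 : EuclideanSpace ℝ (Fin c.q)) 1) := Metric.isOpen_ball.prod Metric.isOpen_ball
  have hΨ : MDifferentiableAt 𝓘(ℝ, EuclideanSpace ℂ (Fin d) × EuclideanSpace ℝ (Fin c.q))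
      𝓘(ℝ, F) c.Ψ a :=
    (c.contMDiffOn_Ψ.contMDiffAt (hB.mem_nhds ha)).mdifferentiableAt (by simp)
  have hW := c.isOpen.mem_nhds (c.mapsTo a.1 ha.1 a.2 ha.2).2
  have hκ : MDifferentiableAt 𝓘(ℝ, F) 𝓘(ℝ, EuclideanSpace ℂ (Fin d)) c.κ (c.Ψ a) :=
    ((contMDiffOn_real c.contMDiffOn_κ).contMDiffAt hW).mdifferentiableAt (by simp)
  have hτ : MDifferentiableAt 𝓘(ℝ, F) 𝓘(ℝ, EuclideanSpace ℝ (Fin c.q)) c.τ (c.Ψ a) :=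
    (c.contMDiffOn_τ.contMDiffAt hW).mdifferentiableAt (by simp)
  have h1 : Prod.fst =ᶠ[𝓝 a] c.κ ∘ c.Ψ := by
    filter_upwards [hB.mem_nhds ha] with b hb using (c.κ_Ψ b.1 hb.1 b.2 hb.2).symm
  have h2 : Prod.snd =ᶠ[𝓝 a] c.τ ∘ c.Ψ := by
    filter_upwards [hB.mem_nhds ha] with b hb using (c.τ_Ψ b.1 hb.1 b.2 hb.2).symm
  have h3 := hasMFDerivAt_unique
    ((hκ.hasMFDerivAt.comp a hΨ.hasMFDerivAt).congr_of_eventuallyEq h1)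
    (hasFDerivAt_fst (𝕜 := ℝ)).hasMFDerivAt
  have h4 := hasMFDerivAt_unique
    ((hτ.hasMFDerivAt.comp a hΨ.hasMFDerivAt).congr_of_eventuallyEq h2)
    (hasFDerivAt_snd (𝕜 := ℝ)).hasMFDerivAt
  intro v w hvw
  refine Prod.ext ?_ ?_
  · refine (DFunLike.congr_fun h3 v).symm.trans (Eq.trans ?_ (DFunLike.congr_fun h3 w))
    exact congrArg (mfderiv 𝓘(ℝ, F) 𝓘(ℝ, EuclideanSpace ℂ (Fin d)) c.κ (c.Ψ a)) hvw
  · refine (DFunLike.congr_fun h4 v).symm.trans (Eq.trans ?_ (DFunLike.congr_fun h4 w))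
    exact congrArg (mfderiv 𝓘(ℝ, F) 𝓘(ℝ, EuclideanSpace ℝ (Fin c.q)) c.τ (c.Ψ a)) hvw

lemma isEmbedding_Ψ : IsEmbedding ((Metric.ball (0 : EuclideanSpace ℂ (Fin d)) 1 ×ˢ
    Metric.ball (0 : EuclideanSpace ℝ (Fin c.q)) 1).domRestrict c.Ψ) := by
  set BT : Set (EuclideanSpace ℂ (Fin d) × EuclideanSpace ℝ (Fin c.q)) :=
    Metric.ball 0 1 ×ˢ Metric.ball 0 1
  let f : BT ≃ₜ (S ∩ c.W : Set Y) :=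
    { toFun := fun a => ⟨c.Ψ a.1, c.mapsTo a.1.1 a.2.1 a.1.2 a.2.2⟩
      invFun := fun y => ⟨(c.κ y, c.τ y), c.κ_mem y y.2, c.τ_mem y y.2⟩
      left_inv := fun a => Subtype.ext (Prod.ext (c.κ_Ψ a.1.1 a.2.1 a.1.2 a.2.2)
        (c.τ_Ψ a.1.1 a.2.1 a.1.2 a.2.2))
      right_inv := fun y => Subtype.ext (c.Ψ_κ_τ y y.2)
      continuous_toFun := (continuousOn_iff_continuous_domRestrict.1
        c.contMDiffOn_Ψ.continuousOn).subtype_mk _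
      continuous_invFun := ((continuousOn_iff_continuous_domRestrict.1
        (c.contMDiffOn_κ.continuousOn.mono inter_subset_right)).prodMk
          (continuousOn_iff_continuous_domRestrict.1
        (c.contMDiffOn_τ.continuousOn.mono inter_subset_right))).subtype_mk _ }
  exact IsEmbedding.subtypeVal.comp f.isEmbedding

lemma image_Ψ : c.Ψ '' (Metric.ball 0 1 ×ˢ Metric.ball 0 1) = S ∩ c.W := by
  refine Subset.antisymm ?_ fun y hy => ⟨_, mk_mem_prod (c.κ_mem y hy) (c.τ_mem y hy), c.Ψ_κ_τ y hy⟩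
  rintro _ ⟨a, ha, rfl⟩
  exact c.mapsTo a.1 ha.1 a.2 ha.2

end FoliatedChart

variable [FiniteDimensional ℂ F] [IsManifold 𝓘(ℂ, F) ∞ Y]

/-- The leaves of a foliated atlas form a foliation. -/
def FoliatedAtlas.foliation (A : FoliatedAtlas F S d) : ComplexFoliation F S d where
  ι := ConnectedComponents (LeafSpace A)
  Leaf i := leaf A i
  incl i a := a.1.val
  incl_injective i a b h := Subtype.ext (LeafSpace.ext h)
  incl_holomorphic i := LeafSpace.contMDiff_val.comp contMDiff_subtype_val
  incl_immersion := mfderiv_leaf_injective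
  leaves_disjoint i j hij := by
    rw [Set.disjoint_left]
    rintro _ ⟨a, rfl⟩ ⟨b, hb⟩
    exact hij (a.2.symm.trans ((congrArg ConnectedComponents.mk (LeafSpace.ext hb)).symm.trans b.2))
  leaves_cover := by
    refine Subset.antisymm (iUnion_subset fun i => ?_) fun y hy => ?_
    · rintro _ ⟨a, rfl⟩
      exact a.1.val_mem
    · exact mem_iUnion.2 ⟨ConnectedComponents.mk (⟨y, hy⟩ : LeafSpace A), ⟨⟨y, hy⟩, rfl⟩, rfl⟩
  exists_chart y hy := by
    set y' : S := ⟨y, hy⟩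
    set c := A.chart y' with hc
    refine ⟨c.q, c.Ψ, c.contMDiffOn_Ψ, c.mfderiv_Ψ_injective, c.isEmbedding_Ψ,
      ⟨c.W, c.isOpen, A.mem_chart y', c.image_Ψ⟩, fun t ht => ⟨c.holomorphic t ht, ?_⟩⟩
    have himage : c.Ψ '' (Metric.ball 0 1 ×ˢ {t}) =
        LeafSpace.val '' (plaqueMap A y' ht '' Metric.ball 0 1) := by
      rw [image_image]
      ext x
      constructor
      · rintro ⟨⟨z, t'⟩, ⟨hz, rfl⟩, rfl⟩
        exact ⟨z, hz, plaqueMap_val ht hz⟩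
      · rintro ⟨z, hz, rfl⟩
        exact ⟨(z, t), ⟨hz, rfl⟩, (plaqueMap_val ht hz).symm⟩
    have h0 : (0 : EuclideanSpace ℂ (Fin d)) ∈ Metric.ball 0 1 := Metric.mem_ball_self one_pos
    have hconn : IsPreconnected (plaqueMap A y' ht '' Metric.ball 0 1) :=
      (convex_ball 0 1).isPreconnected.image _ (continuousOn_plaqueMap ht)
    refine ⟨ConnectedComponents.mk (plaqueMap A y' ht 0), ?_, ?_⟩
    · rw [himage]
      rintro _ ⟨a, ha, rfl⟩
      refine ⟨⟨a, ?_⟩, rfl⟩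
      exact ConnectedComponents.coe_eq_coe'.2
        (hconn.subset_connectedComponent (mem_image_of_mem _ h0) ha)
    · rw [himage]
      convert (isOpen_plaque (A := A) ht Metric.isOpen_ball subset_rfl).preimage
        (continuous_subtype_val (p := fun a => a ∈ leaf A (ConnectedComponents.mk
          (plaqueMap A y' ht 0)))) using 1
      ext a
      constructor
      · rintro ⟨b, hb, hba⟩
        have h1 : b = a.1 := LeafSpace.ext hba
        exact mem_preimage.2 (h1 ▸ hb)
      · intro ha
        exact ⟨a.1, ha, rfl⟩

end Foliation

end CRGeometry

end

theorem theorem4p3 {E : Type*} [NormedAddCommGroup E] [NormedSpace ℂ E] [FiniteDimensional ℂ E]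
    {X : Type*} [TopologicalSpace X] [T2Space X] [ChartedSpace E X] [IsManifold 𝓘(ℂ, E) ∞ X]
    (n k m : ℕ) (M : Set X)
    (hM : CRGeometry.IsCRSubmanifold (F := E) M n k)
    (hgen : CRGeometry.IsGeneric (F := E) M)
    (U : Set (CRGeometry.CotangentBundle E X))
    (hU : ∃ O : Set (CRGeometry.CotangentBundle E X), IsOpen O ∧
      U = O ∩ CRGeometry.nonzeroCharacteristicBundle M)
    (hrank : ∀ p ∈ U,
      CRGeometry.HasLeviRank (F := E) M p.proj (CRGeometry.realCovector p) m) :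
    CRGeometry.IsCRSubmanifold (F := E × (E →L[ℂ] ℂ)) U (n - m) (2 * k + 2 * m) ∧
    CRGeometry.IsLeviFlat (F := E × (E →L[ℂ] ℂ)) U ∧
    Nonempty (CRGeometry.ComplexFoliation (E × (E →L[ℂ] ℂ)) U (n - m)) ∧
    (m < n → U.Nonempty → ¬ CRGeometry.IsGeneric (F := E × (E →L[ℂ] ℂ)) U) := by
  obtain ⟨O', hO', hUO⟩ := hU
  have h := fun p hp =>
    CRGeometry.exists_definingFunction_characteristic hM hgen hO' hUO hp (hrank p hp)
  have hfin : ∀ p ∈ U, Module.finrank ℂ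
      (CRGeometry.crTangentAt (F := E × (E →L[ℂ] ℂ)) U p) = n - m := by
    intro p hp
    obtain ⟨-, O, R, -, -, hd⟩ := h p hp
    omega
  refine ⟨⟨CRGeometry.isSmoothSubmanifold_of_definingFunction fun p hp => ?_, hfin⟩,
    fun p hp ξ hξ => ?_, ⟨CRGeometry.FoliatedAtlas.foliation ?_⟩, fun hmn hne hgenU => ?_⟩
  · obtain ⟨hE, O, R, hR, -, hd⟩ := h p hp
    exact ⟨2 * n + 2 * k, by omega, O, R, hR⟩
  · obtain ⟨-, O, R, hR, hker, -⟩ := h p hp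
    exact hR.isLeviForm_zero hp CRGeometry.symplecticForm CRGeometry.symplecticForm_skew hker ξ hξ
  · have hc : ∀ p : U, ∃ c : CRGeometry.FoliatedChart (E × (E →L[ℂ] ℂ)) U (n - m),
        (p : CRGeometry.CotangentBundle E X) ∈ c.W := by
      intro p
      obtain ⟨-, O, R, hR, hker, -⟩ := h p p.2
      exact hR.exists_foliatedChart p.2 hfin CRGeometry.symplecticForm
        CRGeometry.symplecticForm_skew hker
    choose c hc using hc
    exact ⟨c, hc, hfin⟩
  · obtain ⟨p, hp⟩ := hne
    obtain ⟨hE, O, R, hR, -, hd⟩ := h p hp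
    have h1 := hR.finrank_eq hp (hgenU p hp)
    omega
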